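/- A regular commutative grammar $G=(\Sigma,S,s_0,\delta)$ consists of a finite alphabet $\Sigma$, a finite set $S$ of states, an initial state $s_0\in S$ and a finite set $\delta\subseteq S\times\mathbb N^\Sigma\times\mathbb N^S$ of transitions $\tau=(s,a,t)$ (source $s$, output $a$, target $t$) with $\sum_{x}a(x)\le 1$ and $\sum_{q}t(q)\le 1$. A run of $G$ is a multiset $D\in\mathbb N^\delta$ such that (i) for every state $q$, $$\sum_{(s,a,t)\in\delta,\ s=q}D(s,a,t)=[q=s_0]+\sum_{(s,a,t)\in\delta}D(s,a,t)\,t(q),$$ (ii) every state that is the source of some transition $\tau$ with $D(\tau)>0$ can be reached from $s_0$ by a (possibly empty) path of transitions $\tau$ with $D(\tau)>0$, where a transition $(s,a,t)$ leads from $s$ to the states $q$ with $t(q)>0$. Let ${\rm out}(G)=\big\{\sum_{(s,a,t)\in\delta}D(s,a,t)\,a \;:\; D\text{ a run of }G\big\}\subseteq\mathbb N^\Sigma$; equivalently, ${\rm out}(G)$ is the Parikh image of the language of the corresponding non-deterministic finite automaton. Theorem. Let $\Sigma$ be a fixed finite alphabet. The following problem is in P: given a regular commutative grammar $G$ over $\Sigma$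 (encoded by its number of states, its initial state and a list of its transitions) and a multiset $K\in\mathbb N^\Sigma$ (encoded by its multiplicities written in binary), decide whether $K\in{\rm out}(G)$. That is, for each $\Sigma$ there are a Turing machine and a polynomial $p$ such that the machine decides every instance $(G,K)$ in at most $p(\ell)$ steps, where $\ell$ is the length of the encoding of $(G,K)$. -/

import Mathlib

open Classical in
/-- The indicator multiset of an optional element: `0` for `none`, and `{x}` for `some x`. -/
noncomputable def optMultiset {X : Type} (o : Option X) : X → ℕ :=
  fun x => if o = some x then 1 else 0

/-- A transition `s →ᵃ t` over the alphabet `A` and the states `S`: it consumes the state `source`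
and produces the multiset `out` of letters and the multiset `target` of states. -/
@[ext]
structure Transition (A S : Type) where
  source : S
  out : A → ℕ
  target : S → ℕ

/-- A commutative grammar over the alphabet `A` with states `S`. -/
@[ext]
structure CommGrammar (A S : Type) where
  start : S
  trans : Finset (Transition A S)

namespace CommGrammar

variable {A S : Type} (G : CommGrammar A S)

/-- A grammar is regular if every transition produces at most one letter and at most one state. -/
def IsRegular [Fintype A] [Fintype S] : Prop :=
  ∀ τ ∈ G.trans, ∑ a, τ.out a ≤ 1 ∧ ∑ s, τ.target s ≤ 1

open Classical in
/-- How many times each state is consumed by the multiset `D` of transitions. -/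
noncomputable def sourceCount (D : G.trans → ℕ) (s : S) : ℕ :=
  ∑ τ : G.trans, if τ.1.source = s then D τ else 0

/-- How many times each state is produced by the multiset `D` of transitions. -/
def targetCount (D : G.trans → ℕ) (s : S) : ℕ :=
  ∑ τ : G.trans, D τ * τ.1.target s

/-- How many times each letter is produced by the multiset `D` of transitions. -/
def outCount (D : G.trans → ℕ) (a : A) : ℕ :=
  ∑ τ : G.trans, D τ * τ.1.out a

/-- The states that are sources of transitions in `D`. -/
def support (D : G.trans → ℕ) : Set S :=
  {s | 0 < G.sourceCount D s}

/-- Some transition in `D` leads from `s` to `t`. -/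
def Edge (D : G.trans → ℕ) (s t : S) : Prop :=
  ∃ τ : G.trans, 0 < D τ ∧ τ.1.source = s ∧ 0 < τ.1.target t

/-- Every state of the support of `D` is reached from `s` by a (possibly empty) path in `D`. -/
def ConnectedFrom (D : G.trans → ℕ) (s : S) : Prop :=
  ∀ t ∈ G.support D, Relation.ReflTransGen (G.Edge D) s t

open Classical in
/-- A run: connected from the initial state, and every state is consumed as many times as it is
produced, except that the initial state is consumed one time more. -/
def IsRun (D : G.trans → ℕ) : Prop :=
  G.ConnectedFrom D G.start ∧
    ∀ s, G.sourceCount D s = G.targetCount D s + if s = G.start then 1 else 0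

/-- The set of multisets of letters generated by `G`. -/
def out : Set (A → ℕ) :=
  {K | ∃ D : G.trans → ℕ, G.IsRun D ∧ G.outCount D = K}

end CommGrammar

/-- A finite description of a regular commutative grammar over the alphabet `Fin d`: the number of
states, the initial state, and a list of transitions, each given by its source, the letter it
produces (if any) and the state it produces (if any). -/
structure RegGrammarDesc (d : ℕ) where
  numStates : ℕ
  start : Fin numStates
  rules : List (Fin numStates × Option (Fin d) × Option (Fin numStates))

namespace RegGrammarDesc

variable {d : ℕ}

open Classical in
/-- The grammar described by `g`. -/
noncomputable def toGrammar (g : RegGrammarDesc d) : CommGrammar (Fin d) (Fin g.numStates) where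
  start := g.start
  trans := (g.rules.map fun r => ⟨r.1, optMultiset r.2.1, optMultiset r.2.2⟩).toFinset

end RegGrammarDesc

theorem sum_optMultiset_le {X : Type} [Fintype X] (o : Option X) :
    ∑ x, optMultiset o x ≤ 1 := by
  classical
  cases o with
  | none => simp [optMultiset]
  | some y => simp [optMultiset]

theorem exists_optMultiset {X : Type} [Fintype X] (f : X → ℕ) (hf : ∑ x, f x ≤ 1) :
    ∃ o, optMultiset o = f := by
  classical
  by_cases h : ∃ y, f y ≠ 0
  · obtain ⟨y, hy⟩ := h
    refine ⟨some y, funext fun x => ?_⟩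
    have h1 := Finset.add_sum_erase Finset.univ f (Finset.mem_univ y)
    by_cases hx : y = x
    · subst hx
      simp only [optMultiset, if_true]
      omega
    · have h2 : f x ≤ ∑ z ∈ Finset.univ.erase y, f z :=
        Finset.single_le_sum (f := f) (fun _ _ => Nat.zero_le _)
          (Finset.mem_erase.2 ⟨fun e => hx e.symm, Finset.mem_univ x⟩)
      simp only [optMultiset, Option.some.injEq, hx, if_false]
      omega
  · push Not at h
    exact ⟨none, funext fun x => by simp [optMultiset, h x]⟩

/-- Descriptions describe regular grammars. -/
theorem RegGrammarDesc.toGrammar_isRegular {d : ℕ} (g : RegGrammarDesc d) :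
    g.toGrammar.IsRegular := by
  classical
  intro τ hτ
  simp only [RegGrammarDesc.toGrammar, List.mem_toFinset, List.mem_map] at hτ
  obtain ⟨r, -, rfl⟩ := hτ
  exact ⟨sum_optMultiset_le _, sum_optMultiset_le _⟩

/-- Every regular grammar over `Fin d` with states `Fin n` has a description. -/
theorem RegGrammarDesc.exists_toGrammar {d n : ℕ} (G : CommGrammar (Fin d) (Fin n))
    (hG : G.IsRegular) :
    ∃ rules, RegGrammarDesc.toGrammar ⟨n, G.start, rules⟩ = G := by
  classical
  have key : ∀ τ ∈ G.trans, ∃ r : Fin n × Option (Fin d) × Option (Fin n),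
      (⟨r.1, optMultiset r.2.1, optMultiset r.2.2⟩ : Transition (Fin d) (Fin n)) = τ := by
    intro τ hτ
    obtain ⟨a, ha⟩ := exists_optMultiset _ (hG τ hτ).1
    obtain ⟨t, ht⟩ := exists_optMultiset _ (hG τ hτ).2
    exact ⟨(τ.source, a, t), by rw [ha, ht]⟩
  choose f hf using key
  refine ⟨G.trans.attach.toList.map fun τ => f τ.1 τ.2, ?_⟩
  ext1
  · rfl
  · ext τ
    simp only [RegGrammarDesc.toGrammar, List.mem_toFinset, List.mem_map, Finset.mem_toList]
    constructor
    · rintro ⟨_, ⟨⟨σ, hσ⟩, -, rfl⟩, rfl⟩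
      rw [hf]
      exact hσ
    · intro hτ
      exact ⟨f τ hτ, ⟨⟨τ, hτ⟩, Finset.mem_attach _ _, rfl⟩, hf τ hτ⟩

/-- The symbols of the words that encode instances of the membership problem. -/
inductive Symb (d : ℕ) where
  | tick
  | comma
  | rule
  | letter (a : Fin d)
  | noLetter
  | noState
  | bit (b : Bool)

/-- Unary numerals, for the number of states and the names of states. -/
def encUnary {d : ℕ} (n : ℕ) : List (Symb d) :=
  List.replicate n .tick ++ [.comma]

/-- Binary numerals (least significant digit first), for the multiplicities of letters. -/
def encBinary {d : ℕ} (n : ℕ) : List (Symb d) :=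
  n.bits.map .bit ++ [.comma]

/-- The letter produced by a transition. -/
def encLetter {d : ℕ} : Option (Fin d) → List (Symb d)
  | none => [.noLetter]
  | some a => [.letter a]

/-- The state produced by a transition. -/
def encTarget {d n : ℕ} : Option (Fin n) → List (Symb d)
  | none => [.noState]
  | some t => encUnary t

/-- A transition. -/
def encRule {d n : ℕ} (r : Fin n × Option (Fin d) × Option (Fin n)) : List (Symb d) :=
  .rule :: (encUnary r.1 ++ encLetter r.2.1 ++ encTarget r.2.2)

/-- A description of a grammar. -/
def encGrammar {d : ℕ} (g : RegGrammarDesc d) : List (Symb d) :=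
  encUnary g.numStates ++ encUnary g.start ++ g.rules.flatMap encRule ++ [.comma]

/-- A multiset of letters. -/
def encMultiset {d : ℕ} (K : Fin d → ℕ) : List (Symb d) :=
  (List.finRange d).flatMap fun a => encBinary (K a)

/-- An instance of the membership problem: a regular grammar together with a multiset. -/
def encInstance {d : ℕ} (I : RegGrammarDesc d × (Fin d → ℕ)) : List (Symb d) :=
  encGrammar I.1 ++ encMultiset I.2

theorem encUnary_append_inj {d m n : ℕ} {l l' : List (Symb d)}
    (h : encUnary m ++ l = encUnary n ++ l') : m = n ∧ l = l' := by
  induction m generalizing n with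
  | zero => cases n <;> simp_all [encUnary, List.replicate_succ]
  | succ m ih =>
    cases n with
    | zero => simp [encUnary, List.replicate_succ] at h
    | succ n =>
      have := @ih n (by simpa [encUnary, List.replicate_succ] using h)
      exact ⟨by rw [this.1], this.2⟩

theorem encBits_append_inj {d : ℕ} {m n : List Bool} {l l' : List (Symb d)}
    (h : m.map Symb.bit ++ (.comma :: l) = n.map Symb.bit ++ (.comma :: l')) : m = n ∧ l = l' := by
  induction m generalizing n with
  | nil => cases n <;> simp_all
  | cons b m ih =>
    cases n with
    | nil => simp at h
    | cons c n =>
      simp only [List.map_cons, List.cons_append, List.cons.injEq, Symb.bit.injEq] at h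
      obtain ⟨rfl, h⟩ := h
      have := ih h
      exact ⟨by rw [this.1], this.2⟩

theorem encRule_append_inj {d k : ℕ} {r r' : Fin k × Option (Fin d) × Option (Fin k)}
    {l l' : List (Symb d)} (h : encRule r ++ l = encRule r' ++ l') : r = r' ∧ l = l' := by
  obtain ⟨s, a, t⟩ := r
  obtain ⟨s', a', t'⟩ := r'
  simp only [encRule, List.cons_append, List.cons.injEq, true_and, List.append_assoc] at h
  obtain ⟨h1, h⟩ := encUnary_append_inj h
  obtain rfl := Fin.ext h1
  have h2 : a = a' ∧ encTarget t ++ l = encTarget t' ++ l' := by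
    cases a <;> cases a' <;> simp_all [encLetter]
  obtain ⟨rfl, h3⟩ := h2
  clear h
  cases t with
  | none =>
    cases t' with
    | none => simp_all [encTarget]
    | some t' =>
      rcases t' with ⟨_ | _, _⟩ <;> simp [encTarget, encUnary, List.replicate_succ] at h3
  | some t =>
    cases t' with
    | none => rcases t with ⟨_ | _, _⟩ <;> simp [encTarget, encUnary, List.replicate_succ] at h3
    | some t' =>
      obtain ⟨h4, h5⟩ := encUnary_append_inj h3
      obtain rfl := Fin.ext h4
      exact ⟨rfl, h5⟩

theorem encRules_append_inj {d k : ℕ} {R R' : List (Fin k × Option (Fin d) × Option (Fin k))}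
    {l l' : List (Symb d)}
    (h : R.flatMap encRule ++ (.comma :: l) = R'.flatMap encRule ++ (.comma :: l')) :
    R = R' ∧ l = l' := by
  induction R generalizing R' with
  | nil => cases R' <;> simp_all [encRule]
  | cons r R ih =>
    cases R' with
    | nil => simp [encRule] at h
    | cons r' R' =>
      simp only [List.flatMap_cons, List.append_assoc] at h
      obtain ⟨rfl, h1⟩ := encRule_append_inj h
      obtain ⟨rfl, h2⟩ := ih h1
      exact ⟨rfl, h2⟩

theorem encMultiset_injective {d : ℕ} : Function.Injective (encMultiset (d := d)) := by
  intro K K' h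
  have key : ∀ L : List (Fin d), L.flatMap (fun a => encBinary (d := d) (K a)) =
      L.flatMap (fun a => encBinary (d := d) (K' a)) → ∀ a ∈ L, K a = K' a := by
    intro L
    induction L with
    | nil => simp
    | cons b L ih =>
      intro h
      simp only [List.flatMap_cons, encBinary, List.append_assoc, List.singleton_append] at h
      obtain ⟨h1, h2⟩ := encBits_append_inj h
      intro a ha
      rcases List.mem_cons.1 ha with rfl | ha
      · exact Nat.digits_inj_iff.1 (by rw [Nat.digits_two_eq_bits, Nat.digits_two_eq_bits, h1])
      · exact ih (by simpa [encBinary] using h2) a ha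
  exact funext fun a => key _ h a (List.mem_finRange a)

/-- Different instances have different encodings. -/
theorem encInstance_injective {d : ℕ} : Function.Injective (encInstance (d := d)) := by
  rintro ⟨⟨n, s, R⟩, K⟩ ⟨⟨n', s', R'⟩, K'⟩ h
  simp only [encInstance, encGrammar, List.append_assoc, List.singleton_append] at h
  obtain ⟨rfl, h1⟩ := encUnary_append_inj h
  obtain ⟨h2, h3⟩ := encUnary_append_inj h1
  obtain rfl := Fin.ext h2
  obtain ⟨rfl, h4⟩ := encRules_append_inj h3
  obtain rfl := encMultiset_injective h4
  rfl

open Classical in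
/-- The problem of deciding `p x` for inputs `x` encoded by `enc` is in P: some Turing machine
(with finitely many stacks in place of tapes) answers every input correctly within a number of
steps that is polynomial in the length of the encoded input. -/
def DecidableInPolyTime {X Γ : Type} (enc : X → List Γ) (p : X → Prop) : Prop :=
  Nonempty (Turing.TM2ComputableInPolyTime enc Computability.encodeBool fun x => decide (p x))

/-! Runs are walks. Add a final point `none`, so that each transition is an edge from its source to
its target or to `none`. By Euler's argument, a connected balanced multiset of edges is the edge
multiset of a walk from the initial state to `none` (`Balanced.exists_walk_eq`, `mem_out_iff`). So K
must be realised as the letter count of a walk, whose length may be exponential since K is written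
in binary.

Let n be the number of states and d the number of letters. Cutting closed walks of length at most n
out of a walk leaves a base walk of length at most (n+1)^2 with the same sources, into which closed
walks at these sources can be spliced any number of times (`exists_base`). Only the letter counts of
the closed walks matter, and these are at most (n+1)^d vectors. By the pigeonhole principle any d+1
of them satisfy a relation with small coefficients (`exists_relation`); hence in a lexicographically
least choice of multiplicities all but d are polynomially bounded (`exists_few_large`). Splicing the
closed walks of bounded multiplicity into the base gives K = vec b + Σ_{j<d} M_j vec c_j, where b is
polynomially long for fixed d, each c_j has length at most n, and only the M_j can be large
(`exists_decomposition`).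

Such a representation is found by treating the binary digits of K and of the M_j together, lowest
digit first. In round i, the search walks around c_j if bit i of M_j is 1, adds the letters to a
carry, compares the parity of the carry with bit i of K, and halves it; the carry stays polynomial
(`exists_of_mem_out`). Neither c_j nor M_j is remembered: a closed walk at s_j used in round i
stands for 2^i copies of it, so it does no harm if different rounds use different closed walks
(`Done.insert`, `inv_of_step`). A configuration consists of 2d+3 numbers below a polynomial bound N,
so there are polynomially many configurations, and the reachable ones form a least fixed point.

The rest makes this a machine. Structured programs over unary counters, a word and a boolean table
are compiled into stack machines step for step (`Exec.simulate`). Polynomial-time terms and tests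
are closed under arithmetic, connectives and bounded quantifiers (`IsTm`, `Test`), so the search
rule can be tested because it is such a formula. Repeated passes over all tuples compute the fixed
point (`decidableInPolyTime_of_pass`). -/

namespace StackProg

/-! ### Structured programs and their representation by stacks -/

/-- The state of a structured program: a read-only word with a head, counters, an unbounded table of
booleans with a head, and a flag. -/
@[ext]
structure St (α : Type) where
  word : List α
  cnt : ℕ → ℕ
  inPos : ℕ
  tab : ℕ → Bool
  tabPos : ℕ
  flag : Bool

/-- Elementary instructions. -/
inductive Op (α : Type) where
  | skip
  | inc (c : ℕ)
  | dec (c : ℕ)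
  | inRight
  | inLeft
  | inTest (q : Option α → Bool)
  | tabRight
  | tabLeft
  | tabTest
  | tabSet
  | negate

/-- The effect of an instruction; `dec`, `inLeft` and `tabLeft` report in the flag whether the
counter or the position was positive. -/
def Op.run {α : Type} : Op α → St α → St α
  | skip, s => s
  | inc c, s => { s with cnt := Function.update s.cnt c (s.cnt c + 1) }
  | dec c, s => { s with cnt := Function.update s.cnt c (s.cnt c - 1), flag := decide (s.cnt c ≠ 0) }
  | inRight, s => { s with inPos := s.inPos + 1 }
  | inLeft, s => { s with inPos := s.inPos - 1, flag := decide (s.inPos ≠ 0) }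
  | inTest q, s => { s with flag := q s.word[s.inPos]? }
  | tabRight, s => { s with tabPos := s.tabPos + 1 }
  | tabLeft, s => { s with tabPos := s.tabPos - 1, flag := decide (s.tabPos ≠ 0) }
  | tabTest, s => { s with flag := s.tab s.tabPos }
  | tabSet, s => { s with tab := Function.update s.tab s.tabPos true }
  | negate, s => { s with flag := !s.flag }

/-- Structured programs: `loop o p` runs `o` and, as long as this leaves the flag set, runs `p` and
starts again. -/
inductive Prog (α : Type) where
  | op (o : Op α)
  | seq (p q : Prog α)
  | ite (p q : Prog α)
  | loop (o : Op α) (p : Prog α)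

/-- `Exec p s s' t`: the program `p` leads from `s` to `s'` in `t` steps. -/
inductive Exec {α : Type} : Prog α → St α → St α → ℕ → Prop
  | op (o : Op α) (s : St α) : Exec (.op o) s (o.run s) 1
  | seq {p q : Prog α} {s s' s'' : St α} {t t' : ℕ} (h : Exec p s s' t) (h' : Exec q s' s'' t') :
      Exec (.seq p q) s s'' (t + t')
  | iteTrue {p q : Prog α} {s s' : St α} {t : ℕ} (hs : s.flag = true) (h : Exec p s s' t) :
      Exec (.ite p q) s s' (t + 1)
  | iteFalse {p q : Prog α} {s s' : St α} {t : ℕ} (hs : s.flag = false) (h : Exec q s s' t) :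
      Exec (.ite p q) s s' (t + 1)
  | loopEnd {o : Op α} {p : Prog α} {s : St α} (hs : (o.run s).flag = false) :
      Exec (.loop o p) s (o.run s) 1
  | loopNext {o : Op α} {p : Prog α} {s s' s'' : St α} {t t' : ℕ} (hs : (o.run s).flag = true)
      (h : Exec p (o.run s) s' t) (h' : Exec (.loop o p) s' s'' t') :
      Exec (.loop o p) s s'' (1 + t + t')

/-- The instruction uses only counters below `D`. -/
def Op.Below {α : Type} (D : ℕ) : Op α → Prop
  | inc c => c < D
  | dec c => c < D
  | _ => True

/-- The program uses only counters below `D`. -/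
def Prog.Below {α : Type} (D : ℕ) : Prog α → Prop
  | op o => o.Below D
  | seq p q => p.Below D ∧ q.Below D
  | ite p q => p.Below D ∧ q.Below D
  | loop o p => o.Below D ∧ p.Below D

theorem Op.Below.mono {α : Type} {D D' : ℕ} (h : D ≤ D') {o : Op α} (ho : o.Below D) :
    o.Below D' := by
  cases o <;> simp only [Op.Below] at * <;> omega

theorem Prog.Below.mono {α : Type} {D D' : ℕ} (h : D ≤ D') {p : Prog α} (hp : p.Below D) :
    p.Below D' := by
  induction p with
  | op o => exact Op.Below.mono h hp
  | seq p q ihp ihq => exact ⟨ihp hp.1, ihq hp.2⟩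
  | ite p q ihp ihq => exact ⟨ihp hp.1, ihq hp.2⟩
  | loop o p ih => exact ⟨Op.Below.mono h hp.1, ih hp.2⟩

theorem Op.exists_below {α : Type} (o : Op α) : ∃ D, o.Below D := by
  cases o with
  | inc c => exact ⟨c + 1, Nat.lt_succ_self c⟩
  | dec c => exact ⟨c + 1, Nat.lt_succ_self c⟩
  | _ => exact ⟨0, trivial⟩

theorem Prog.exists_below {α : Type} (p : Prog α) : ∃ D, p.Below D := by
  induction p with
  | op o => exact o.exists_below
  | seq p q ihp ihq =>
    obtain ⟨D, hD⟩ := ihp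
    obtain ⟨D', hD'⟩ := ihq
    exact ⟨max D D', hD.mono (le_max_left _ _), hD'.mono (le_max_right _ _)⟩
  | ite p q ihp ihq =>
    obtain ⟨D, hD⟩ := ihp
    obtain ⟨D', hD'⟩ := ihq
    exact ⟨max D D', hD.mono (le_max_left _ _), hD'.mono (le_max_right _ _)⟩
  | loop o p ih =>
    obtain ⟨D, hD⟩ := ih
    obtain ⟨D', hD'⟩ := o.exists_below
    exact ⟨max D D', hD'.mono (le_max_right _ _), hD.mono (le_max_left _ _)⟩

/-- The stacks of the machine: the counters, and two stacks for each tape. -/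
inductive Stk (D : ℕ) where
  | cnt (c : Fin D)
  | inL
  | inR
  | tabL
  | tabR
  | out
deriving DecidableEq, Fintype

/-- The alphabets of the stacks. -/
abbrev Alph (α : Type) {D : ℕ} : Stk D → Type
  | .cnt _ => Unit
  | .inL => Option α
  | .inR => α
  | .tabL => Bool
  | .tabR => Bool
  | .out => Bool

/-- The finite memory of the machine: the flag and symbols in transit. -/
abbrev Mem (α : Type) : Type := Bool × Option α × Bool

open Turing.TM2.Stmt

/-- The machine code of an instruction. -/
def Op.stmt {α : Type} [Inhabited α] {D : ℕ} {Λ : Type} (o : Op α)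
    (q : Turing.TM2.Stmt (Alph α (D := D)) Λ (Mem α)) :
    Turing.TM2.Stmt (Alph α (D := D)) Λ (Mem α) :=
  match o with
  | skip => q
  | inc c => if h : c < D then push (.cnt ⟨c, h⟩) (fun _ => ()) q else q
  | dec c => if h : c < D then pop (.cnt ⟨c, h⟩) (fun v (a : Option Unit) => (a.isSome, v.2)) q else q
  | inRight => pop .inR (fun v (a : Option α) => (v.1, a, v.2.2)) (push .inL (fun v => v.2.1) q)
  | inLeft => pop .inL (fun v (a : Option (Option α)) => (a.isSome, a.join, v.2.2))
      (branch (fun v => v.2.1.isSome) (push .inR (fun v => v.2.1.getD default) q) q)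
  | inTest f => peek .inR (fun v (a : Option α) => (f a, v.2)) q
  | tabRight => pop .tabR (fun v (a : Option Bool) => (v.1, v.2.1, a.getD false))
      (push .tabL (fun v => v.2.2) q)
  | tabLeft => pop .tabL (fun v (a : Option Bool) => (a.isSome, v.2.1, a.getD false))
      (branch (fun v => v.1) (push .tabR (fun v => v.2.2) q) q)
  | tabTest => peek .tabR (fun v (a : Option Bool) => (a.getD false, v.2)) q
  | tabSet => pop .tabR (fun v _ => v) (push .tabR (fun _ => true) q)
  | negate => load (fun v => (!v.1, v.2)) q

/-- The stacks with the given contents. -/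
def mkStacks {α : Type} {D : ℕ} (n : ℕ → ℕ) (il : List (Option α)) (ir : List α)
    (tl tr ou : List Bool) : ∀ k : Stk D, List (Alph α k)
  | .cnt c => List.replicate (n c) ()
  | .inL => il
  | .inR => ir
  | .tabL => tl
  | .tabR => tr
  | .out => ou

section mkStacks

variable {α : Type} {D : ℕ} (n : ℕ → ℕ) (il x : List (Option α)) (ir y : List α)
  (tl tr ou z : List Bool)

theorem update_mkStacks_cnt (c : Fin D) (m : ℕ) :
    Function.update (mkStacks (D := D) n il ir tl tr ou) (.cnt c) (List.replicate m () : List Unit) =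
      mkStacks (Function.update n c m) il ir tl tr ou := by
  funext k
  rcases k with c' | _ | _ | _ | _ | _
  · by_cases h : c' = c
    · subst h
      rw [Function.update_self]
      simp only [mkStacks, Function.update_self]
    · rw [Function.update_of_ne (by simpa using h)]
      simp only [mkStacks]
      rw [Function.update_of_ne (fun e => h (Fin.ext e))]
  all_goals rfl

theorem update_mkStacks_inL :
    Function.update (mkStacks (D := D) n il ir tl tr ou) .inL x = mkStacks n x ir tl tr ou := by
  funext k
  cases k <;> rfl

theorem update_mkStacks_inR :
    Function.update (mkStacks (D := D) n il ir tl tr ou) .inR y = mkStacks n il y tl tr ou := by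
  funext k
  cases k <;> rfl

theorem update_mkStacks_tabL :
    Function.update (mkStacks (D := D) n il ir tl tr ou) .tabL z = mkStacks n il ir z tr ou := by
  funext k
  cases k <;> rfl

theorem update_mkStacks_tabR :
    Function.update (mkStacks (D := D) n il ir tl tr ou) .tabR z = mkStacks n il ir tl z ou := by
  funext k
  cases k <;> rfl

theorem update_mkStacks_out :
    Function.update (mkStacks (D := D) n il ir tl tr ou) .out z = mkStacks n il ir tl tr z := by
  funext k
  cases k <;> rfl

end mkStacks

/-- The memory `v` and the stacks `S` represent the state `s`, with at most `B` table entries. -/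
def Rep {α : Type} {D : ℕ} (B : ℕ) (s : St α) (v : Mem α) (S : ∀ k : Stk D, List (Alph α k)) :
    Prop :=
  ∃ tr : List Bool,
    S = mkStacks s.cnt ((List.range s.inPos).map (fun i => s.word[i]?)).reverse
      (s.word.drop s.inPos) ((List.range s.tabPos).map s.tab).reverse tr [] ∧
    (∀ i, tr.getD i false = s.tab (s.tabPos + i)) ∧ s.tabPos + tr.length ≤ B ∧ v.1 = s.flag

/-- The code of an instruction contains no jump, so it is absorbed into one machine step, whatever
the continuation `q` is. A tape is two stacks meeting at the head. The right table stack lists only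
finitely many cells and an empty stack is read as `false`. An instruction adds at most one cell,
whence `B + 1`; the bound limits the time needed to empty the table at the end. -/
theorem Op.rep_run {α : Type} [Inhabited α] {D B : ℕ} {s : St α} {v : Mem α}
    {S : ∀ k : Stk D, List (Alph α k)} (o : Op α) (ho : o.Below D) (h : Rep B s v S) :
    ∃ v' S', Rep (B + 1) (o.run s) v' S' ∧ ∀ {Λ : Type}
      (q : Turing.TM2.Stmt (Alph α (D := D)) Λ (Mem α)),
      Turing.TM2.stepAux (o.stmt q) v S = Turing.TM2.stepAux q v' S' := by
  obtain ⟨tr, rfl, htr, hlen, hfl⟩ := h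
  have htr0 : tr.head?.getD false = s.tab s.tabPos := by
    rw [← Nat.add_zero s.tabPos, ← htr 0]
    cases tr <;> simp
  have htr1 : ∀ i, tr.tail.getD i false = s.tab (s.tabPos + (i + 1)) := by
    intro i
    rw [← htr (i + 1)]
    cases tr <;> simp
  have htl := List.length_tail (l := tr)
  cases o with
  | skip => exact ⟨v, _, ⟨tr, rfl, htr, by simp only [run]; omega, hfl⟩, fun q => rfl⟩
  | inc c =>
    have hcD : c < D := ho
    refine ⟨v, _, ⟨tr, rfl, htr, by simp only [run]; omega, hfl⟩, fun q => ?_⟩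
    simp only [stmt, hcD, dite_true, Turing.TM2.stepAux, run]
    congr 1
    exact update_mkStacks_cnt _ _ _ _ _ _ ⟨c, hcD⟩ (s.cnt c + 1)
  | dec c =>
    have hcD : c < D := ho
    refine ⟨(decide (s.cnt c ≠ 0), v.2), _, ⟨tr, rfl, htr, by simp only [run]; omega, rfl⟩,
      fun q => ?_⟩
    simp only [stmt, hcD, dite_true, Turing.TM2.stepAux, run]
    have h1 := update_mkStacks_cnt s.cnt ((List.range s.inPos).map (fun i => s.word[i]?)).reverse
      (s.word.drop s.inPos) ((List.range s.tabPos).map s.tab).reverse tr [] ⟨c, hcD⟩ (s.cnt c - 1)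
    rw [← h1]
    congr 1
    · simp only [mkStacks]
      cases s.cnt c <;> simp [List.replicate_succ]
    · congr 1
      simp only [mkStacks]
      cases s.cnt c <;> simp [List.replicate_succ]
  | inRight =>
    refine ⟨(v.1, s.word[s.inPos]?, v.2.2), _, ⟨tr, rfl, htr, by simp only [run]; omega, hfl⟩,
      fun q => ?_⟩
    simp only [stmt, Turing.TM2.stepAux, run]
    rw [update_mkStacks_inR, update_mkStacks_inL]
    simp only [mkStacks, List.head?_drop, List.tail_drop, List.range_succ, List.map_append,
      List.reverse_append, List.map_cons, List.map_nil, List.reverse_singleton,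
      List.singleton_append]
  | inLeft =>
    obtain h0 | ⟨p, hp⟩ : s.inPos = 0 ∨ ∃ p, s.inPos = p + 1 := by
      cases s.inPos <;> simp
    · refine ⟨(false, none, v.2.2), _, ⟨tr, rfl, htr, by simp only [run]; omega, ?_⟩, fun q => ?_⟩
      · simp [run, h0]
      · simp only [stmt, Turing.TM2.stepAux, run]
        rw [update_mkStacks_inL]
        simp [mkStacks, h0]
    · refine ⟨(true, s.word[p]?, v.2.2), _, ⟨tr, rfl, htr, by simp only [run]; omega, ?_⟩,
        fun q => ?_⟩
      · simp [run, hp]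
      · simp only [stmt, Turing.TM2.stepAux, run]
        rw [update_mkStacks_inL, update_mkStacks_inR]
        by_cases hl : p < s.word.length
        · simp [mkStacks, hp, List.range_succ, hl]
        -- The head may stand beyond the end of the word. The left stack then holds `none` for each
        -- such position, and moving left pops it without pushing anything.
        · have e1 : s.word.drop p = [] := List.drop_eq_nil_of_le (by omega)
          have e2 : s.word.drop (p + 1) = [] := List.drop_eq_nil_of_le (by omega)
          simp [mkStacks, hp, List.range_succ, hl, e1, e2]
  | inTest f =>
    refine ⟨(f s.word[s.inPos]?, v.2), _, ⟨tr, rfl, htr, by simp only [run]; omega, rfl⟩,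
      fun q => ?_⟩
    simp only [stmt, Turing.TM2.stepAux, run]
    simp [mkStacks]
  | tabRight =>
    refine ⟨(v.1, v.2.1, s.tab s.tabPos), _, ⟨tr.tail, rfl, ?_, ?_, hfl⟩, fun q => ?_⟩
    · intro i
      rw [htr1]
      simp only [run]
      congr 1
      ring
    · simp only [run]
      omega
    · simp only [stmt, Turing.TM2.stepAux, run]
      rw [update_mkStacks_tabR, update_mkStacks_tabL]
      simp [mkStacks, List.range_succ, htr0]
  | tabLeft =>
    obtain h0 | ⟨p, hp⟩ : s.tabPos = 0 ∨ ∃ p, s.tabPos = p + 1 := by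
      cases s.tabPos <;> simp
    · refine ⟨(false, v.2.1, false), _, ⟨tr, rfl, ?_, by simp only [run]; omega, ?_⟩, fun q => ?_⟩
      · simpa [run, h0] using htr
      · simp [run, h0]
      · simp only [stmt, Turing.TM2.stepAux, run]
        rw [update_mkStacks_tabL]
        simp [mkStacks, h0]
    · refine ⟨(true, v.2.1, s.tab p), _, ⟨s.tab p :: tr, rfl, ?_, ?_, ?_⟩, fun q => ?_⟩
      · intro i
        cases i with
        | zero => simp [run, hp]
        | succ i =>
          simp only [run, hp, List.getD_cons_succ, Nat.add_sub_cancel]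
          rw [htr, hp]
          congr 1
          ring
      · simp only [run, List.length_cons]
        omega
      · simp [run, hp]
      · simp only [stmt, Turing.TM2.stepAux, run]
        rw [update_mkStacks_tabL, update_mkStacks_tabR]
        simp [mkStacks, hp, List.range_succ]
  | tabTest =>
    refine ⟨(s.tab s.tabPos, v.2), _, ⟨tr, rfl, htr, by simp only [run]; omega, rfl⟩,
      fun q => ?_⟩
    simp only [stmt, Turing.TM2.stepAux, run]
    simp [mkStacks, htr0]
  | tabSet =>
    refine ⟨v, _, ⟨true :: tr.tail, rfl, ?_, ?_, hfl⟩, fun q => ?_⟩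
    · intro i
      cases i with
      | zero => simp [run]
      | succ i =>
        simp only [run, List.getD_cons_succ]
        rw [htr1, Function.update_of_ne (by omega)]
    · simp only [run, List.length_cons]
      omega
    · simp only [stmt, Turing.TM2.stepAux, run]
      rw [update_mkStacks_tabR, update_mkStacks_tabR]
      have : (List.range s.tabPos).map (Function.update s.tab s.tabPos true) =
          (List.range s.tabPos).map s.tab := by
        apply List.map_congr_left
        intro i hi
        rw [Function.update_of_ne (by simp at hi; omega)]
      simp [mkStacks, this]
  | negate =>
    refine ⟨(!v.1, v.2), _, ⟨tr, rfl, htr, by simp only [run]; omega, by simp [run, hfl]⟩,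
      fun q => rfl⟩

end StackProg

/-! ### Compilation of structured programs into stack machines -/

namespace StackProg

open Turing.TM2.Stmt

/-- The labels of the code of a program. -/
def Prog.Lab {α : Type} : Prog α → Type
  | op _ => Unit
  | seq p q => p.Lab ⊕ q.Lab
  | ite p q => Option (p.Lab ⊕ q.Lab)
  | loop _ p => Option p.Lab

/-- There are finitely many labels. -/
@[reducible] def Prog.fintypeLab {α : Type} : (p : Prog α) → Fintype p.Lab
  | op _ => inferInstanceAs (Fintype Unit)
  | seq p q =>
    have := p.fintypeLab
    have := q.fintypeLab
    inferInstanceAs (Fintype (p.Lab ⊕ q.Lab))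
  | ite p q =>
    have := p.fintypeLab
    have := q.fintypeLab
    inferInstanceAs (Fintype (Option (p.Lab ⊕ q.Lab)))
  | loop _ p =>
    have := p.fintypeLab
    inferInstanceAs (Fintype (Option p.Lab))

/-- The label where the execution of a program starts. -/
def Prog.entry {α : Type} : (p : Prog α) → p.Lab
  | op _ => ()
  | seq p _ => Sum.inl p.entry
  | ite _ _ => none
  | loop _ _ => none

/-- The machine code of a program, with labels placed by `emb` and continuing at `exit`. -/
def Prog.code {α : Type} [Inhabited α] {D : ℕ} {Λ : Type} :
    (p : Prog α) → (emb : p.Lab → Λ) → (exit : Λ) → p.Lab →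
      Turing.TM2.Stmt (Alph α (D := D)) Λ (Mem α)
  | op o, _, exit, _ => o.stmt (goto fun _ => exit)
  | seq p q, emb, _, Sum.inl l => p.code (fun l => emb (Sum.inl l)) (emb (Sum.inr q.entry)) l
  | seq _ q, emb, exit, Sum.inr l => q.code (fun l => emb (Sum.inr l)) exit l
  | ite p q, emb, _, none =>
    branch (fun v => v.1) (goto fun _ => emb (some (Sum.inl p.entry)))
      (goto fun _ => emb (some (Sum.inr q.entry)))
  | ite p _, emb, exit, some (Sum.inl l) => p.code (fun l => emb (some (Sum.inl l))) exit l
  | ite _ q, emb, exit, some (Sum.inr l) => q.code (fun l => emb (some (Sum.inr l))) exit l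
  | loop o p, emb, exit, none =>
    o.stmt (branch (fun v => v.1) (goto fun _ => emb (some p.entry)) (goto fun _ => exit))
  | loop _ p, emb, _, some l => p.code (fun l => emb (some l)) (emb none) l

/-- `n` steps of the partial function `f` lead from `a` to `b`. -/
def Steps {τ : Type} (f : τ → Option τ) (n : ℕ) (a b : τ) : Prop :=
  (flip bind f)^[n] (some a) = some b

theorem Steps.trans {τ : Type} {f : τ → Option τ} {m n : ℕ} {a b c : τ} (h : Steps f m a b)
    (h' : Steps f n b c) : Steps f (m + n) a c := by
  unfold Steps at *
  rw [Nat.add_comm, Function.iterate_add_apply, h, h']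

theorem Steps.single {τ : Type} {f : τ → Option τ} {a b : τ} (h : f a = some b) :
    Steps f 1 a b := h

/-- Induction on the execution, with the exit label general because a program exits to its successor
in a sequence and to the loop head in a loop. Every unit of time in `Exec` is one machine step,
since the test of a loop and its jump share a label. -/
theorem Exec.simulate {α : Type} [Inhabited α] {D : ℕ} {p : Prog α} {s s' : St α} {t : ℕ}
    (h : Exec p s s' t) (hp : p.Below D) {Λ : Type}
    (M : Λ → Turing.TM2.Stmt (Alph α (D := D)) Λ (Mem α)) (emb : p.Lab → Λ) (exit : Λ)
    (hM : ∀ l, M (emb l) = p.code emb exit l) {B : ℕ} {v : Mem α}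
    {S : ∀ k : Stk D, List (Alph α k)} (hS : Rep B s v S) :
    ∃ v' S', Rep (B + t) s' v' S' ∧
      Steps (Turing.TM2.step M) t ⟨some (emb p.entry), v, S⟩ ⟨some exit, v', S'⟩ := by
  induction h generalizing B v S exit with
  | op o s =>
    obtain ⟨v', S', h1, h2⟩ := o.rep_run hp hS
    refine ⟨v', S', h1, Steps.single ?_⟩
    simp only [Turing.TM2.step, hM, Prog.code, h2, Turing.TM2.stepAux]
  | seq h h' ih ih' =>
    rename_i p q s s' s'' t t'
    obtain ⟨v1, S1, h1, h2⟩ := ih hp.1 (fun l => emb (Sum.inl l)) (emb (Sum.inr q.entry))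
      (fun l => hM _) hS
    obtain ⟨v2, S2, h3, h4⟩ := ih' hp.2 (fun l => emb (Sum.inr l)) exit (fun l => hM _) h1
    exact ⟨v2, S2, by rwa [← add_assoc], h2.trans h4⟩
  | iteTrue hs h ih =>
    rename_i p q s s' t
    obtain ⟨v1, S1, h1, h2⟩ := ih hp.1 (fun l => emb (some (Sum.inl l))) exit (fun l => hM _) hS
    obtain ⟨tr, e, htr, hlen, hfl⟩ := h1
    refine ⟨v1, S1, ⟨tr, e, htr, by omega, hfl⟩, ?_⟩
    rw [Nat.add_comm]
    refine Steps.trans (Steps.single ?_) h2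
    obtain ⟨_, _, _, _, hfl⟩ := hS
    simp only [Turing.TM2.step, hM]
    simp only [Prog.entry, Prog.code, Turing.TM2.stepAux, hfl, hs, cond_true]
  | iteFalse hs h ih =>
    rename_i p q s s' t
    obtain ⟨v1, S1, h1, h2⟩ := ih hp.2 (fun l => emb (some (Sum.inr l))) exit (fun l => hM _) hS
    obtain ⟨tr, e, htr, hlen, hfl⟩ := h1
    refine ⟨v1, S1, ⟨tr, e, htr, by omega, hfl⟩, ?_⟩
    rw [Nat.add_comm]
    refine Steps.trans (Steps.single ?_) h2
    obtain ⟨_, _, _, _, hfl⟩ := hS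
    simp only [Turing.TM2.step, hM]
    simp only [Prog.entry, Prog.code, Turing.TM2.stepAux, hfl, hs, cond_false]
  | loopEnd hs =>
    rename_i o p s
    obtain ⟨v', S', h1, h2⟩ := o.rep_run hp.1 hS
    refine ⟨v', S', h1, Steps.single ?_⟩
    obtain ⟨_, _, _, _, hfl⟩ := h1
    simp only [Turing.TM2.step, hM]
    simp only [Prog.entry, Prog.code, h2, Turing.TM2.stepAux, hfl, hs,
      cond_false]
  | loopNext hs h h' ih ih' =>
    rename_i o p s s' s'' t t'
    obtain ⟨v', S', h1, h2⟩ := o.rep_run hp.1 hS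
    obtain ⟨v1, S1, h3, h4⟩ := ih hp.2 (fun l => emb (some l)) (emb none) (fun l => hM _) h1
    obtain ⟨v2, S2, h5, h6⟩ := ih' hp emb exit hM h3
    refine ⟨v2, S2, by rwa [show B + (1 + t + t') = B + 1 + t + t' by ring], ?_⟩
    refine Steps.trans (Steps.trans (Steps.single ?_) h4) h6
    obtain ⟨_, _, _, _, hfl⟩ := h1
    simp only [Turing.TM2.step, hM]
    simp only [Prog.entry, Prog.code, h2, Turing.TM2.stepAux, hfl, hs,
      cond_true]

/-- The code of a program, followed by code that empties the stacks and outputs the flag. -/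
def Prog.fullCode {α : Type} [Inhabited α] {D : ℕ} (p : Prog α) :
    Option p.Lab → Turing.TM2.Stmt (Alph α (D := D)) (Option p.Lab) (Mem α)
  | none => pop .inR (fun v (a : Option α) => (v.1, a, v.2.2))
      (pop .tabR (fun v (a : Option Bool) => (v.1, v.2.1, a.isSome))
        (branch (fun v => v.2.1.isSome || v.2.2) (goto fun _ => none)
          (push .out (fun v => v.1) (load (fun _ => (false, none, false)) halt))))
  | some l => p.code some none l

/-- The machine that runs `p`, empties its stacks and outputs the flag. -/
def machine {α : Type} [Inhabited α] [Fintype α] (p : Prog α) (D : ℕ) : Turing.FinTM2 where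
  K := Stk D
  k₀ := .inR
  k₁ := .out
  Γ := Alph α
  Λ := Option p.Lab
  main := some p.entry
  ΛFin := by
    have := p.fintypeLab
    infer_instance
  σ := Mem α
  initialState := (false, none, false)
  Γk₀Fin := inferInstanceAs (Fintype α)
  m := p.fullCode

/-- A halting configuration must have empty stacks apart from the output, and the initial memory.
Counters and left stacks are already empty when this code starts; each round pops one symbol from
both right stacks, and the last round finds both empty, writes the flag and resets the memory. -/
theorem steps_cleanup {α : Type} [Inhabited α] (p : Prog α) (D n : ℕ) :
    ∀ (ir : List α) (tr : List Bool), ir.length ≤ n → tr.length ≤ n → ∀ v : Mem α,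
      ∃ m ≤ n + 1, Steps (Turing.TM2.step (p.fullCode (D := D))) m
        ⟨some none, v, mkStacks (fun _ => 0) [] ir [] tr []⟩
        ⟨none, (false, none, false), mkStacks (fun _ => 0) [] [] [] [] [v.1]⟩ := by
  induction n with
  | zero =>
    intro ir tr h1 h2 v
    have e1 : ir = [] := List.length_eq_zero_iff.1 (by omega)
    have e2 : tr = [] := List.length_eq_zero_iff.1 (by omega)
    subst e1 e2
    refine ⟨1, le_rfl, Steps.single ?_⟩
    simp only [Turing.TM2.step, Prog.fullCode, Turing.TM2.stepAux]
    rw [update_mkStacks_inR, update_mkStacks_tabR, update_mkStacks_out]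
    simp [mkStacks]
  | succ n ih =>
    intro ir tr h1 h2 v
    by_cases h : ir = [] ∧ tr = []
    · obtain ⟨rfl, rfl⟩ := h
      obtain ⟨m, hm, h3⟩ := ih [] [] (by simp) (by simp) v
      exact ⟨m, by omega, h3⟩
    · obtain ⟨m, hm, h3⟩ := ih ir.tail tr.tail (by simp; omega) (by simp; omega)
        (v.1, ir.head?, tr.head?.isSome)
      refine ⟨1 + m, by omega, Steps.trans (Steps.single ?_) h3⟩
      simp only [Turing.TM2.step, Prog.fullCode, Turing.TM2.stepAux]
      rw [update_mkStacks_inR, update_mkStacks_tabR]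
      have : (ir.head?.isSome || tr.head?.isSome) = true := by
        cases ir <;> cases tr <;> simp_all
      simp only [mkStacks, this, cond_true]

/-- The state before the execution of a program. -/
def St.initial {α : Type} (w : List α) : St α := ⟨w, fun _ => 0, 0, fun _ => false, 0, false⟩

/-- A problem is decided by a machine in polynomial time if it is decided by a structured program in
polynomial time. -/
theorem decidableInPolyTime_of_prog {α X : Type} [Inhabited α] [Fintype α] {enc : X → List α}
    {P : X → Prop} (p : Prog α) (q : Polynomial ℕ)
    (h : ∀ x, ∃ s t, Exec p (St.initial (enc x)) s t ∧ t ≤ q.eval (enc x).length ∧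
      s.word = enc x ∧ s.cnt = (fun _ => 0) ∧ s.inPos = 0 ∧ s.tabPos = 0 ∧
      (s.flag = true ↔ P x)) :
    DecidableInPolyTime enc P := by
  classical
  obtain ⟨D, hD⟩ := p.exists_below
  -- The program takes t ≤ q steps and leaves at most t table cells. Hence the right stacks are no
  -- longer than t plus the input length, and the clean-up takes at most one step more than that.
  have key : ∀ x, ∃ n ≤ (2 * q + Polynomial.X + 2).eval (enc x).length,
      Steps (machine p D).step n (Turing.initList (machine p D) (enc x))
        (Turing.haltList (machine p D) [decide (P x)]) := by
    intro x
    obtain ⟨s, t, h1, h2, h3, h4, h5, h6, h7⟩ := h x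
    have hS : Rep (D := D) 0 (St.initial (enc x)) (false, none, false)
        (mkStacks (fun _ => 0) [] (enc x) [] [] []) :=
      ⟨[], by simp [St.initial], by simp [St.initial], by simp [St.initial], rfl⟩
    obtain ⟨v', S', ⟨tr, e, htr, hlen, hfl⟩, h9⟩ := h1.simulate hD p.fullCode some none
      (fun l => rfl) hS
    subst e
    rw [h3, h4, h5, h6] at h9
    obtain ⟨m, hm, h10⟩ := steps_cleanup p D (t + (enc x).length) (enc x) tr (by omega) (by omega) v'
    refine ⟨t + m, ?_, ?_⟩
    · simp only [Polynomial.eval_add, Polynomial.eval_mul, Polynomial.eval_X,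
        Polynomial.eval_ofNat]
      omega
    · have e1 : Turing.initList (machine p D) (enc x) =
          ⟨some (some p.entry), (false, none, false),
            mkStacks (fun _ => 0) [] (enc x) [] [] []⟩ := by
        unfold Turing.initList
        congr 1
        funext k
        cases k <;> rfl
      have e2 : Turing.haltList (machine p D) [decide (P x)] =
          ⟨none, (false, none, false), mkStacks (fun _ => 0) [] [] [] [] [v'.1]⟩ := by
        have : decide (P x) = v'.1 := by
          rw [hfl]
          by_cases hP : P x <;> simp [hP, h7, ← Bool.not_eq_true]
        rw [this]
        unfold Turing.haltList
        congr 1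
        funext k
        cases k <;> rfl
      rw [e1, e2]
      exact Steps.trans h9 h10
  choose n hn hsteps using key
  exact ⟨{
    tm := machine p D
    inputAlphabet := Equiv.refl α
    outputAlphabet := Equiv.refl Bool
    time := 2 * q + Polynomial.X + 2
    outputsFun := fun x =>
      { steps := n x
        evals_in_steps := by
          have h1 : (enc x).map (Equiv.refl α).invFun = enc x := List.map_id _
          have h2 := hsteps x
          unfold Steps at h2
          rw [← h1] at h2
          exact h2
        steps_le_m := hn x } }⟩

end StackProg

/-! ### Rules for executions with time bounds -/

namespace StackProg

/-- From the state `s`, with any flag, `p` leads to `s'` with the flag `b` in at most `n` steps. -/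
def Yields {α : Type} (p : Prog α) (s s' : St α) (b : Bool) (n : ℕ) : Prop :=
  ∀ fl, ∃ t ≤ n, Exec p { s with flag := fl } { s' with flag := b } t

/-- From the state `s`, with any flag, `p` leads to `s'`, with some flag, in at most `n` steps. -/
def Does {α : Type} (p : Prog α) (s s' : St α) (n : ℕ) : Prop :=
  ∀ fl, ∃ fl', ∃ t ≤ n, Exec p { s with flag := fl } { s' with flag := fl' } t

section rules

variable {α : Type} {p p' q : Prog α} {s s' s'' : St α} {b b' : Bool} {m n : ℕ}

theorem Yields.does (h : Yields p s s' b n) : Does p s s' n := by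
  intro fl
  obtain ⟨t, ht, h⟩ := h fl
  exact ⟨b, t, ht, h⟩

theorem Yields.mono (h : Yields p s s' b n) (hn : n ≤ m) : Yields p s s' b m := by
  intro fl
  obtain ⟨t, ht, h⟩ := h fl
  exact ⟨t, ht.trans hn, h⟩

theorem Does.mono (h : Does p s s' n) (hn : n ≤ m) : Does p s s' m := by
  intro fl
  obtain ⟨fl', t, ht, h⟩ := h fl
  exact ⟨fl', t, ht.trans hn, h⟩

theorem Does.seq (h : Does p s s' n) (h' : Does q s' s'' m) : Does (.seq p q) s s'' (n + m) := by
  intro fl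
  obtain ⟨fl', t, ht, h⟩ := h fl
  obtain ⟨fl'', t', ht', h'⟩ := h' fl'
  exact ⟨fl'', t + t', add_le_add ht ht', .seq h h'⟩

theorem Does.seqYields (h : Does p s s' n) (h' : Yields q s' s'' b m) :
    Yields (.seq p q) s s'' b (n + m) := by
  intro fl
  obtain ⟨fl', t, ht, h⟩ := h fl
  obtain ⟨t', ht', h'⟩ := h' fl'
  exact ⟨t + t', add_le_add ht ht', .seq h h'⟩

theorem Yields.ite (h : Yields p s s' b n) (h1 : b = true → Does p' s' s'' m)
    (h2 : b = false → Does q s' s'' m) : Does (.seq p (.ite p' q)) s s'' (n + (m + 1)) := by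
  intro fl
  obtain ⟨t, ht, h⟩ := h fl
  cases b with
  | true =>
    obtain ⟨fl', t', ht', h'⟩ := h1 rfl true
    exact ⟨fl', t + (t' + 1), by omega, .seq h (.iteTrue rfl h')⟩
  | false =>
    obtain ⟨fl', t', ht', h'⟩ := h2 rfl false
    exact ⟨fl', t + (t' + 1), by omega, .seq h (.iteFalse rfl h')⟩

theorem Yields.iteYields (h : Yields p s s' b n) (h1 : b = true → Yields p' s' s'' b' m)
    (h2 : b = false → Yields q s' s'' b' m) :
    Yields (.seq p (.ite p' q)) s s'' b' (n + (m + 1)) := by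
  intro fl
  obtain ⟨t, ht, h⟩ := h fl
  cases b with
  | true =>
    obtain ⟨t', ht', h'⟩ := h1 rfl true
    exact ⟨t + (t' + 1), by omega, .seq h (.iteTrue rfl h')⟩
  | false =>
    obtain ⟨t', ht', h'⟩ := h2 rfl false
    exact ⟨t + (t' + 1), by omega, .seq h (.iteFalse rfl h')⟩

theorem does_skip (s : St α) : Does (.op .skip) s s 1 :=
  fun fl => ⟨fl, 1, le_rfl, .op .skip _⟩

theorem does_inc (s : St α) (c : ℕ) :
    Does (.op (.inc c)) s { s with cnt := Function.update s.cnt c (s.cnt c + 1) } 1 :=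
  fun fl => ⟨fl, 1, le_rfl, .op (.inc c) _⟩

theorem yields_dec (s : St α) (c : ℕ) :
    Yields (.op (.dec c)) s { s with cnt := Function.update s.cnt c (s.cnt c - 1) }
      (decide (s.cnt c ≠ 0)) 1 :=
  fun _ => ⟨1, le_rfl, .op (.dec c) _⟩

theorem does_inRight (s : St α) : Does (.op .inRight) s { s with inPos := s.inPos + 1 } 1 :=
  fun fl => ⟨fl, 1, le_rfl, .op .inRight _⟩

theorem yields_inTest (s : St α) (f : Option α → Bool) :
    Yields (.op (.inTest f)) s s (f s.word[s.inPos]?) 1 :=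
  fun _ => ⟨1, le_rfl, .op (.inTest f) _⟩

theorem does_tabRight (s : St α) : Does (.op .tabRight) s { s with tabPos := s.tabPos + 1 } 1 :=
  fun fl => ⟨fl, 1, le_rfl, .op .tabRight _⟩

theorem yields_tabTest (s : St α) : Yields (.op .tabTest) s s (s.tab s.tabPos) 1 :=
  fun _ => ⟨1, le_rfl, .op .tabTest _⟩

theorem does_tabSet (s : St α) :
    Does (.op .tabSet) s { s with tab := Function.update s.tab s.tabPos true } 1 :=
  fun fl => ⟨fl, 1, le_rfl, .op .tabSet _⟩

theorem Yields.negate (h : Yields p s s' b n) : Yields (.seq p (.op .negate)) s s' (!b) (n + 1) := by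
  intro fl
  obtain ⟨t, ht, h⟩ := h fl
  exact ⟨t + 1, by omega, .seq h (.op .negate _)⟩

/-- The rule for counted loops: `f i` is the state after `i` rounds, and the body starts from it
with `c` already decremented. Each round costs the body and one `dec`; the final `dec` that finds
`0` gives the additional `1`. -/
theorem yields_loop_dec {c : ℕ} (N : ℕ) (f : ℕ → St α) (hc : ∀ i ≤ N, (f i).cnt c = N - i)
    (hp : ∀ i < N, Does p { f i with cnt := Function.update (f i).cnt c (N - i - 1) } (f (i + 1)) n) :
    Yields (.loop (.dec c) p) (f 0) (f N) false ((n + 1) * N + 1) := by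
  have key : ∀ d i, i + d = N → Yields (.loop (.dec c) p) (f i) (f N) false ((n + 1) * d + 1) := by
    intro d
    induction d with
    | zero =>
      intro i hi fl
      obtain rfl : i = N := by omega
      have h0 : (f i).cnt c = 0 := by rw [hc i le_rfl]; omega
      refine ⟨1, by omega, ?_⟩
      have e : ({ f i with flag := false } : St α) = (Op.dec c).run { f i with flag := fl } := by
        simp only [Op.run, h0]
        ext <;> simp
        rw [← h0, Function.update_eq_self]
      rw [e]
      exact .loopEnd (by simp [Op.run, h0])
    | succ d ih =>
      intro i hi fl
      have h0 : (f i).cnt c = N - i := hc i (by omega)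
      obtain ⟨fl', t, ht, h1⟩ := hp i (by omega) true
      obtain ⟨t', ht', h2⟩ := ih (i + 1) (by omega) fl'
      refine ⟨1 + t + t', by nlinarith, .loopNext ?_ ?_ h2⟩
      · simp [Op.run, h0]; omega
      · have e : (Op.dec c).run { f i with flag := fl } =
            { f i with cnt := Function.update (f i).cnt c (N - i - 1), flag := true } := by
          simp only [Op.run, h0]
          ext <;> simp
          omega
        rw [e]
        exact h1
  exact key N 0 (by omega)

theorem yields_rewind_in (s : St α) :
    Yields (.loop .inLeft (.op .skip)) s { s with inPos := 0 } false (2 * s.inPos + 1) := by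
  obtain ⟨w, e, i, T, j, fl⟩ := s
  induction i with
  | zero => exact fun fl => ⟨1, by simp, .loopEnd rfl⟩
  | succ i ih =>
    intro fl
    obtain ⟨t, ht, h⟩ := ih true
    exact ⟨1 + 1 + t, by simp only at ht ⊢; omega, .loopNext rfl (.op .skip _) h⟩

theorem yields_rewind_tab (s : St α) :
    Yields (.loop .tabLeft (.op .skip)) s { s with tabPos := 0 } false (2 * s.tabPos + 1) := by
  obtain ⟨w, e, i, T, j, fl⟩ := s
  induction j with
  | zero => exact fun fl => ⟨1, by simp, .loopEnd rfl⟩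
  | succ i ih =>
    intro fl
    obtain ⟨t, ht, h⟩ := ih true
    exact ⟨1 + 1 + t, by simp only at ht ⊢; omega, .loopNext rfl (.op .skip _) h⟩

end rules

section counters

variable {α : Type} (s : St α)

/-- Reset the counter `c`. -/
def clear (c : ℕ) : Prog α := .loop (.dec c) (.op .skip)

theorem yields_clear (c : ℕ) :
    Yields (clear c) s { s with cnt := Function.update s.cnt c 0 } false (2 * s.cnt c + 1) := by
  have := yields_loop_dec (p := .op .skip) (n := 1) (c := c) (s.cnt c)
    (fun i => { s with cnt := Function.update s.cnt c (s.cnt c - i) }) (by simp)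
    (fun i hi => by
      simp only [Function.update_idem]
      exact does_skip _)
  simp only [Nat.sub_zero, Function.update_eq_self, Nat.sub_self] at this
  exact this

/-- Add the counter `c` to the counter `d` and reset the counter `c`. -/
def transfer (c d : ℕ) : Prog α := .loop (.dec c) (.op (.inc d))

theorem yields_transfer {c d : ℕ} (h : c ≠ d) :
    Yields (transfer c d) s
      { s with cnt := Function.update (Function.update s.cnt c 0) d (s.cnt d + s.cnt c) } false
      (2 * s.cnt c + 1) := by
  have := yields_loop_dec (p := .op (.inc d)) (n := 1) (c := c) (s.cnt c)
    (fun i => { s with cnt := Function.update (Function.update s.cnt c (s.cnt c - i)) d (s.cnt d + i) })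
    (by simp [h])
    (fun i hi => by
      convert does_inc _ d using 1
      ext1 <;> try rfl
      funext x
      simp only [Function.update_apply]
      split_ifs <;> omega)
  simp only [Nat.sub_zero, Nat.add_zero, Function.update_eq_self, Nat.sub_self] at this
  exact this

/-- Add the counter `c` to the counter `d`, by means of the counter `d + 1`. -/
def copy (c d : ℕ) : Prog α :=
  .seq (transfer c (d + 1)) (.loop (.dec (d + 1)) (.seq (.op (.inc c)) (.op (.inc d))))

theorem yields_copy {c d : ℕ} (h : c < d) (h0 : s.cnt (d + 1) = 0) :
    Yields (copy c d) s { s with cnt := Function.update s.cnt d (s.cnt d + s.cnt c) } false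
      (5 * s.cnt c + 2) := by
  have h1 := yields_transfer s (c := c) (d := d + 1) (by omega)
  have h2 := yields_loop_dec (p := .seq (.op (.inc c)) (.op (.inc d))) (n := 2) (c := d + 1) (s.cnt c)
    (fun i => { s with cnt := Function.update (Function.update (Function.update s.cnt c i) d (s.cnt d + i)) (d + 1) (s.cnt c - i) })
    (by simp)
    (fun i hi => by
      convert (does_inc _ c).seq (does_inc _ d) using 1
      ext1 <;> try rfl
      funext x
      simp only [Function.update_apply]
      split_ifs <;> omega)
  have h3 := h1.does.seqYields (s'' := { s with cnt := Function.update s.cnt d (s.cnt d + s.cnt c) }) (by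
    convert h2 using 1
    all_goals
      ext1 <;> try rfl
      funext x
      simp only [Function.update_apply]
      split_ifs <;> subst_vars <;> omega)
  exact h3.mono (by omega)

end counters

/-! ### Numerical terms computed in polynomial time -/

/-- The numerical function `f` of the counters below `k` is computed in polynomial time, into any
counter `k' ≥ k`, by means of the counters above `k'`. -/
def IsTm (α : Type) (k : ℕ) (f : (ℕ → ℕ) → ℕ) : Prop :=
  (∀ e e', (∀ j < k, e j = e' j) → f e = f e') ∧
  ∃ q : Polynomial ℕ, (∀ e M, (∀ j < k, e j ≤ M) → f e ≤ q.eval M) ∧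
    ∃ p : ℕ → Prog α, ∀ k' ≥ k, ∀ (s : St α) (M : ℕ), (∀ j, s.cnt j ≤ M) →
      (∀ j ≥ k', s.cnt j = 0) →
      Does (p k') s { s with cnt := Function.update s.cnt k' (f s.cnt) } (q.eval M)

namespace IsTm

variable {α : Type} {k : ℕ} {f g : (ℕ → ℕ) → ℕ}

theorem mono (hf : IsTm α k f) {k' : ℕ} (h : k ≤ k') : IsTm α k' f := by
  obtain ⟨h1, q, h2, p, h3⟩ := hf
  exact ⟨fun e e' h' => h1 e e' fun j hj => h' j (by omega), q,
    fun e M h' => h2 e M fun j hj => h' j (by omega), p, fun k'' hk => h3 k'' (by omega)⟩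

theorem const (n : ℕ) : IsTm α k fun _ => n := by
  refine ⟨fun _ _ _ => rfl, Polynomial.C (n + 1), fun e M _ => by simp, ?_⟩
  induction n with
  | zero =>
    refine ⟨fun _ => .op .skip, fun k' _ s M _ h0 => ?_⟩
    have : Function.update s.cnt k' 0 = s.cnt := by rw [← h0 k' le_rfl, Function.update_eq_self]
    rw [this]
    exact (does_skip s).mono (by simp)
  | succ n ih =>
    obtain ⟨p, hp⟩ := ih
    refine ⟨fun k' => .seq (p k') (.op (.inc k')), fun k' hk s M hM h0 => ?_⟩
    have := (hp k' hk s M hM h0).seq (does_inc _ k')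
    simp only [Function.update_self, Function.update_idem] at this
    exact this.mono (by simp)

theorem var {j : ℕ} (hj : j < k) : IsTm α k fun e => e j := by
  refine ⟨fun e e' h => h j hj, 5 * Polynomial.X + 2, fun e M h => ?_, fun k' => copy j k',
    fun k' hk s M hM h0 => ?_⟩
  · have := h j hj
    simp
    omega
  · have := (yields_copy s (c := j) (d := k') (by omega) (h0 _ (by omega))).does
    rw [h0 k' le_rfl, Nat.zero_add] at this
    refine this.mono ?_
    have := hM j
    simp
    omega

theorem add (hf : IsTm α k f) (hg : IsTm α k g) : IsTm α k fun e => f e + g e := by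
  obtain ⟨hf1, qf, hf2, pf, hf3⟩ := hf
  obtain ⟨hg1, qg, hg2, pg, hg3⟩ := hg
  -- When `g` is evaluated, the counter `k'` already holds the value of `f`; this is why its time
  -- bound is taken at `X + qf`.
  refine ⟨fun e e' h => congrArg₂ _ (hf1 e e' h) (hg1 e e' h),
    qf + qg + qg.comp (Polynomial.X + qf) + 2 * qg + 1, fun e M h => ?_,
    fun k' => .seq (pf k') (.seq (pg (k' + 1)) (transfer (k' + 1) k')), fun k' hk s M hM h0 => ?_⟩
  · have := hf2 e M h
    have := hg2 e M h
    simp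
    omega
  · have hfM := hf2 s.cnt M fun j _ => hM j
    have hgM := hg2 s.cnt M fun j _ => hM j
    have h1 := hf3 k' hk s M hM h0
    have h2 := hg3 (k' + 1) (by omega) { s with cnt := Function.update s.cnt k' (f s.cnt) }
      (M + qf.eval M) (fun j => by
        simp only [Function.update_apply]
        split_ifs
        · omega
        · have := hM j
          omega) (fun j hj => by
        simp only [Function.update_apply]
        split_ifs
        · omega
        · exact h0 j (by omega))
    have e1 : g (Function.update s.cnt k' (f s.cnt)) = g s.cnt :=
      hg1 _ _ fun j hj => Function.update_of_ne (by omega) _ _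
    simp only [e1] at h2
    have h3 := (yields_transfer { s with cnt := Function.update (Function.update s.cnt k' (f s.cnt)) (k' + 1) (g s.cnt) } (c := k' + 1) (d := k') (by omega)).does
    have h4 := h1.seq (h2.seq h3)
    simp at h4
    convert h4.mono _ using 1
    · ext1 <;> try rfl
      funext x
      have := h0 (k' + 1) (by omega)
      simp only [Function.update_apply]
      split_ifs <;> subst_vars <;> omega
    · simp
      omega

theorem mul (hf : IsTm α k f) (hg : IsTm α k g) : IsTm α k fun e => f e * g e := by
  obtain ⟨hf1, qf, hf2, pf, hf3⟩ := hf
  obtain ⟨hg1, qg, hg2, pg, hg3⟩ := hg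
  -- The product is repeated addition: `k'` counts down from `f`, and each round copies `g` from `k'
  -- + 1` onto the accumulator `k' + 2`, with `k' + 3` as the scratch counter of `copy`.
  refine ⟨fun e e' h => congrArg₂ _ (hf1 e e' h) (hg1 e e' h),
    qf + qg.comp (Polynomial.X + qf) + (5 * qg + 3) * qf + 2 * qg + 2 * qf * qg + 3, fun e M h => ?_,
    fun k' => .seq (pf k') (.seq (pg (k' + 1)) (.seq (.loop (.dec k') (copy (k' + 1) (k' + 2)))
      (.seq (clear (k' + 1)) (transfer (k' + 2) k')))), fun k' hk s M hM h0 => ?_⟩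
  · have := Nat.mul_le_mul (hf2 e M h) (hg2 e M h)
    simp
    nlinarith
  · have hfM := hf2 s.cnt M fun j _ => hM j
    have hgM := hg2 s.cnt M fun j _ => hM j
    have h1 := hf3 k' hk s M hM h0
    have h2 := hg3 (k' + 1) (by omega) { s with cnt := Function.update s.cnt k' (f s.cnt) }
      (M + qf.eval M) (fun j => by
        simp only [Function.update_apply]
        split_ifs
        · omega
        · have := hM j
          omega) (fun j hj => by
        simp only [Function.update_apply]
        split_ifs
        · omega
        · exact h0 j (by omega))
    have e1 : g (Function.update s.cnt k' (f s.cnt)) = g s.cnt :=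
      hg1 _ _ fun j hj => Function.update_of_ne (by omega) _ _
    simp only [e1] at h2
    have h3 := yields_loop_dec (p := copy (k' + 1) (k' + 2)) (n := 5 * g s.cnt + 2) (c := k') (f s.cnt)
      (fun i => { s with cnt := Function.update (Function.update (Function.update s.cnt k' (f s.cnt - i)) (k' + 1) (g s.cnt)) (k' + 2) (i * g s.cnt) })
      (by simp)
      (fun i hi => by
        have := (yields_copy { s with cnt := Function.update (Function.update (Function.update s.cnt k' (f s.cnt - i - 1)) (k' + 1) (g s.cnt)) (k' + 2) (i * g s.cnt) } (c := k' + 1) (d := k' + 2) (by omega) (by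
          simp only [Function.update_apply]
          split_ifs <;> first | omega | exact h0 (k' + 2 + 1) (by omega))).does
        simp at this
        convert this using 1
        · ext1 <;> try rfl
          funext x
          simp only [Function.update_apply]
          split_ifs <;> omega
        · ext1 <;> try rfl
          funext x
          simp only [Function.update_apply]
          split_ifs
          · ring
          all_goals omega)
    have h4 := (yields_clear { s with cnt := Function.update (Function.update (Function.update s.cnt k' 0) (k' + 1) (g s.cnt)) (k' + 2) (f s.cnt * g s.cnt) } (k' + 1)).does
    have h5 := (yields_transfer { s with cnt := Function.update (Function.update (Function.update (Function.update s.cnt k' 0) (k' + 1) (g s.cnt)) (k' + 2) (f s.cnt * g s.cnt)) (k' + 1) 0 } (c := k' + 2) (d := k') (by omega)).does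
    have e3 : (Function.update (Function.update (Function.update s.cnt k' (f s.cnt)) (k' + 1) (g s.cnt)) (k' + 2) 0) = (Function.update (Function.update s.cnt k' (f s.cnt)) (k' + 1) (g s.cnt)) := by
      funext x
      have := h0 (k' + 2) (by omega)
      simp only [Function.update_apply]
      split_ifs <;> subst_vars <;> omega
    simp only [Nat.sub_zero, Nat.zero_mul, e3, Nat.sub_self] at h3
    have h6 := h1.seq (h2.seq (h3.does.seq (h4.seq h5)))
    simp at h6
    convert h6.mono _ using 1
    · ext1 <;> try rfl
      funext x
      have := h0 (k' + 1) (by omega)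
      have := h0 (k' + 2) (by omega)
      simp only [Function.update_apply]
      split_ifs <;> subst_vars <;> omega
    · have := Nat.mul_le_mul hfM hgM
      have := Nat.mul_le_mul_left 5 this
      simp
      nlinarith

theorem pow (hf : IsTm α k f) (n : ℕ) : IsTm α k fun e => f e ^ n := by
  induction n with
  | zero => simpa using const 1
  | succ n ih => simpa [pow_succ] using ih.mul hf

theorem ofDigits {ι : Type} (hf : IsTm α k f) (l : List ι) (x : ι → (ℕ → ℕ) → ℕ)
    (hx : ∀ i ∈ l, IsTm α k (x i)) :
    IsTm α k fun e => Nat.ofDigits (f e) (l.map fun i => x i e) := by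
  induction l with
  | nil => simpa using const 0
  | cons i l ih =>
    simp only [List.map_cons, Nat.ofDigits_cons]
    exact (hx i (by simp)).add (hf.mul (ih fun j hj => hx j (by simp [hj])))

end IsTm

end StackProg

/-! ### Tests decidable in polynomial time -/

namespace StackProg

/-- The counters below `k`. -/
def trunc (k : ℕ) (e : ℕ → ℕ) : ℕ → ℕ := fun j => if j < k then e j else 0

theorem trunc_eq_self {k : ℕ} {e : ℕ → ℕ} (h : ∀ j ≥ k, e j = 0) : trunc k e = e := by
  funext j
  simp only [trunc]
  split_ifs with hj
  · rfl
  · exact (h j (by omega)).symm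

/-- A quantifier stores its variable in a counter above those of the surrounding formula. Truncation
hides such counters, so that terms of the outer formula can be used unchanged inside. -/
theorem IsTm.trunc {α : Type} {k k' : ℕ} {f : (ℕ → ℕ) → ℕ} (hf : IsTm α k f) (h : k ≤ k') :
    IsTm α k' fun e => f (trunc k e) := by
  have : (fun e => f (StackProg.trunc k e)) = f := by
    funext e
    exact hf.1 _ _ fun j hj => if_pos hj
  rw [this]
  exact hf.mono h

/-- The property `P` of the word, the table and the counters below `k` is decided in polynomial
time by means of the counters from `k` on. -/
def Test {α : Type} (k : ℕ) (P : List α → (ℕ → Bool) → (ℕ → ℕ) → Prop) : Prop :=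
  ∃ (p : Prog α) (q : Polynomial ℕ), ∀ (s : St α) (M : ℕ), s.inPos = 0 → s.tabPos = 0 →
    (∀ j, s.cnt j ≤ M) → (∀ j ≥ k, s.cnt j = 0) →
    ∃ b, (b = true ↔ P s.word s.tab s.cnt) ∧ Yields p s s b (q.eval M)

namespace Test

variable {α : Type} {k : ℕ} {P Q : List α → (ℕ → Bool) → (ℕ → ℕ) → Prop} {f g : (ℕ → ℕ) → ℕ}

theorem congr (h : Test k P)
    (h' : ∀ w T e, (∀ j ≥ k, e j = 0) → (P w T e ↔ Q w T e)) : Test k Q := by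
  obtain ⟨p, q, h⟩ := h
  refine ⟨p, q, fun s M h1 h2 h3 h4 => ?_⟩
  obtain ⟨b, h5, h6⟩ := h s M h1 h2 h3 h4
  exact ⟨b, h5.trans (h' _ _ _ h4), h6⟩

/-- The truth value does not depend on the input, so classical logic only selects one of two
constant programs. -/
theorem const (c : Prop) : Test k fun (_ : List α) _ _ => c := by
  classical
  have h (fl : Bool) (s : St α) : Yields (.op (.inTest fun _ => fl)) s s fl 1 := yields_inTest s _
  exact ⟨.op (.inTest fun _ => decide c), 1, fun s M _ _ _ _ =>
    ⟨decide c, by simp, (h _ s).mono (by simp)⟩⟩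

theorem not (hP : Test k P) : Test k fun w T e => ¬ P w T e := by
  obtain ⟨p, q, h⟩ := hP
  refine ⟨.seq p (.op .negate), q + 1, fun s M h1 h2 h3 h4 => ?_⟩
  obtain ⟨b, h5, h6⟩ := h s M h1 h2 h3 h4
  exact ⟨!b, by simp [← h5], by simpa using h6.negate⟩

theorem and (hP : Test k P) (hQ : Test k Q) : Test k fun w T e => P w T e ∧ Q w T e := by
  obtain ⟨p, q, h⟩ := hP
  obtain ⟨p', q', h'⟩ := hQ
  refine ⟨.seq p (.ite p' (.op (.inTest fun _ => false))), q + (q' + 2), fun s M h1 h2 h3 h4 => ?_⟩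
  obtain ⟨b, h5, h6⟩ := h s M h1 h2 h3 h4
  obtain ⟨b', h5', h6'⟩ := h' s M h1 h2 h3 h4
  refine ⟨b && b', by simp [← h5, ← h5'], ?_⟩
  refine (h6.iteYields (m := q'.eval M + 1) (fun hb => ?_) fun hb => ?_).mono (by simp)
  · rw [hb]
    exact h6'.mono (by omega)
  · rw [hb]
    exact (yields_inTest s _).mono (by omega)

theorem or (hP : Test k P) (hQ : Test k Q) : Test k fun w T e => P w T e ∨ Q w T e :=
  (hP.not.and hQ.not).not.congr fun _ _ _ _ => by tauto

theorem imp (hP : Test k P) (hQ : Test k Q) : Test k fun w T e => P w T e → Q w T e :=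
  (hP.and hQ.not).not.congr fun _ _ _ _ => by tauto

theorem iff (hP : Test k P) (hQ : Test k Q) : Test k fun w T e => P w T e ↔ Q w T e :=
  ((hP.imp hQ).and (hQ.imp hP)).congr fun _ _ _ _ => by tauto

/-- A quantifier over a fixed finite type is unfolded into a disjunction in the program itself; it
serves for letters and for tuples of bits, as `d` is fixed. -/
theorem existsFintype {ι : Type} [Finite ι] {P : ι → List α → (ℕ → Bool) → (ℕ → ℕ) → Prop}
    (hP : ∀ i, Test k (P i)) : Test k fun w T e => ∃ i, P i w T e := by
  classical
  have := Fintype.ofFinite ι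
  have key : ∀ s : Finset ι, Test k fun w T e => ∃ i ∈ s, P i w T e := by
    intro s
    induction s using Finset.induction with
    | empty => exact (const False).congr fun _ _ _ _ => by simp
    | insert a s _ ih => exact ((hP a).or ih).congr fun _ _ _ _ => by simp
  exact (key Finset.univ).congr fun _ _ _ _ => by simp

theorem forallFintype {ι : Type} [Finite ι] {P : ι → List α → (ℕ → Bool) → (ℕ → ℕ) → Prop}
    (hP : ∀ i, Test k (P i)) : Test k fun w T e => ∀ i, P i w T e :=
  (existsFintype fun i => (hP i).not).not.congr fun _ _ _ _ => by simp

theorem lt (hf : IsTm α k f) (hg : IsTm α k g) :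
    Test k fun (_ : List α) _ e => f e < g e := by
  obtain ⟨hf1, qf, hf2, pf, hf3⟩ := hf
  obtain ⟨hg1, qg, hg2, pg, hg3⟩ := hg
  -- Subtracting `f` from `g` with truncation leaves `k + 1` positive iff `f < g`. This bit is moved
  -- to counter `k`, so that after `k + 1` is cleared the last `dec` both resets `k` and puts the
  -- bit into the flag.
  refine ⟨.seq (pf k) (.seq (pg (k + 1)) (.seq (.loop (.dec k) (.op (.dec (k + 1))))
    (.seq (.seq (.op (.dec (k + 1))) (.ite (.op (.inc k)) (.op .skip)))
      (.seq (clear (k + 1)) (.op (.dec k)))))),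
    qf + qg.comp (Polynomial.X + qf) + 2 * qf + 2 * qg + 10, fun s M _ _ hM h0 => ?_⟩
  have hfM := hf2 s.cnt M fun j _ => hM j
  have hgM := hg2 s.cnt M fun j _ => hM j
  have h1 := hf3 k le_rfl s M hM h0
  have h2 := hg3 (k + 1) (by omega) { s with cnt := Function.update s.cnt k (f s.cnt) }
    (M + qf.eval M) (fun j => by
      simp only [Function.update_apply]
      split_ifs
      · omega
      · have := hM j
        omega) (fun j hj => by
      simp only [Function.update_apply]
      split_ifs
      · omega
      · exact h0 j (by omega))
  have e1 : g (Function.update s.cnt k (f s.cnt)) = g s.cnt :=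
    hg1 _ _ fun j hj => Function.update_of_ne (by omega) _ _
  simp only [e1] at h2
  have h3 := yields_loop_dec (p := .op (.dec (k + 1))) (n := 1) (c := k) (f s.cnt)
    (fun i => { s with cnt := Function.update (Function.update s.cnt k (f s.cnt - i)) (k + 1) (g s.cnt - i) })
    (by simp)
    (fun i hi => by
      convert (yields_dec _ (k + 1)).does using 1
      ext1 <;> try rfl
      funext x
      simp only [Function.update_apply]
      split_ifs <;> omega)
  simp only [Nat.sub_zero, Nat.sub_self] at h3
  have h4 := (yields_dec { s with cnt := Function.update (Function.update s.cnt k 0) (k + 1) (g s.cnt - f s.cnt) } (k + 1)).ite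
    (p' := .op (.inc k)) (q := .op .skip) (m := 1)
    (s'' := { s with cnt := Function.update (Function.update s.cnt k (if f s.cnt < g s.cnt then 1 else 0)) (k + 1) (g s.cnt - f s.cnt - 1) })
    (fun hb => by
      simp at hb
      convert does_inc _ k using 1
      ext1 <;> try rfl
      funext x
      simp only [Function.update_apply]
      split_ifs <;> omega)
    (fun hb => by
      simp at hb
      convert does_skip _ using 1
      ext1 <;> try rfl
      funext x
      simp only [Function.update_apply]
      split_ifs <;> omega)
  have h5 := (yields_clear { s with cnt := Function.update (Function.update s.cnt k (if f s.cnt < g s.cnt then 1 else 0)) (k + 1) (g s.cnt - f s.cnt - 1) } (k + 1)).does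
  have h6 := yields_dec { s with cnt := Function.update (Function.update (Function.update s.cnt k (if f s.cnt < g s.cnt then 1 else 0)) (k + 1) (g s.cnt - f s.cnt - 1)) (k + 1) 0 } k
  have h7 := h1.seqYields (h2.seqYields (h3.does.seqYields (h4.seqYields (h5.seqYields h6))))
  refine ⟨decide (f s.cnt < g s.cnt), by simp, ?_⟩
  · convert h7.mono _ using 1
    · ext1 <;> try rfl
      funext x
      have := h0 k (by omega)
      have := h0 (k + 1) (by omega)
      simp only [Function.update_apply]
      split_ifs <;> subst_vars <;> omega
    · simp
    · simp
      omega

theorem le (hf : IsTm α k f) (hg : IsTm α k g) : Test k fun (_ : List α) _ e => f e ≤ g e :=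
  (lt hg hf).not.congr fun _ _ _ _ => not_lt

theorem eq (hf : IsTm α k f) (hg : IsTm α k g) : Test k fun (_ : List α) _ e => f e = g e :=
  ((le hf hg).and (le hg hf)).congr fun _ _ _ _ => le_antisymm_iff.symm

/-- Save the flag in the counter `c`, run `p`, and restore the flag. -/
def keepFlag (c : ℕ) (p q : Prog α) : Prog α :=
  .seq (.seq p (.ite (.op (.inc c)) (.op .skip))) (.seq q (.op (.dec c)))

theorem yields_keepFlag {p q : Prog α} {s s' s'' : St α} {b : Bool} {c m n : ℕ}
    (hp : Yields p s s' b m) (h0 : s'.cnt c = 0)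
    (hq : Does q { s' with cnt := Function.update s'.cnt c (if b then 1 else 0) }
      { s'' with cnt := Function.update s''.cnt c (if b then 1 else 0) } n) (h0' : s''.cnt c = 0) :
    Yields (keepFlag c p q) s s'' b (m + n + 3) := by
  have h1 := hp.ite (p' := .op (.inc c)) (q := .op .skip) (m := 1)
    (s'' := { s' with cnt := Function.update s'.cnt c (if b then 1 else 0) })
    (fun hb => by
      convert does_inc s' c using 1
      ext1 <;> try rfl
      simp [h0, hb])
    (fun hb => by
      convert does_skip s' using 1
      ext1 <;> try rfl
      funext x
      simp only [Function.update_apply]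
      split_ifs <;> simp_all)
  have h2 := yields_dec { s'' with cnt := Function.update s''.cnt c (if b then 1 else 0) } c
  have h3 := h1.seqYields (hq.seqYields h2)
  unfold keepFlag
  convert h3.mono _ using 1
  · ext1 <;> try rfl
    funext x
    simp only [Function.update_apply]
    split_ifs <;> simp_all
  · simp
  · omega

/-- The head is moved to its place by a counted loop. Rewinding it destroys the flag, so the answer
waits in counter `k` meanwhile. -/
theorem inp (hf : IsTm α k f) (t : Option α → Bool) :
    Test k fun w _ e => t w[f e]? = true := by
  obtain ⟨hf1, qf, hf2, pf, hf3⟩ := hf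
  refine ⟨.seq (pf k) (.seq (.loop (.dec k) (.op .inRight))
    (keepFlag k (.op (.inTest t)) (.loop .inLeft (.op .skip)))), 5 * qf + 10,
    fun s M hi _ hM h0 => ?_⟩
  have hfM := hf2 s.cnt M fun j _ => hM j
  have h1 := hf3 k le_rfl s M hM h0
  have h2 := yields_loop_dec (p := .op .inRight) (n := 1) (c := k) (f s.cnt)
    (fun i => { s with cnt := Function.update s.cnt k (f s.cnt - i), inPos := i })
    (by simp)
    (fun i hi => by
      convert does_inRight _ using 1
      simp [Nat.sub_sub])
  have h3 := yields_keepFlag (c := k) (s'' := s) (yields_inTest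
    { s with cnt := Function.update s.cnt k 0, inPos := f s.cnt } t) (by simp)
    (by
      convert (yields_rewind_in _).does using 1
      ext1 <;> try rfl
      · simp
      · simp [hi]) (h0 k le_rfl)
  simp only [Nat.sub_zero, Nat.sub_self] at h2
  have e : ({ s with cnt := Function.update s.cnt k (f s.cnt), inPos := 0 } : St α) =
      { s with cnt := Function.update s.cnt k (f s.cnt) } := by
    rw [← hi]
  rw [e] at h2
  refine ⟨_, Iff.rfl, (h1.seqYields (h2.does.seqYields h3)).mono ?_⟩
  simp
  omega

theorem tab (hf : IsTm α k f) : Test k fun (_ : List α) T e => T (f e) = true := by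
  obtain ⟨hf1, qf, hf2, pf, hf3⟩ := hf
  refine ⟨.seq (pf k) (.seq (.loop (.dec k) (.op .tabRight))
    (keepFlag k (.op .tabTest) (.loop .tabLeft (.op .skip)))), 5 * qf + 10,
    fun s M _ hi hM h0 => ?_⟩
  have hfM := hf2 s.cnt M fun j _ => hM j
  have h1 := hf3 k le_rfl s M hM h0
  have h2 := yields_loop_dec (p := .op .tabRight) (n := 1) (c := k) (f s.cnt)
    (fun i => { s with cnt := Function.update s.cnt k (f s.cnt - i), tabPos := i })
    (by simp)
    (fun i hi => by
      convert does_tabRight _ using 1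
      simp [Nat.sub_sub])
  have h3 := yields_keepFlag (c := k) (s'' := s) (yields_tabTest
    { s with cnt := Function.update s.cnt k 0, tabPos := f s.cnt }) (by simp)
    (by
      convert (yields_rewind_tab _).does using 1
      ext1 <;> try rfl
      · simp
      · simp [hi]) (h0 k le_rfl)
  simp only [Nat.sub_zero, Nat.sub_self] at h2
  have e : ({ s with cnt := Function.update s.cnt k (f s.cnt), tabPos := 0 } : St α) =
      { s with cnt := Function.update s.cnt k (f s.cnt) } := by
    rw [← hi]
  rw [e] at h2
  refine ⟨_, Iff.rfl, (h1.seqYields (h2.does.seqYields h3)).mono ?_⟩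
  simp
  omega

/-- Counter `k` holds the number of candidates left, `k + 1` the candidate `x`, and `k + 2` whether
a witness was found. The test of `Q` is assumed for every term `x` and with `trunc k e`, so that it
ignores these counters and quantifiers can be nested. -/
theorem exists_lt (hf : IsTm α k f) {Q : List α → (ℕ → Bool) → (ℕ → ℕ) → ℕ → Prop}
    (hQ : ∀ k' ≥ k, ∀ x, IsTm α k' x → Test k' fun w T e => Q w T (trunc k e) (x e)) :
    Test k fun w T e => ∃ x < f e, Q w T e x := by
  classical
  obtain ⟨hf1, qf, hf2, pf, hf3⟩ := hf
  obtain ⟨p, q, h⟩ := hQ (k + 3) (by omega) (fun e => e (k + 1)) (IsTm.var (by omega))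
  -- A truncated `dec` followed by `inc` turns both 0 and 1 into 1, so the witness counter is set
  -- without a case distinction.
  refine ⟨.seq (pf k) (.seq (.loop (.dec k) (.seq (.seq p
    (.ite (.seq (.op (.dec (k + 2))) (.op (.inc (k + 2)))) (.op .skip))) (.op (.inc (k + 1)))))
    (.seq (clear (k + 1)) (.op (.dec (k + 2))))),
    3 * qf + (q.comp (Polynomial.X + qf + 1) + 6) * qf + 10, fun s M hi ht hM h0 => ?_⟩
  have hfM := hf2 s.cnt M fun j _ => hM j
  have h1 := hf3 k le_rfl s M hM h0
  let acc (i : ℕ) : ℕ := if ∃ x < i, Q s.word s.tab s.cnt x then 1 else 0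
  have hacc (i : ℕ) : acc i ≠ 0 ↔ ∃ x < i, Q s.word s.tab s.cnt x := by
    simp only [acc]
    split_ifs with h <;> simp [h]
  have hacc' (i : ℕ) : acc i ≤ 1 := by
    simp only [acc]
    split_ifs <;> omega
  have hacc0 : acc 0 = 0 := by simp [acc]
  clear_value acc
  set F : ℕ → St α := fun i => { s with cnt := Function.update (Function.update (Function.update s.cnt k (f s.cnt - i)) (k + 1) i) (k + 2) (acc i) } with hF
  have h2 := yields_loop_dec (p := .seq (.seq p
    (.ite (.seq (.op (.dec (k + 2))) (.op (.inc (k + 2)))) (.op .skip))) (.op (.inc (k + 1))))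
    (n := q.eval (M + qf.eval M + 1) + 4) (c := k) (f s.cnt) F (by simp [hF]) (fun i hi' => by
      obtain ⟨b, hb, hy⟩ := h { F i with cnt := Function.update (F i).cnt k (f s.cnt - i - 1) }
        (M + qf.eval M + 1) hi ht (fun j => by
          have := hM j
          have := hacc' i
          simp only [hF, Function.update_apply]
          split_ifs <;> omega) (fun j hj => by
          have := h0 j (by omega)
          simp only [hF, Function.update_apply]
          split_ifs <;> omega)
      have e1 : trunc k (Function.update (F i).cnt k (f s.cnt - i - 1)) = s.cnt := by
        funext j
        have := h0 j
        simp only [trunc, hF, Function.update_apply]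
        split_ifs <;> omega
      have e2 : Function.update (F i).cnt k (f s.cnt - i - 1) (k + 1) = i := by
        simp [hF]
      simp only [e1, e2] at hb
      have hex : (∃ x < i + 1, Q s.word s.tab s.cnt x) ↔
          (∃ x < i, Q s.word s.tab s.cnt x) ∨ Q s.word s.tab s.cnt i := by
        constructor
        · rintro ⟨x, hx, hq⟩
          rcases Nat.lt_succ_iff_lt_or_eq.1 hx with h | rfl
          · exact Or.inl ⟨x, h, hq⟩
          · exact Or.inr hq
        · rintro (⟨x, hx, hq⟩ | hq)
          · exact ⟨x, by omega, hq⟩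
          · exact ⟨i, by omega, hq⟩
      have h3 := hy.ite (p' := .seq (.op (.dec (k + 2))) (.op (.inc (k + 2)))) (q := .op .skip)
        (m := 2) (s'' := { s with cnt := Function.update (Function.update (Function.update s.cnt k (f s.cnt - i - 1)) (k + 1) i) (k + 2) (acc (i + 1)) })
        (fun hbt => by
          have h3 := (hacc (i + 1)).2 (hex.2 (Or.inr (hb.1 hbt)))
          have h4 := hacc' (i + 1)
          have : acc (i + 1) = 1 := by omega
          have h5 := hacc' i
          convert (yields_dec _ (k + 2)).does.seq (does_inc _ (k + 2)) using 1
          ext1 <;> try rfl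
          funext x
          simp only [this, hF, Function.update_apply]
          split_ifs <;> omega)
        (fun hbf => by
          have hn : ¬ Q s.word s.tab s.cnt i := by rw [← hb, hbf]; simp
          have : acc (i + 1) = acc i := by
            have h3 := hacc (i + 1)
            rw [hex, or_iff_left hn, ← hacc i] at h3
            have h4 := hacc' (i + 1)
            have h5 := hacc' i
            omega
          refine Does.mono ?_ (show 1 ≤ 2 by norm_num)
          convert does_skip _ using 1
          ext1 <;> try rfl
          funext x
          simp only [this, hF, Function.update_apply]
          split_ifs <;> omega)
      convert h3.seq (does_inc _ (k + 1)) using 1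
      ext1 <;> try rfl
      funext x
      simp only [hF, Function.update_apply]
      split_ifs <;> omega)
  have h4 := (yields_clear (F (f s.cnt)) (k + 1)).does
  have h5 := yields_dec { F (f s.cnt) with cnt := Function.update (F (f s.cnt)).cnt (k + 1) 0 } (k + 2)
  have e0 : F 0 = { s with cnt := Function.update s.cnt k (f s.cnt) } := by
    ext1 <;> try rfl
    funext x
    have := h0 x
    simp only [hF, Function.update_apply]
    split_ifs <;> omega
  rw [e0] at h2
  refine ⟨decide (∃ x < f s.cnt, Q s.word s.tab s.cnt x), by simp, ?_⟩
  · convert (h1.seqYields (h2.does.seqYields (h4.seqYields h5))).mono _ using 1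
    · ext1 <;> try rfl
      funext x
      have := h0 x
      have := hacc' (f s.cnt)
      simp only [hF, Function.update_apply]
      split_ifs <;> omega
    · simp [hF, ← hacc]
    · have := Nat.mul_le_mul_left (q.eval (M + qf.eval M + 1) + 4 + 1) hfM
      simp [hF]
      nlinarith

theorem forall_lt (hf : IsTm α k f) {Q : List α → (ℕ → Bool) → (ℕ → ℕ) → ℕ → Prop}
    (hQ : ∀ k' ≥ k, ∀ x, IsTm α k' x → Test k' fun w T e => Q w T (trunc k e) (x e)) :
    Test k fun w T e => ∀ x < f e, Q w T e x :=
  (exists_lt (Q := fun w T e x => ¬ Q w T e x) hf fun k' hk x hx => (hQ k' hk x hx).not).not.congr fun _ _ _ _ => by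
    push Not
    rfl

end Test

end StackProg

/-! ### Tables filled by repeated passes -/

namespace StackProg

section tables

variable {α : Type} {k A : ℕ} (Φ : List α → (ℕ → Bool) → (ℕ → ℕ) → Prop) (idx : (ℕ → ℕ) → ℕ)

open Classical in
/-- The table after trying to apply the rule `Φ` once for all values below `e (A + 1)` of the first
`m` counters, in turn. -/
noncomputable def passTab (A : ℕ) (w : List α) : ℕ → (ℕ → ℕ) → (ℕ → Bool) → (ℕ → Bool)
  | 0, e, T => if Φ w T e then Function.update T (idx e) true else T
  | m + 1, e, T => Nat.rec T (fun i Ti => passTab A w m (Function.update e m i) Ti) (e (A + 1))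

variable {Φ idx}

theorem exists_does_setTab (hidx : IsTm α k idx) :
    ∃ (p : Prog α) (q : Polynomial ℕ), ∀ (s : St α) (M : ℕ), s.tabPos = 0 →
      (∀ j, s.cnt j ≤ M) → (∀ j ≥ k, s.cnt j = 0) →
      Does p s { s with tab := Function.update s.tab (idx s.cnt) true } (q.eval M) := by
  obtain ⟨hf1, qf, hf2, pf, hf3⟩ := hidx
  refine ⟨.seq (pf k) (.seq (.loop (.dec k) (.op .tabRight)) (.seq (.op .tabSet)
    (.loop .tabLeft (.op .skip)))), 5 * qf + 10, fun s M hi hM h0 => ?_⟩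
  have hfM := hf2 s.cnt M fun j _ => hM j
  have h1 := hf3 k le_rfl s M hM h0
  have h2 := yields_loop_dec (p := .op .tabRight) (n := 1) (c := k) (idx s.cnt)
    (fun i => { s with cnt := Function.update s.cnt k (idx s.cnt - i), tabPos := i })
    (by simp)
    (fun i hi => by
      convert does_tabRight _ using 1
      simp [Nat.sub_sub])
  simp only [Nat.sub_zero, Nat.sub_self] at h2
  have e : ({ s with cnt := Function.update s.cnt k (idx s.cnt), tabPos := 0 } : St α) =
      { s with cnt := Function.update s.cnt k (idx s.cnt) } := by
    rw [← hi]
  rw [e] at h2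
  have h3 := h1.seq (h2.does.seq ((does_tabSet _).seq (yields_rewind_tab _).does))
  convert h3.mono _ using 1
  · ext1 <;> try rfl
    · simp only
      rw [← h0 k le_rfl, Function.update_eq_self]
    · exact hi
  · simp
    omega

/-- A pass is `A` nested loops. Stage `m + 1` lets counter `m` run upwards under the control of
counter `2 * A + 2 - m`. The controls fill the places `A + 3` to `2 * A + 2`, so `A + 2` stays free
for the number of rounds and the rule is tested with scratch counters from `2 * A + 3` on. -/
theorem exists_does_pass (hidx : IsTm α (A + 2) idx)
    (hΦ : ∀ k ≥ A + 2, Test k fun w T e => Φ w T (trunc (A + 2) e)) :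
    ∀ m ≤ A, ∃ (p : Prog α) (q : Polynomial ℕ), ∀ (s : St α) (M : ℕ), s.inPos = 0 → s.tabPos = 0 →
      (∀ j, s.cnt j ≤ M) → (∀ j ≥ 2 * A + 3 - m, s.cnt j = 0) → (∀ j < m, s.cnt j = 0) →
      Does p s { s with tab := passTab Φ idx A s.word m (trunc (A + 2) s.cnt) s.tab } (q.eval M) := by
  intro m
  induction m with
  | zero =>
    intro _
    obtain ⟨p, q, h⟩ := hΦ (2 * A + 3) (by omega)
    obtain ⟨p', q', h'⟩ := exists_does_setTab (hidx.mono (show A + 2 ≤ 2 * A + 3 by omega))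
    refine ⟨.seq p (.ite p' (.op .skip)), q + (q' + 1 + 1), fun s M hi ht hM h0 _ => ?_⟩
    obtain ⟨b, hb, h1⟩ := h s M hi ht hM h0
    have h2 := h' s M ht hM h0
    have e1 : idx (trunc (A + 2) s.cnt) = idx s.cnt := hidx.1 _ _ fun j hj => if_pos hj
    refine (h1.ite (m := q'.eval M + 1) (fun hbt => ?_) fun hbf => ?_).mono (by simp)
    · simp only [passTab, if_pos (hb.1 hbt), e1]
      exact h2.mono (by omega)
    · have : ¬ Φ s.word s.tab (trunc (A + 2) s.cnt) := fun hf =>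
        Bool.false_ne_true (hbf.symm.trans (hb.2 hf))
      simp only [passTab, if_neg this]
      exact (does_skip s).mono (by omega)
  | succ m ih =>
    intro hm
    obtain ⟨p, q, h⟩ := ih (by omega)
    set c := 2 * A + 2 - m with hc
    refine ⟨.seq (copy (A + 1) c) (.seq (.loop (.dec c) (.seq p (.op (.inc m)))) (clear m)),
      10 * Polynomial.X + (q + 2) * Polynomial.X + 10, fun s M hi ht hM h0 hz => ?_⟩
    have h1 := yields_copy s (c := A + 1) (d := c) (by omega) (h0 _ (by omega))
    rw [h0 c (by omega), zero_add] at h1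
    set e := trunc (A + 2) s.cnt with he
    have heN : e (A + 1) = s.cnt (A + 1) := by simp [he, trunc]
    let T (i : ℕ) : ℕ → Bool := Nat.rec s.tab
      (fun i Ti => passTab Φ idx A s.word m (Function.update e m i) Ti) i
    have hNM := hM (A + 1)
    have h2 := yields_loop_dec (p := .seq p (.op (.inc m))) (n := q.eval M + 1) (c := c)
      (s.cnt (A + 1)) (fun i => { s with cnt := Function.update (Function.update s.cnt m i) c (s.cnt (A + 1) - i), tab := T i })
      (by simp) (fun i hi' => by
        have h3 := h { s with cnt := Function.update (Function.update s.cnt m i) c (s.cnt (A + 1) - i - 1), tab := T i } M hi ht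
          (fun j => by
            have := hM j
            simp only [Function.update_apply]
            split_ifs <;> omega)
          (fun j hj => by
            have := h0 j (by omega)
            simp only [Function.update_apply]
            split_ifs <;> omega)
          (fun j hj => by
            have := hz j (by omega)
            simp only [Function.update_apply]
            split_ifs <;> omega)
        have e1 : trunc (A + 2) (Function.update (Function.update s.cnt m i) c (s.cnt (A + 1) - i - 1)) = Function.update e m i := by
          funext j
          simp only [he, trunc, Function.update_apply]
          split_ifs <;> omega
        simp only [e1] at h3
        convert h3.seq (does_inc _ m) using 1
        · ext1 <;> try rfl
          simp
        · ext1 <;> try rfl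
          funext j
          simp only [Function.update_apply]
          split_ifs <;> omega)
    have h3 := (yields_clear { s with cnt := Function.update (Function.update s.cnt m (s.cnt (A + 1))) c 0, tab := T (s.cnt (A + 1)) } m).does.mono
      (show _ ≤ 2 * s.cnt (A + 1) + 1 by
        simp only
        rw [Function.update_of_ne (by omega), Function.update_self])
    have e0 : Function.update (Function.update s.cnt m 0) c (s.cnt (A + 1)) =
        Function.update s.cnt c (s.cnt (A + 1)) := by
      have := hz m (by omega)
      funext j
      simp only [Function.update_apply]
      split_ifs <;> subst_vars <;> omega
    simp only [Nat.sub_zero, Nat.sub_self, e0] at h2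
    have h4 := h1.does.seq (h2.does.seq h3)
    convert h4.mono _ using 1
    · ext1 <;> try rfl
      · have := hz m (by omega)
        have := h0 c (by omega)
        funext j
        simp only [Function.update_apply]
        split_ifs <;> subst_vars <;> omega
      · simp only [passTab, heN]
        rfl
    · have := Nat.mul_le_mul_left (q.eval M + 1 + 1) hNM
      simp
      nlinarith

/-- The counters after the initialization: `A` zeros, the length of the input, the range of the
loops. -/
def envAt (A ℓ N : ℕ) : ℕ → ℕ := Function.update (Function.update (fun _ => 0) A ℓ) (A + 1) N

theorem exists_does_length (c : ℕ) : ∃ (p : Prog α) (q : Polynomial ℕ), ∀ w : List α,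
    Does p (St.initial w) { St.initial w with cnt := Function.update (fun _ => 0) c w.length }
      (q.eval w.length) := by
  refine ⟨.seq (.loop (.inTest Option.isSome) (.seq (.op .inRight) (.op (.inc c))))
    (.loop .inLeft (.op .skip)), 5 * Polynomial.X + 5, fun w => ?_⟩
  let F (i : ℕ) : St α := { St.initial w with cnt := Function.update (fun _ => 0) c i, inPos := i }
  have key : ∀ d i, i + d = w.length →
      Yields (.loop (.inTest Option.isSome) (.seq (.op .inRight) (.op (.inc c)))) (F i) (F w.length)
        false (3 * d + 1) := by
    intro d
    induction d with
    | zero =>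
      intro i hi fl
      obtain rfl : i = w.length := by omega
      exact ⟨1, by omega, by
        convert Exec.loopEnd (s := { F w.length with flag := fl }) _ using 1
        · simp [Op.run, F, St.initial]
        · simp [Op.run, F, St.initial]⟩
    | succ d ih =>
      intro i hi fl
      obtain ⟨fl', t, ht, h⟩ := (does_inRight (F i)).seq (does_inc _ c) true
      obtain ⟨t', ht', h'⟩ := ih (i + 1) (by omega) fl'
      have hi' : i < w.length := by omega
      refine ⟨1 + t + t', by omega, Exec.loopNext ?_ ?_ h'⟩
      · simp [Op.run, F, St.initial, hi']
      · convert h using 1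
        · simp [Op.run, F, St.initial, hi']
        · simp [F]
  have h1 := (key w.length 0 (by omega)).does.seq (yields_rewind_in _).does
  convert h1.mono _ using 1
  · ext1 <;> try rfl
    simp only [F, St.initial]
    funext j
    simp [Function.update_apply]
  · rfl
  · simp [F]
    omega

/-- A problem is in P if it is decided by computing a table by iteration of a rule that is tested in
polynomial time, and a test of the table. -/
theorem decidableInPolyTime_of_pass {X : Type} [Inhabited α] [Fintype α] {enc : X → List α}
    {P : X → Prop} {N : (ℕ → ℕ) → ℕ} (hN : IsTm α (A + 1) N) (hidx : IsTm α (A + 2) idx)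
    (hΦ : ∀ k ≥ A + 2, Test k fun w T e => Φ w T (trunc (A + 2) e))
    {Acc : List α → (ℕ → Bool) → (ℕ → ℕ) → Prop} (hAcc : Test (A + 2) Acc)
    (h : ∀ x, ∀ n, n = N (Function.update (fun _ => 0) A (enc x).length) →
      (Acc (enc x) ((passTab Φ idx A (enc x) A (envAt A (enc x).length n))^[n ^ A] fun _ => false)
        (envAt A (enc x).length n) ↔ P x)) :
    DecidableInPolyTime enc P := by
  obtain ⟨p1, q1, h1⟩ := exists_does_length (α := α) A
  obtain ⟨-, q2, h2', p2, h2⟩ := hN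
  obtain ⟨-, q3, h3', p3, h3⟩ := (IsTm.var (α := α) (show A + 1 < A + 2 by omega)).pow A
  obtain ⟨p4, q4, h4⟩ := exists_does_pass hidx hΦ A le_rfl
  obtain ⟨p5, q5, h5⟩ := hAcc
  let Q : Polynomial ℕ := Polynomial.X + q2
  -- Counter `A` receives the input length, `A + 1` the range `n`, and `A + 2` the number `n ^ A` of
  -- passes. This last counter is `0` again when the final test uses it as scratch; afterwards it
  -- keeps the answer while `A` and `A + 1` are cleared.
  refine decidableInPolyTime_of_prog (.seq p1 (.seq (p2 (A + 1)) (.seq (p3 (A + 2))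
    (.seq (.loop (.dec (A + 2)) p4)
      (Test.keepFlag (A + 2) p5 (.seq (clear A) (clear (A + 1)))))))) (q1 + q2 + q3.comp Q +
      (q4.comp (Q + q3.comp Q) + 1) * q3.comp Q + q5.comp Q + 2 * Q + 2 * Q + 10) fun x => ?_
  set w := enc x with hw
  set ℓ := w.length with hℓ
  obtain ⟨n, hn⟩ : ∃ n, n = N (Function.update (fun _ => 0) A ℓ) := ⟨_, rfl⟩
  have hP := h x n hn
  have i1 := h1 w
  have i2 := h2 (A + 1) le_rfl { St.initial w with cnt := Function.update (fun _ => 0) A ℓ } ℓ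
    (fun j => by simp only [Function.update_apply]; split_ifs <;> omega)
    (fun j hj => by simp only [Function.update_apply]; split_ifs <;> omega)
  have hnQ : n ≤ q2.eval ℓ := by
    rw [hn]
    exact h2' _ _ fun j _ => by simp only [Function.update_apply]; split_ifs <;> omega
  rw [← hn] at i2
  have hQ : Q.eval ℓ = ℓ + q2.eval ℓ := by simp [Q]
  have i3 := h3 (A + 2) le_rfl { St.initial w with cnt := envAt A ℓ n } (Q.eval ℓ)
    (fun j => by simp only [envAt, Function.update_apply]; split_ifs <;> omega)
    (fun j hj => by simp only [envAt, Function.update_apply]; split_ifs <;> omega)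
  have e1 : envAt A ℓ n (A + 1) = n := by simp [envAt]
  simp only [e1] at i3
  have hn3 : n ^ A ≤ q3.eval (Q.eval ℓ) := by
    rw [← e1]
    exact h3' _ _ fun j _ => by simp only [envAt, Function.update_apply]; split_ifs <;> omega
  let T (i : ℕ) : ℕ → Bool := (passTab Φ idx A w A (envAt A ℓ n))^[i] fun _ => false
  have i4 := yields_loop_dec (p := p4) (n := q4.eval (Q.eval ℓ + q3.eval (Q.eval ℓ))) (c := A + 2)
    (n ^ A) (fun i => { St.initial w with cnt := Function.update (envAt A ℓ n) (A + 2) (n ^ A - i), tab := T i })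
    (by simp) (fun i hi => by
      have := h4 { St.initial w with cnt := Function.update (envAt A ℓ n) (A + 2) (n ^ A - i - 1), tab := T i }
        (Q.eval ℓ + q3.eval (Q.eval ℓ)) rfl rfl
        (fun j => by simp only [envAt, Function.update_apply]; split_ifs <;> omega)
        (fun j hj => by simp only [envAt, Function.update_apply]; split_ifs <;> omega)
        (fun j hj => by simp only [envAt, Function.update_apply]; split_ifs <;> omega)
      have e2 : trunc (A + 2) (Function.update (envAt A ℓ n) (A + 2) (n ^ A - i - 1)) = envAt A ℓ n := by
        funext j
        simp only [trunc, envAt, Function.update_apply]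
        split_ifs <;> omega
      simp only [e2] at this
      convert this using 1
      · simp
      · simp only [Nat.sub_sub, T, Function.iterate_succ_apply']
        rfl)
  have e3 : Function.update (envAt A ℓ n) (A + 2) 0 = envAt A ℓ n := by
    funext j
    simp only [envAt, Function.update_apply]
    split_ifs <;> omega
  simp only [Nat.sub_zero, Nat.sub_self, e3] at i4
  obtain ⟨b, hb, i5⟩ := h5 { St.initial w with cnt := envAt A ℓ n, tab := T (n ^ A) } (Q.eval ℓ)
    rfl rfl (fun j => by simp only [envAt, Function.update_apply]; split_ifs <;> omega)
    (fun j hj => by simp only [envAt, Function.update_apply]; split_ifs <;> omega)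
  have i6 := (yields_clear { St.initial w with cnt := Function.update (envAt A ℓ n) (A + 2) (if b then 1 else 0), tab := T (n ^ A) } A).does.seq (yields_clear _ (A + 1)).does |>.mono
    (show _ ≤ 2 * ℓ + 2 * n + 2 by simp [envAt]; omega)
  have i7 := Test.yields_keepFlag (c := A + 2) (s'' := { St.initial w with cnt := fun _ => 0, tab := T (n ^ A) }) i5
    (by simp [envAt]) (by
      convert i6 using 1
      ext1 <;> try rfl
      funext j
      simp only [envAt, Function.update_apply]
      split_ifs <;> omega) rfl
  obtain ⟨t, ht, i8⟩ := (i1.seqYields (i2.seqYields (i3.seqYields (i4.does.seqYields i7)))) false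
  refine ⟨_, t, i8, ht.trans ?_, rfl, rfl, rfl, rfl, ?_⟩
  · have := Nat.mul_le_mul_left (q4.eval (Q.eval ℓ + q3.eval (Q.eval ℓ)) + 1) hn3
    simp only [Polynomial.eval_add, Polynomial.eval_mul, Polynomial.eval_comp, Polynomial.eval_one,
      Polynomial.eval_ofNat]
    rw [← hℓ]
    omega
  · exact hb.trans hP

end tables

end StackProg

/-! ### The table as a least fixed point -/

namespace StackProg

/-- As long as the table is not fixed, each application of `F` makes a new entry true, and only `B`
entries can ever be true. If round `B` did not give a fixed point, `B + 1` rounds would have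
produced `B + 1` entries below `B`. -/
theorem iterate_fixed_of_bounded (F : (ℕ → Bool) → (ℕ → Bool)) (T : ℕ → Bool) (B : ℕ)
    (hF : ∀ T z, T z = true → F T z = true) (hB : ∀ r z, F^[r] T z = true → z < B) :
    F (F^[B] T) = F^[B] T := by
  by_contra hne
  have h1 : ∀ r ≤ B, F (F^[r] T) ≠ F^[r] T := by
    intro r hr he
    apply hne
    obtain ⟨d, rfl⟩ := Nat.exists_eq_add_of_le hr
    rw [Nat.add_comm, Function.iterate_add_apply]
    have : F^[d] (F^[r] T) = F^[r] T := Function.iterate_fixed he d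
    rw [this, he]
  have h2 : ∀ r ≤ B + 1, r ≤ ((Finset.range B).filter fun z => F^[r] T z = true).card := by
    intro r
    induction r with
    | zero => intro _; omega
    | succ r ih =>
      intro hr
      have hlt : ((Finset.range B).filter fun z => F^[r] T z = true) ⊂
          ((Finset.range B).filter fun z => F^[r + 1] T z = true) := by
        rw [Finset.ssubset_iff_of_subset]
        · have := h1 r (by omega)
          rw [Ne, funext_iff] at this
          push Not at this
          obtain ⟨z, hz⟩ := this
          have hz1 : F (F^[r] T) z = true := by
            by_contra hz1
            rw [Bool.not_eq_true] at hz1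
            have : F^[r] T z = false := by
              by_contra hz2
              rw [Bool.not_eq_false] at hz2
              rw [hF _ _ hz2] at hz1
              cases hz1
            exact hz (hz1.trans this.symm)
          refine ⟨z, ?_, ?_⟩
          · have hz3 : F^[r + 1] T z = true := by rwa [Function.iterate_succ_apply']
            exact Finset.mem_filter.2 ⟨Finset.mem_range.2 (hB _ _ hz3), hz3⟩
          · intro hz4
            rw [Finset.mem_filter] at hz4
            exact hz (hz1.trans hz4.2.symm)
        · intro z hz
          rw [Finset.mem_filter] at hz ⊢
          refine ⟨hz.1, ?_⟩
          rw [Function.iterate_succ_apply']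
          exact hF _ _ hz.2
      have := Finset.card_lt_card hlt
      have := ih (by omega)
      omega
  have h3 := h2 (B + 1) le_rfl
  have h4 := Finset.card_filter_le (Finset.range B) fun z => F^[B + 1] T z = true
  rw [Finset.card_range] at h4
  omega

/-- The counters `e` describe the length of the input, the range of the loops, and a tuple in this
range. -/
def InBox (A ℓ n : ℕ) (e : ℕ → ℕ) : Prop :=
  (∀ j < A, e j < n) ∧ ∀ j ≥ A, e j = envAt A ℓ n j

section fixpoint

variable {α : Type} {A ℓ n : ℕ} {Φ : List α → (ℕ → Bool) → (ℕ → ℕ) → Prop} {idx : (ℕ → ℕ) → ℕ}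
  {w : List α}

theorem InBox.update {e : ℕ → ℕ} (he : InBox A ℓ n e) {m i : ℕ} (hm : m < A) (hi : i < n) :
    InBox A ℓ n (Function.update e m i) := by
  constructor
  · intro j hj
    have := he.1 j hj
    simp only [Function.update_apply]
    split_ifs <;> omega
  · intro j hj
    rw [Function.update_of_ne (by omega)]
    exact he.2 j hj

theorem InBox.range {e : ℕ → ℕ} (he : InBox A ℓ n e) : e (A + 1) = n := by
  rw [he.2 _ (by omega)]
  simp [envAt]

/-- The table is updated in place, so the rule meets intermediate tables; for this reason `hG`
concerns every table with good entries. -/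
theorem passTab_sound (G : ℕ → Prop)
    (hG : ∀ T : ℕ → Bool, (∀ z, T z = true → G z) → ∀ y, InBox A ℓ n y → Φ w T y → G (idx y))
    (m : ℕ) (hm : m ≤ A) (e : ℕ → ℕ) (he : InBox A ℓ n e) (T : ℕ → Bool)
    (hT : ∀ z, T z = true → G z) : ∀ z, passTab Φ idx A w m e T z = true → G z := by
  induction m generalizing e T with
  | zero =>
    intro z
    simp only [passTab]
    split_ifs with h
    · simp only [Function.update_apply]
      split_ifs with hz
      · rintro -
        rw [hz]
        exact hG T hT e he h
      · exact hT z
    · exact hT z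
  | succ m ih =>
    simp only [passTab, he.range]
    have key : ∀ i ≤ n, ∀ z, (Nat.rec T (fun i Ti => passTab Φ idx A w m (Function.update e m i) Ti)
        i : ℕ → Bool) z = true → G z := by
      intro i
      induction i with
      | zero => exact fun _ => hT
      | succ i ih' =>
        intro hi
        exact ih (by omega) _ (he.update (by omega) (by omega)) _ (ih' (by omega))
    exact key n le_rfl

theorem le_passTab (m : ℕ) (e : ℕ → ℕ) (T : ℕ → Bool) (z : ℕ) (hz : T z = true) :
    passTab Φ idx A w m e T z = true := by
  induction m generalizing e T with
  | zero =>
    simp only [passTab]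
    split_ifs
    · simp [Function.update_apply, hz]
    · exact hz
  | succ m ih =>
    simp only [passTab]
    induction e (A + 1) with
    | zero => exact hz
    | succ i ih' => exact ih _ _ ih'

/-- When the pass comes to the tuple `y`, the table may already have grown; monotonicity keeps the
rule applicable, and later updates keep the entry. -/
theorem passTab_complete
    (hmono : ∀ (T T' : ℕ → Bool) e, (∀ z, T z = true → T' z = true) → Φ w T e → Φ w T' e)
    (m : ℕ) (hm : m ≤ A) (e : ℕ → ℕ) (he : InBox A ℓ n e) (T : ℕ → Bool) (y : ℕ → ℕ)
    (hy : InBox A ℓ n y) (hye : ∀ j ≥ m, y j = e j) (h : Φ w T y) :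
    passTab Φ idx A w m e T (idx y) = true := by
  induction m generalizing e T with
  | zero =>
    have : y = e := funext fun j => hye j (Nat.zero_le j)
    subst this
    simp [passTab, h]
  | succ m ih =>
    simp only [passTab, he.range]
    have hle : ∀ i z, T z = true → (Nat.rec T (fun i Ti => passTab Φ idx A w m
        (Function.update e m i) Ti) i : ℕ → Bool) z = true := by
      intro i z hz
      induction i with
      | zero => exact hz
      | succ i ih' => exact le_passTab _ _ _ _ ih'
    have key : ∀ i ≤ n, y m < i → (Nat.rec T (fun i Ti => passTab Φ idx A w m
        (Function.update e m i) Ti) i : ℕ → Bool) (idx y) = true := by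
      intro i
      induction i with
      | zero => intro _ h; omega
      | succ i ih' =>
        intro hi hyi
        by_cases hym : y m < i
        · exact le_passTab _ _ _ _ (ih' (by omega) hym)
        · refine ih (by omega) _ (he.update (by omega) (by omega)) _ ?_ (hmono T _ y (hle i) h)
          intro j hj
          simp only [Function.update_apply]
          split_ifs with hjm
          · subst hjm
            omega
          · exact hye j (by omega)
    exact key n le_rfl (hy.1 m (by omega))

/-- Whatever is put into the table is good, if the rule only produces good entries. -/
theorem iterate_passTab_sound (G : ℕ → Prop)
    (hG : ∀ T : ℕ → Bool, (∀ z, T z = true → G z) → ∀ y, InBox A ℓ n y → Φ w T y → G (idx y))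
    (hn : 0 < n) (r z : ℕ)
    (hz : (passTab Φ idx A w A (envAt A ℓ n))^[r] (fun _ => false) z = true) : G z := by
  induction r generalizing z with
  | zero => cases hz
  | succ r ih =>
    rw [Function.iterate_succ_apply'] at hz
    refine passTab_sound G hG A le_rfl _ ⟨fun j hj => ?_, fun j _ => rfl⟩ _ ih z hz
    simp only [envAt, Function.update_apply]
    split_ifs <;> omega

/-- After `n ^ A` rounds, the table is closed under the rule. -/
theorem iterate_passTab_complete (hn : 0 < n)
    (hmono : ∀ (T T' : ℕ → Bool) e, (∀ z, T z = true → T' z = true) → Φ w T e → Φ w T' e)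
    (hidx : ∀ y, InBox A ℓ n y → idx y < n ^ A) (y : ℕ → ℕ) (hy : InBox A ℓ n y)
    (h : Φ w ((passTab Φ idx A w A (envAt A ℓ n))^[n ^ A] fun _ => false) y) :
    (passTab Φ idx A w A (envAt A ℓ n))^[n ^ A] (fun _ => false) (idx y) = true := by
  -- The bound on the true entries is itself an instance of soundness, for the property `z < n ^ A`.
  have h1 := iterate_fixed_of_bounded (passTab Φ idx A w A (envAt A ℓ n)) (fun _ => false) (n ^ A)
    (fun T z => le_passTab _ _ _ _) (fun r z => iterate_passTab_sound (Φ := Φ) (idx := idx)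
      (fun z => z < n ^ A) (fun _ _ y hy _ => hidx y hy) hn r z)
  rw [← h1]
  refine passTab_complete hmono A le_rfl _ ⟨fun j hj => ?_, fun j _ => rfl⟩ _ y hy hy.2 h
  simp only [envAt, Function.update_apply]
  split_ifs <;> omega

end fixpoint

end StackProg

/-! ### Runs and walks -/

namespace LabelledWalk

variable {S A : Type}

/-- The list `l` of labelled edges is a walk; `none` stands for the final point. -/
def IsWalk : Option S → List (S × Option A × Option S) → Option S → Prop
  | x, [], y => x = y
  | x, r :: l, y => x = some r.1 ∧ IsWalk r.2.2 l y

theorem isWalk_append {x y : Option S} {l m : List (S × Option A × Option S)} :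
    IsWalk x (l ++ m) y ↔ ∃ z, IsWalk x l z ∧ IsWalk z m y := by
  induction l generalizing x with
  | nil => simp [IsWalk]
  | cons r l ih => simp [IsWalk, ih, and_assoc]

/-- Every source on a walk splits the walk. -/
theorem IsWalk.split {x y : Option S} {l : List (S × Option A × Option S)} (h : IsWalk x l y)
    {s : S} (hs : s ∈ l.map Prod.fst) :
    ∃ l₁ l₂, l = l₁ ++ l₂ ∧ IsWalk x l₁ (some s) ∧ IsWalk (some s) l₂ y ∧
      s ∈ l₂.map Prod.fst := by
  obtain ⟨r, hr, rfl⟩ := List.mem_map.1 hs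
  obtain ⟨l₁, l₂, rfl⟩ := List.append_of_mem hr
  obtain ⟨z, h1, h2⟩ := isWalk_append.1 h
  obtain rfl : z = some r.1 := h2.1
  exact ⟨_, _, rfl, h1, h2, by simp⟩

/-- The closed walk is run at an occurrence of its base point. -/
theorem IsWalk.insert {x y : Option S} {l c : List (S × Option A × Option S)} (h : IsWalk x l y)
    {s : S} (hs : s ∈ l.map Prod.fst) (hc : IsWalk (some s) c (some s)) :
    ∃ l', IsWalk x l' y ∧ l'.Perm (l ++ c) := by
  obtain ⟨l₁, l₂, rfl, h1, h2, -⟩ := h.split hs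
  refine ⟨l₁ ++ (c ++ l₂), isWalk_append.2 ⟨_, h1, isWalk_append.2 ⟨_, hc, h2⟩⟩, ?_⟩
  rw [List.append_assoc]
  exact List.perm_append_comm.append_left _

/-- A successor on a walk to the final point is a source of the walk. -/
theorem IsWalk.target_mem {x : Option S} {l : List (S × Option A × Option S)}
    (h : IsWalk x l none) {r : S × Option A × Option S} (hr : r ∈ l) {t : S}
    (ht : r.2.2 = some t) : t ∈ l.map Prod.fst := by
  obtain ⟨l₁, l₂, rfl⟩ := List.append_of_mem hr
  obtain ⟨z, h1, h2⟩ := isWalk_append.1 h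
  have h3 := h2.2
  rw [ht] at h3
  cases l₂ with
  | nil => cases h3
  | cons r' l₂ =>
    obtain ⟨h4, -⟩ := h3
    cases h4
    simp

theorem IsWalk.start_mem {s : S} {l : List (S × Option A × Option S)}
    (h : IsWalk (some s) l none) : s ∈ l.map Prod.fst := by
  cases l with
  | nil => cases h
  | cons r l =>
    obtain ⟨h, -⟩ := h
    cases h
    simp

section euler

variable [DecidableEq S]

/-- The multiset `R` of edges could be the multiset of edges of a walk from `x` to `y`. -/
def Balanced (R : Multiset (S × Option A × Option S)) (x y : Option S) : Prop :=
  ∀ s : S, Multiset.count (some s) (y ::ₘ R.map fun r => some r.1) =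
    Multiset.count (some s) (x ::ₘ R.map fun r => r.2.2)

theorem IsWalk.balanced {x y : Option S} {l : List (S × Option A × Option S)} (h : IsWalk x l y) :
    Balanced (l : Multiset (S × Option A × Option S)) x y := by
  induction l generalizing x with
  | nil =>
    obtain rfl : x = y := h
    exact fun s => rfl
  | cons r l ih =>
    obtain ⟨rfl, h⟩ := h
    intro s
    have := ih h s
    rw [← Multiset.cons_coe, Multiset.map_cons, Multiset.map_cons]
    rw [Multiset.cons_swap, Multiset.count_cons, this, ← Multiset.count_cons]

theorem balanced_cons {R : Multiset (S × Option A × Option S)} {r : S × Option A × Option S}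
    {y : Option S} : Balanced (r ::ₘ R) (some r.1) y ↔ Balanced R r.2.2 y := by
  refine forall_congr' fun s => ?_
  rw [Multiset.map_cons, Multiset.map_cons, Multiset.cons_swap,
    Multiset.count_cons _ (some r.1), Multiset.count_cons _ (some r.1)]
  omega

/-- A balanced multiset contains the edges of a walk. -/
theorem Balanced.exists_walk {R : Multiset (S × Option A × Option S)} {x y : Option S}
    (h : Balanced R x y) : ∃ l : List (S × Option A × Option S), IsWalk x l y ∧
      (l : Multiset (S × Option A × Option S)) ≤ R := by
  induction hn : R.card generalizing R x with
  | zero =>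
    rw [Multiset.card_eq_zero] at hn
    subst hn
    refine ⟨[], ?_, le_rfl⟩
    change x = y
    ext s
    have := h s
    simp only [Multiset.map_zero, Multiset.count_cons, Multiset.count_zero] at this
    split_ifs at this with h1 h2 h2
    · simp [← h1, ← h2]
    · omega
    · omega
    · simp [Ne.symm h1, Ne.symm h2]
  | succ n ih =>
    by_cases hxy : x = y
    · exact ⟨[], hxy, Multiset.zero_le _⟩
    cases x with
    | none =>
      exfalso
      obtain ⟨t, rfl⟩ : ∃ t, y = some t := Option.ne_none_iff_exists'.1 (Ne.symm hxy)
      -- A walk cannot leave the final point. Balance on genuine states and equal cardinalities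
      -- force the two multisets to agree, but only the right one contains `none`.
      have h1 : (some t ::ₘ R.map fun r => some r.1) ≤ (none ::ₘ R.map fun r => r.2.2) := by
        rw [Multiset.le_iff_count]
        intro s
        cases s with
        | some s => exact (h s).le
        | none => simp
      have h2 := Multiset.eq_of_le_of_card_le h1 (by simp)
      have h3 : (none : Option S) ∈ (none ::ₘ R.map fun r => r.2.2) := Multiset.mem_cons_self _ _
      rw [← h2] at h3
      simp at h3
    | some s =>
      have h1 := h s
      -- As `s` is not the end `y`, balance at `s` provides an edge with source `s`, which becomes
      -- the first edge of the walk.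
      rw [Multiset.count_cons_of_ne hxy, Multiset.count_cons_self] at h1
      have h2 : some s ∈ R.map fun r => some r.1 := Multiset.count_pos.1 (by omega)
      obtain ⟨r, hr, h3⟩ := Multiset.mem_map.1 h2
      cases h3
      obtain ⟨R', rfl⟩ := Multiset.exists_cons_of_mem hr
      obtain ⟨l, hl, hle⟩ := ih (balanced_cons.1 h) (by simpa using hn)
      exact ⟨r :: l, ⟨rfl, hl⟩, by rw [← Multiset.cons_coe]; exact Multiset.cons_le_cons _ hle⟩

/-- A connected balanced multiset consists of the edges of a walk. -/
theorem Balanced.exists_walk_eq {R : Multiset (S × Option A × Option S)} {s₀ : S}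
    (h : Balanced R (some s₀) none)
    (hconn : ∀ r ∈ R, Relation.ReflTransGen (fun s t => ∃ r ∈ R, r.1 = s ∧ r.2.2 = some t) s₀ r.1) :
    ∃ l : List (S × Option A × Option S), IsWalk (some s₀) l none ∧
      (l : Multiset (S × Option A × Option S)) = R := by
  classical
  obtain ⟨l₀, h₀, hle₀⟩ := h.exists_walk
  -- A longest walk inside `R` uses all of `R`. The rest `Q` would have equal in- and out-counts at
  -- each state; if it were nonempty, it would contain a closed walk meeting the longest one, and
  -- splicing would lengthen it.
  let P : ℕ → Prop := fun k => ∃ l : List (S × Option A × Option S), IsWalk (some s₀) l none ∧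
      (l : Multiset (S × Option A × Option S)) ≤ R ∧ l.length = k
  have hP : P (Nat.findGreatest P R.card) :=
    Nat.findGreatest_spec (by simpa using Multiset.card_le_card hle₀) ⟨l₀, h₀, hle₀, rfl⟩
  obtain ⟨l, hl, hle, hlen⟩ := hP
  refine ⟨l, hl, ?_⟩
  obtain ⟨Q, rfl⟩ := Multiset.le_iff_exists_add.1 hle
  by_contra hne
  have hQ : Q ≠ 0 := fun h => hne (by rw [h, add_zero])
  have hbal : ∀ s, Multiset.count (some s) (Q.map fun r => some r.1) =
      Multiset.count (some s) (Q.map fun r => r.2.2) := by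
    intro s
    have h1 := h s
    have h2 := hl.balanced s
    simp only [Multiset.map_add, Multiset.count_cons, Multiset.count_add] at h1 h2
    omega
  -- Otherwise no remaining edge starts on the walk, so every edge leaving a source of the walk
  -- belongs to the walk. The sources of the walk are then closed under edges of `R`, and
  -- connectedness puts the source of any remaining edge among them.
  obtain ⟨r, hr, hrl⟩ : ∃ r ∈ Q, r.1 ∈ l.map Prod.fst := by
    by_contra hno
    push Not at hno
    obtain ⟨r, hr⟩ := Multiset.exists_mem_of_ne_zero hQ
    refine hno r hr ?_
    have := hconn r (Multiset.mem_add.2 (Or.inr hr))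
    generalize r.1 = t at this
    induction this with
    | refl => exact hl.start_mem
    | tail _ h2 ih =>
      obtain ⟨r', hr', rfl, ht⟩ := h2
      rcases Multiset.mem_add.1 hr' with h3 | h3
      · exact hl.target_mem (Multiset.mem_coe.1 h3) ht
      · exact absurd ih (hno _ h3)
  obtain ⟨Q', rfl⟩ := Multiset.exists_cons_of_mem hr
  have hb : Balanced (r ::ₘ Q') (some r.1) (some r.1) := fun s => by
    rw [Multiset.count_cons, hbal, ← Multiset.count_cons]
  obtain ⟨c, hc, hcle⟩ := (balanced_cons.1 hb).exists_walk
  obtain ⟨l', hl', hperm⟩ := hl.insert (c := r :: c) hrl ⟨rfl, hc⟩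
  have h1 : (l' : Multiset _) ≤ (l : Multiset _) + r ::ₘ Q' := by
    rw [Multiset.coe_eq_coe.2 hperm, ← Multiset.coe_add, ← Multiset.cons_coe]
    exact add_le_add_right (Multiset.cons_le_cons _ hcle) _
  have h2 := Multiset.card_le_card h1
  have h3 := Nat.le_findGreatest (P := P) h2 ⟨l', hl', h1, rfl⟩
  have h4 := hperm.length_eq
  rw [Multiset.coe_card, ← hlen, h4] at h3
  simp at h3

end euler

section vec

variable [DecidableEq A]

/-- The number of edges with a given label. -/
def vec (l : List (S × Option A × Option S)) (a : A) : ℕ :=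
  l.countP fun r => r.2.1 = some a

theorem vec_append (l m : List (S × Option A × Option S)) : vec (l ++ m) = vec l + vec m :=
  funext fun _ => List.countP_append

theorem vec_perm {l m : List (S × Option A × Option S)} (h : l.Perm m) : vec l = vec m :=
  funext fun _ => h.countP_eq _

theorem vec_le_length (l : List (S × Option A × Option S)) (a : A) : vec l a ≤ l.length :=
  List.countP_le_length

theorem vec_eq_count (l : List (S × Option A × Option S)) (a : A) :
    vec l a = Multiset.count (some a) (Multiset.map (fun r => r.2.1) (Multiset.ofList l)) := by
  rw [Multiset.count_map, ← Multiset.countP_eq_card_filter, Multiset.coe_countP, vec]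
  simp only [eq_comm]

end vec

end LabelledWalk

namespace RegGrammarDesc

open LabelledWalk

variable {d : ℕ} (g : RegGrammarDesc d)

/-- The multisets generated by a grammar are the Parikh images of walks. -/
theorem mem_out_iff (K : Fin d → ℕ) :
    K ∈ g.toGrammar.out ↔
      ∃ l, IsWalk (some g.start) l none ∧ (∀ r ∈ l, r ∈ g.rules) ∧ vec l = K := by
  classical
  let tr : Fin g.numStates × Option (Fin d) × Option (Fin g.numStates) →
      Transition (Fin d) (Fin g.numStates) := fun r => ⟨r.1, optMultiset r.2.1, optMultiset r.2.2⟩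
  constructor
  · rintro ⟨D, ⟨hconn, hbal⟩, rfl⟩
    -- Rules form a list, possibly with repetitions, but transitions a finite set. One rule `f τ` is
    -- chosen for each transition, and `D` becomes a multiset of rules.
    have hf : ∀ τ : g.toGrammar.trans, ∃ r ∈ g.rules, tr r = τ.1 := fun τ =>
      List.mem_map.1 (List.mem_toFinset.1 τ.2)
    choose f hf hfτ using hf
    have hmap : ∀ {β : Type} [DecidableEq β] (F : _ → β) (b : β),
        Multiset.count b ((∑ τ, D τ • ({f τ} : Multiset _)).map F) =
          ∑ τ, if F (f τ) = b then D τ else 0 := by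
      intro β _ F b
      rw [← Multiset.coe_mapAddMonoidHom, map_sum, Multiset.count_sum']
      refine Finset.sum_congr rfl fun τ _ => ?_
      rw [map_nsmul, Multiset.count_nsmul, Multiset.coe_mapAddMonoidHom, Multiset.map_singleton,
        Multiset.count_singleton]
      split_ifs with h1 h2 h2 <;> simp_all
    have hmem : ∀ r, r ∈ (∑ τ, D τ • ({f τ} : Multiset _)) ↔ ∃ τ, 0 < D τ ∧ f τ = r := by
      intro r
      rw [Multiset.mem_sum]
      simp only [Finset.mem_univ, true_and, Multiset.mem_nsmul, Multiset.mem_singleton]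
      exact exists_congr fun τ => by rw [Nat.pos_iff_ne_zero, eq_comm (a := r)]
    obtain ⟨l, hl, hlR⟩ := Balanced.exists_walk_eq (s₀ := g.start)
      (R := ∑ τ, D τ • ({f τ} : Multiset _)) (by
        intro s
        have := hbal s
        rw [Multiset.count_cons_of_ne (by simp), Multiset.count_cons, hmap, hmap]
        have h1 : (∑ τ, if some (f τ).1 = some s then D τ else 0) =
            g.toGrammar.sourceCount D s :=
          Finset.sum_congr rfl fun τ _ => by simp [← hfτ τ, tr]
        have h2 : (∑ τ, if (f τ).2.2 = some s then D τ else 0) =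
            g.toGrammar.targetCount D s :=
          Finset.sum_congr rfl fun τ _ => by simp [← hfτ τ, tr, optMultiset]
        rw [h1, h2, this]
        have h3 : g.toGrammar.start = g.start := rfl
        simp only [h3, Option.some.injEq]) (by
        intro r hr
        obtain ⟨τ, hτ, rfl⟩ := (hmem r).1 hr
        have h1 := hconn τ.1.source (by
          refine Finset.sum_pos' (fun _ _ => Nat.zero_le _) ⟨τ, Finset.mem_univ _, ?_⟩
          simpa using hτ)
        have h2 : τ.1.source = (f τ).1 := by rw [← hfτ τ]
        rw [h2] at h1
        refine Relation.ReflTransGen.mono ?_ _ _ h1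
        rintro s t ⟨σ, hσ, rfl, h3⟩
        refine ⟨f σ, (hmem _).2 ⟨σ, hσ, rfl⟩, by rw [← hfτ σ], ?_⟩
        rw [← hfτ σ] at h3
        simp only [tr, optMultiset] at h3
        by_contra h4
        simp [h4] at h3)
    refine ⟨l, hl, ?_, ?_⟩
    · intro r hr
      rw [← Multiset.mem_coe, hlR] at hr
      obtain ⟨τ, -, rfl⟩ := (hmem r).1 hr
      exact hf τ
    · funext a
      rw [vec_eq_count, hlR, hmap]
      refine Finset.sum_congr rfl fun τ _ => ?_
      simp [← hfτ τ, tr, optMultiset]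
  · rintro ⟨l, hl, hlE, rfl⟩
    have htr : ∀ r ∈ l, tr r ∈ g.toGrammar.trans := fun r hr =>
      List.mem_toFinset.2 (List.mem_map.2 ⟨r, hlE r hr, rfl⟩)
    -- Conversely, `D` counts the occurrences of each transition on the walk, and sums over
    -- transitions weighted by `D` turn into sums along the walk.
    have hsum : ∀ (F : Transition (Fin d) (Fin g.numStates) → ℕ) (m : List _),
        (∀ r ∈ m, tr r ∈ g.toGrammar.trans) →
        ∑ τ : g.toGrammar.trans, (m.map tr).count τ.1 * F τ.1 = (m.map fun r => F (tr r)).sum := by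
      intro F m hm
      induction m with
      | nil => simp
      | cons r m ih =>
        simp only [List.map_cons, List.count_cons, List.sum_cons, add_mul, Finset.sum_add_distrib]
        rw [ih fun r hr => hm r (List.mem_cons_of_mem _ hr), add_comm]
        congr 1
        rw [Finset.sum_eq_single ⟨tr r, hm r List.mem_cons_self⟩]
        · simp
        · intro τ _ hτ
          have : tr r ≠ τ.1 := fun h => hτ (Subtype.ext h.symm)
          simp [this]
        · simp
    have hcount : ∀ {γ β : Type} [DecidableEq β] (F : γ → β) (b : β) (m : List γ),
        (m.map fun r => if F r = b then 1 else 0).sum =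
          Multiset.count b (Multiset.map F (Multiset.ofList m)) := by
      intro γ β _ F b m
      induction m with
      | nil => rfl
      | cons r m ih =>
        rw [List.map_cons, List.sum_cons, ih, ← Multiset.cons_coe, Multiset.map_cons,
          Multiset.count_cons, add_comm]
        simp only [eq_comm]
    have hsrc : ∀ s, g.toGrammar.sourceCount (fun τ => (l.map tr).count τ.1) s =
        Multiset.count (some s) (Multiset.map (fun r => some r.1) (Multiset.ofList l)) := by
      intro s
      have := hsum (fun τ => if τ.source = s then 1 else 0) l htr
      simp only [mul_ite, mul_one, mul_zero] at this
      rw [← hcount]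
      refine Eq.trans ?_ (this.trans ?_)
      · simp only [CommGrammar.sourceCount]
      · simp [tr]
    refine ⟨fun τ => (l.map tr).count τ.1, ⟨?_, ?_⟩, ?_⟩
    -- The prefix of the walk that ends at a state is a path to it in `D`.
    · have key : ∀ l₁ l₂, l₁ ++ l₂ = l → ∀ s, IsWalk (some g.start) l₁ (some s) →
          Relation.ReflTransGen (g.toGrammar.Edge fun τ => (l.map tr).count τ.1) g.start s := by
        intro l₁
        induction l₁ using List.reverseRecOn with
        | nil =>
          rintro l₂ - s hs
          cases hs
          exact .refl
        | append_singleton l₁ r ih =>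
          intro l₂ hl₁ s hs
          obtain ⟨z, h1, rfl, h2⟩ := isWalk_append.1 hs
          have hr : r ∈ l := by rw [← hl₁]; simp
          refine (ih (r :: l₂) (by simpa using hl₁) _ h1).tail ⟨⟨tr r, htr r hr⟩, ?_, rfl, ?_⟩
          · exact List.count_pos_iff.2 (List.mem_map_of_mem hr)
          · have h3 : r.2.2 = some s := h2
            simp [tr, optMultiset, h3]
      intro s hs
      have h1 := hsrc s ▸ hs.out
      obtain ⟨r, hr, h2⟩ := Multiset.mem_map.1 (Multiset.count_pos.1 h1)
      cases h2
      obtain ⟨l₁, l₂, h3, h4, -⟩ := hl.split (List.mem_map_of_mem hr)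
      exact key _ _ h3.symm _ h4
    · intro s
      have h1 := hl.balanced s
      rw [Multiset.count_cons_of_ne (by simp), Multiset.count_cons, ← hsrc, ← hcount] at h1
      rw [h1, CommGrammar.targetCount, hsum (fun τ => τ.target s) l htr]
      simp [tr, optMultiset, toGrammar]
      refine congrArg₂ (· + ·) (congrArg (fun F : _ → ℕ => (List.map F l).sum) (funext fun r => ?_)) ?_
      all_goals congr
    · funext a
      rw [CommGrammar.outCount, hsum (fun τ => τ.out a) l htr]
      rw [vec_eq_count, ← hcount]
      simp [tr, optMultiset]
      refine congrArg (fun F : _ → ℕ => (List.map F l).sum) (funext fun r => ?_)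
      congr

end RegGrammarDesc

/-! ### Decomposition of walks -/

namespace LabelledWalk

variable {S A : Type}

/-- Insertion never loses a source, so the base points of the remaining closed walks stay available.
-/
theorem IsWalk.insert_flatten {x y : Option S} {l : List (S × Option A × Option S)}
    (h : IsWalk x l y) (C : List (List (S × Option A × Option S)))
    (hC : ∀ c ∈ C, ∃ s ∈ l.map Prod.fst, IsWalk (some s) c (some s)) :
    ∃ l', IsWalk x l' y ∧ l'.Perm (l ++ C.flatten) := by
  induction C with
  | nil => exact ⟨l, h, by simp⟩
  | cons c C ih =>
    obtain ⟨l₁, h1, hp⟩ := ih fun c hc => hC c (List.mem_cons_of_mem _ hc)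
    obtain ⟨s, hs, hc⟩ := hC c List.mem_cons_self
    obtain ⟨l₂, h2, hp2⟩ := h1.insert (s := s)
      ((hp.map _).mem_iff.2 (by rw [List.map_append]; exact List.mem_append_left _ hs)) hc
    refine ⟨l₂, h2, hp2.trans ?_⟩
    rw [List.flatten_cons, ← List.append_assoc]
    refine (hp.append_right c).trans ?_
    rw [List.append_assoc, List.append_assoc]
    exact List.perm_append_comm.append_left l

/-- A walk splits into a short walk with the same sources and short closed walks at its sources. -/
theorem IsWalk.exists_base [Fintype S] {x y : Option S} {l : List (S × Option A × Option S)}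
    (h : IsWalk x l y) :
    ∃ (b : List (S × Option A × Option S)) (C : List (List (S × Option A × Option S))),
      IsWalk x b y ∧ (∀ s, s ∈ b.map Prod.fst ↔ s ∈ l.map Prod.fst) ∧
      b.length ≤ (Fintype.card S + 1) ^ 2 ∧
      (∀ c ∈ C, c.length ≤ Fintype.card S ∧
        ∃ s ∈ b.map Prod.fst, IsWalk (some s) c (some s)) ∧
      l.Perm (b ++ C.flatten) := by
  classical
  set n := Fintype.card S
  -- The walk is read edge by edge. `p` is the part to be kept and `t` a tail without repeated
  -- sources, all of which occur in `p`. An edge with a new source moves `t` and itself into `p`, at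
  -- a cost of at most n + 1 edges per source. If the source occurs in `t`, the closed walk since
  -- that occurrence is cut off into `C`. Otherwise the edge is appended to `t`.
  have key : ∃ (p t : List (S × Option A × Option S)) (C : List (List (S × Option A × Option S)))
      (z : Option S), IsWalk x p z ∧ IsWalk z t y ∧ (t.map Prod.fst).Nodup ∧
      (∀ s ∈ t.map Prod.fst, s ∈ p.map Prod.fst) ∧
      p.length ≤ (n + 1) * (p.map Prod.fst).toFinset.card ∧
      (∀ s, s ∈ p.map Prod.fst ↔ s ∈ l.map Prod.fst) ∧
      (∀ c ∈ C, c.length ≤ n ∧ ∃ s ∈ p.map Prod.fst, IsWalk (some s) c (some s)) ∧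
      l.Perm (p ++ t ++ C.flatten) := by
    induction l using List.reverseRecOn generalizing y with
    | nil =>
      obtain rfl : x = y := h
      exact ⟨[], [], [], x, rfl, rfl, by simp, by simp, by simp, by simp, by simp, by simp⟩
    | append_singleton l r ih =>
      obtain ⟨y', h1, rfl, h2⟩ := isWalk_append.1 h
      have h2' : r.2.2 = y := h2
      obtain ⟨p, t, C, z, hp, ht, hnd, hsub, hlen, hsrc, hC, hperm⟩ := ih h1
      have htlen : t.length ≤ n := by
        have := hnd.length_le_card
        rwa [List.length_map] at this
      have hnew : IsWalk (some r.1) [r] y := ⟨rfl, h2⟩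
      have hmove : (p ++ t ++ C.flatten ++ [r]).Perm (p ++ (t ++ [r]) ++ C.flatten) := by
        rw [List.append_assoc (p ++ t), ← List.append_assoc p, List.append_assoc (p ++ t)]
        exact List.perm_append_comm.append_left _
      by_cases hr : r.1 ∈ p.map Prod.fst
      · have hsrc' : ∀ s, s ∈ p.map Prod.fst ↔ s ∈ (l ++ [r]).map Prod.fst := by
          intro s
          rw [List.map_append, List.mem_append, ← hsrc]
          simp only [List.map_cons, List.map_nil, List.mem_singleton]
          exact ⟨Or.inl, fun h => h.elim id fun h => h ▸ hr⟩
        by_cases hrt : r.1 ∈ t.map Prod.fst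
        · obtain ⟨t₁, t₂, rfl, h3, h4, h5⟩ := ht.split hrt
          refine ⟨p, t₁ ++ [r], t₂ :: C, z, hp, isWalk_append.2 ⟨_, h3, hnew⟩, ?_, ?_, hlen, hsrc',
            ?_, ?_⟩
          · rw [List.map_append] at hnd
            rw [List.map_append, List.map_singleton]
            obtain ⟨h6, -, h7⟩ := List.nodup_append.1 hnd
            refine List.nodup_append.2 ⟨h6, List.nodup_singleton _, fun a ha b hb => ?_⟩
            rw [List.mem_singleton.1 hb]
            exact h7 a ha _ h5
          · intro s hs
            rw [List.map_append, List.mem_append] at hs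
            rcases hs with hs | hs
            · exact hsub s (by rw [List.map_append]; exact List.mem_append_left _ hs)
            · rw [List.map_singleton, List.mem_singleton] at hs
              rwa [hs]
          · intro c hc
            rcases List.mem_cons.1 hc with rfl | hc
            · exact ⟨by rw [List.length_append] at htlen; omega, r.1, hr, h4⟩
            · exact hC c hc
          · refine (hperm.append_right _).trans (hmove.trans ?_)
            rw [List.flatten_cons]
            simp only [List.append_assoc]
            refine List.Perm.append_left _ (List.Perm.append_left _ ?_)
            simp only [← List.append_assoc]
            exact List.perm_append_comm.append_right _
        · refine ⟨p, t ++ [r], C, z, hp, isWalk_append.2 ⟨_, ht, hnew⟩, ?_, ?_, hlen, hsrc', hC, ?_⟩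
          · rw [List.map_append, List.map_singleton]
            exact List.nodup_append.2 ⟨hnd, List.nodup_singleton _, by
              intro a ha b hb
              rw [List.mem_singleton.1 hb]
              exact fun h => hrt (h ▸ ha)⟩
          · intro s hs
            rw [List.map_append, List.mem_append] at hs
            rcases hs with hs | hs
            · exact hsub s hs
            · rw [List.map_singleton, List.mem_singleton] at hs
              rwa [hs]
          · exact (hperm.append_right _).trans hmove
      · have hfin : ((p ++ t ++ [r]).map Prod.fst).toFinset =
            Insert.insert r.1 (p.map Prod.fst).toFinset := by
          ext s
          have := hsub s
          simp only [List.map_append, List.mem_toFinset, List.mem_append, Finset.mem_insert,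
            List.map_singleton, List.mem_singleton]
          tauto
        refine ⟨p ++ t ++ [r], [], C, y, isWalk_append.2 ⟨_, isWalk_append.2 ⟨_, hp, ht⟩, hnew⟩,
          rfl, by simp, by simp, ?_, ?_, ?_, ?_⟩
        · rw [hfin, Finset.card_insert_of_notMem (by rwa [List.mem_toFinset]), Nat.mul_add_one]
          simp only [List.length_append, List.length_singleton]
          omega
        · intro s
          rw [← List.mem_toFinset, hfin, Finset.mem_insert, List.mem_toFinset, List.map_append,
            List.mem_append, ← hsrc, or_comm]
          simp
        · intro c hc
          obtain ⟨h5, s, hs, h6⟩ := hC c hc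
          refine ⟨h5, s, ?_, h6⟩
          rw [List.append_assoc, List.map_append]
          exact List.mem_append_left _ hs
        · rw [List.append_nil, List.append_assoc p]
          exact (hperm.append_right _).trans hmove
  obtain ⟨p, t, C, z, hp, ht, hnd, hsub, hlen, hsrc, hC, hperm⟩ := key
  have hmem : ∀ s, s ∈ (p ++ t).map Prod.fst ↔ s ∈ p.map Prod.fst := by
    intro s
    rw [List.map_append, List.mem_append]
    exact ⟨fun h => h.elim id (hsub s), Or.inl⟩
  refine ⟨p ++ t, C, isWalk_append.2 ⟨_, hp, ht⟩, fun s => (hmem s).trans (hsrc s), ?_,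
    fun c hc => ?_, hperm⟩
  · have h1 := hnd.length_le_card
    rw [List.length_map] at h1
    have h2 : (p.map Prod.fst).toFinset.card ≤ n := Finset.card_le_univ _
    rw [List.length_append]
    nlinarith
  · obtain ⟨h5, s, hs, h6⟩ := hC c hc
    exact ⟨h5, s, (hmem s).2 hs, h6⟩

/-- Many small vectors satisfy a small linear relation. -/
theorem exists_relation {ι : Type} {d e : ℕ} (v : ι → Fin d → ℕ) (hv : ∀ i a, v i a ≤ e)
    (H : Finset ι) (hH : H.card = d + 1) :
    ∃ f g : ι → ℕ, f ≠ g ∧ (∀ i ∉ H, f i = 0 ∧ g i = 0) ∧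
      (∀ i, f i ≤ ((d + 1) * e + 1) ^ d ∧ g i ≤ ((d + 1) * e + 1) ^ d) ∧
      ∑ i ∈ H, f i • v i = ∑ i ∈ H, g i • v i := by
  classical
  -- Pigeonhole: coefficients in 0..X give (X+1)^(d+1) combinations, whose sums have entries at most
  -- (d+1)eX. With this X the number of sums is at most (((d+1)e+1)(X+1))^d = X(X+1)^d, which is
  -- smaller.
  set X := ((d + 1) * e + 1) ^ d with hX
  let F : (H → Fin (X + 1)) → (Fin d → Fin ((d + 1) * e * X + 1)) := fun f a =>
    ⟨∑ i, (f i : ℕ) * v i a, by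
      rw [Nat.lt_succ_iff]
      calc ∑ i : H, (f i : ℕ) * v i a ≤ ∑ i : H, X * e :=
            Finset.sum_le_sum fun i _ => Nat.mul_le_mul (Nat.lt_succ_iff.1 (f i).2) (hv _ _)
        _ = (d + 1) * e * X := by simp [hH]; ring⟩
  have hcard : Fintype.card (Fin d → Fin ((d + 1) * e * X + 1)) <
      Fintype.card (H → Fin (X + 1)) := by
    simp only [Fintype.card_fun, Fintype.card_fin, Fintype.card_coe, hH]
    calc ((d + 1) * e * X + 1) ^ d ≤ (((d + 1) * e + 1) * (X + 1)) ^ d := by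
          refine Nat.pow_le_pow_left ?_ d
          nlinarith
      _ = X * (X + 1) ^ d := by rw [mul_pow]
      _ < (X + 1) ^ (d + 1) := by
          rw [pow_succ, mul_comm]
          exact Nat.mul_lt_mul_of_pos_left (Nat.lt_succ_self X) (by positivity)
  obtain ⟨f, g, hne, hfg⟩ := Fintype.exists_ne_map_eq_of_card_lt F hcard
  refine ⟨fun i => if h : i ∈ H then f ⟨i, h⟩ else 0, fun i => if h : i ∈ H then g ⟨i, h⟩ else 0,
    ?_, ?_, ?_, ?_⟩
  · intro h
    apply hne
    funext i
    have := congrFun h i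
    simpa [Fin.val_inj] using this
  · intro i hi
    simp [hi]
  · intro i
    constructor
    · dsimp only
      split_ifs
      · exact Nat.lt_succ_iff.1 (f _).2
      · exact Nat.zero_le _
    · dsimp only
      split_ifs
      · exact Nat.lt_succ_iff.1 (g _).2
      · exact Nat.zero_le _
  · funext a
    have := congrArg Fin.val (congrFun hfg a)
    simp only [F] at this
    rw [← Finset.sum_coe_sort H, ← Finset.sum_coe_sort H]
    simpa using this

/-- In a combination of small vectors, at most `d` of the coefficients need to be large. -/
theorem exists_few_large {ι : Type} [Fintype ι] {d e : ℕ} (v : ι → Fin d → ℕ)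
    (hv : ∀ i a, v i a ≤ e) (m₀ : ι → ℕ) :
    ∃ m : ι → ℕ, (∀ i, m₀ i = 0 → m i = 0) ∧ ∑ i, m i • v i = ∑ i, m₀ i • v i ∧
      (Finset.univ.filter fun i => ((d + 1) * e + 1) ^ d < m i).card ≤ d := by
  classical
  -- Take the lexicographically least coefficients with the given sum, under an arbitrary order of
  -- the index set. If d + 1 of them were large, a small relation between their vectors could be
  -- added in the direction that lowers the first coefficient in which its sides differ. Largeness
  -- keeps all coefficients nonnegative, contradicting minimality.
  let _ : LinearOrder ι := LinearOrder.lift' (Fintype.equivFin ι) (Fintype.equivFin ι).injective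
  have : WellFounded fun a b : ι → ℕ => toLex a < toLex b :=
    InvImage.wf toLex (wellFounded_lt (α := Lex (ι → ℕ)))
  obtain ⟨m, ⟨hm0, hm⟩, hmin⟩ := this.has_min
    {m | (∀ i, m₀ i = 0 → m i = 0) ∧ ∑ i, m i • v i = ∑ i, m₀ i • v i} ⟨m₀, fun _ => id, rfl⟩
  refine ⟨m, hm0, hm, ?_⟩
  by_contra hlt
  obtain ⟨H, hH, hcard⟩ := Finset.exists_subset_card_eq (Nat.succ_le_of_lt (not_le.1 hlt))
  have hheavy : ∀ i ∈ H, ((d + 1) * e + 1) ^ d < m i := fun i hi =>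
    (Finset.mem_filter.1 (hH hi)).2
  obtain ⟨f, g, hne, hz, hb, hfg⟩ := exists_relation v hv H hcard
  have main : ∀ f g : ι → ℕ, (∀ i ∉ H, f i = 0 ∧ g i = 0) →
      (∀ i, f i ≤ ((d + 1) * e + 1) ^ d ∧ g i ≤ ((d + 1) * e + 1) ^ d) →
      ∑ i ∈ H, f i • v i = ∑ i ∈ H, g i • v i →
      ∀ i, (∀ j < i, f j = g j) → f i < g i → False := by
    intro f g hz hb hfg i hi hlt
    have hle : ∀ j, g j ≤ m j := by
      intro j
      by_cases hj : j ∈ H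
      · exact (hb j).2.trans (hheavy j hj).le
      · rw [(hz j hj).2]
        exact Nat.zero_le _
    refine hmin (fun j => m j + f j - g j) ⟨?_, ?_⟩ ⟨i, ?_, ?_⟩
    · intro j hj
      have h1 := hm0 j hj
      have hjH : j ∉ H := fun hjH => by
        have := hheavy j hjH
        omega
      have h2 := hz j hjH
      change m j + f j - g j = 0
      omega
    · have h1 : ∑ j, (m j + f j - g j) • v j + ∑ j, g j • v j = ∑ j, m j • v j + ∑ j, f j • v j := by
        rw [← Finset.sum_add_distrib, ← Finset.sum_add_distrib]
        refine Finset.sum_congr rfl fun j _ => ?_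
        rw [← add_smul, ← add_smul]
        congr 1
        have := hle j
        omega
      have h2 : ∀ f : ι → ℕ, (∀ j ∉ H, f j = 0) → ∑ j, f j • v j = ∑ j ∈ H, f j • v j := by
        intro f hf
        refine (Finset.sum_subset (Finset.subset_univ H) fun j _ hj => ?_).symm
        rw [hf j hj, zero_smul]
      rw [h2 f fun j hj => (hz j hj).1, h2 g fun j hj => (hz j hj).2, hfg] at h1
      exact (add_right_cancel h1).trans hm
    · intro j hj
      have := hi j hj
      change m j + f j - g j = m j
      omega
    · have := hle i
      change m i + f i - g i < m i
      omega
  obtain ⟨i, hi, hmini⟩ := (wellFounded_lt (α := ι)).has_min {i | f i ≠ g i}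
    (Function.ne_iff.1 hne)
  have hprev : ∀ j < i, f j = g j := fun j hj => by
    by_contra h
    exact hmini j h hj
  rcases lt_or_gt_of_ne hi with h | h
  · exact main f g hz hb hfg i hprev h
  · exact main g f (fun i hi => (hz i hi).symm) (fun i => (hb i).symm) hfg.symm i
      (fun j hj => (hprev j hj).symm) h

theorem vec_flatten [DecidableEq A] (C : List (List (S × Option A × Option S))) :
    vec C.flatten = (C.map vec).sum := by
  induction C with
  | nil => rfl
  | cons c C ih => rw [List.flatten_cons, vec_append, ih, List.map_cons, List.sum_cons]

/-- A bound for the length of the short part of a walk on `n` points with `d` labels. -/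
def baseBound (d n : ℕ) : ℕ :=
  (n + 1) ^ 2 + (n + 1) ^ d * (((d + 1) * n + 1) ^ d * n)

/-- A walk to the final point has the same labels as a short walk together with multiples of `d`
short closed walks at sources of this short walk. -/
theorem IsWalk.exists_decomposition [Fintype S] {d : ℕ} {x : S}
    {l : List (S × Option (Fin d) × Option S)} (h : IsWalk (some x) l none) :
    ∃ (b : List (S × Option (Fin d) × Option S)) (s : Fin d → S)
      (c : Fin d → List (S × Option (Fin d) × Option S)) (M : Fin d → ℕ),
      IsWalk (some x) b none ∧ (∀ r ∈ b, r ∈ l) ∧ b.length ≤ baseBound d (Fintype.card S) ∧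
      (∀ j, s j ∈ b.map Prod.fst ∧ IsWalk (some (s j)) (c j) (some (s j)) ∧ (∀ r ∈ c j, r ∈ l) ∧
        (c j).length ≤ Fintype.card S) ∧
      vec l = vec b + ∑ j, M j • vec (c j) := by
  classical
  set n := Fintype.card S
  obtain ⟨b₀, C, hb₀, -, hlen, hC, hperm⟩ := h.exists_base
  -- Closed walks are classified by their letter counts. The minimum only makes the type finite: it
  -- is inactive on `C`, whose members have length at most `n`.
  let κ : List (S × Option (Fin d) × Option S) → (Fin d → Fin (n + 1)) := fun c a =>
    ⟨min (vec c a) n, by omega⟩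
  have hκ : ∀ c ∈ C, (fun a => (κ c a : ℕ)) = vec c := fun c hc => funext fun a =>
    min_eq_left ((vec_le_length c a).trans (hC c hc).1)
  let m₀ : (Fin d → Fin (n + 1)) → ℕ := fun i => (C.map κ).count i
  obtain ⟨m, hm0, hm, hcard⟩ := exists_few_large (e := n)
    (fun (i : Fin d → Fin (n + 1)) a => (i a : ℕ)) (fun i a => Nat.lt_succ_iff.1 (i a).2) m₀
  set B := ((d + 1) * n + 1) ^ d with hB
  -- One closed walk from `C` represents each class with nonzero coefficient. It exists because the
  -- new coefficients vanish wherever the old ones do.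
  have hL : ∀ i, ∃ c, m i ≠ 0 → c ∈ C ∧ κ c = i := by
    intro i
    by_cases hi : m i = 0
    · exact ⟨[], fun h => absurd hi h⟩
    · have h1 : 0 < (C.map κ).count i := Nat.pos_of_ne_zero fun h => hi (hm0 i h)
      obtain ⟨c, hc, h2⟩ := List.mem_map.1 (List.count_pos_iff.1 h1)
      exact ⟨c, fun _ => ⟨hc, h2⟩⟩
  choose L hL using hL
  have hLC : ∀ c ∈ C, ∀ r ∈ c, r ∈ l := fun c hc r hr =>
    hperm.mem_iff.2 (List.mem_append_right _ (List.mem_flatten.2 ⟨c, hc, hr⟩))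
  have hsum : vec C.flatten = ∑ i, m i • vec (L i) := by
    have h1 : ∀ D : List (List (S × Option (Fin d) × Option S)), (∀ c ∈ D, c ∈ C) →
        (D.map vec).sum = ∑ i, (D.map κ).count i • fun a => (i a : ℕ) := by
      intro D hD
      induction D with
      | nil => simp
      | cons c D ih =>
        rw [List.map_cons, List.sum_cons, ih fun c' hc' => hD c' (List.mem_cons_of_mem _ hc')]
        simp only [List.map_cons, List.count_cons, add_smul, Finset.sum_add_distrib]
        rw [add_comm]
        congr 1
        rw [Finset.sum_eq_single (κ c), ← hκ c (hD c List.mem_cons_self)]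
        · simp
        · intro i _ hi
          simp [Ne.symm hi]
        · simp
    rw [vec_flatten, h1 C fun _ => id, ← hm]
    refine Finset.sum_congr rfl fun i _ => ?_
    by_cases hi : m i = 0
    · rw [hi, zero_smul, zero_smul]
    · obtain ⟨h2, h3⟩ := hL i hi
      rw [← hκ _ h2, h3]
  -- The light classes: at most (n+1)^d of them, each with at most `B` copies of a closed walk of
  -- length at most `n`. They are spliced into the base walk, which accounts for `baseBound`.
  let D := (Finset.univ.filter fun i => ¬ B < m i).toList.flatMap fun i =>
    List.replicate (m i) (L i)
  have hD : ∀ c ∈ D, c ∈ C := by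
    intro c hc
    obtain ⟨i, -, hi⟩ := List.mem_flatMap.1 hc
    obtain ⟨h1, rfl⟩ := List.mem_replicate.1 hi
    exact (hL i h1).1
  obtain ⟨b, hb, hbperm⟩ := hb₀.insert_flatten D fun c hc => (hC c (hD c hc)).2
  have hsrc : ∀ s ∈ b₀.map Prod.fst, s ∈ b.map Prod.fst := fun s hs =>
    (hbperm.map _).mem_iff.2 (by rw [List.map_append]; exact List.mem_append_left _ hs)
  -- The heavy classes are numbered by `Fin d`. Unused numbers get the empty closed walk at `x` with
  -- multiplicity 0.
  obtain ⟨φ⟩ : Nonempty ({i // i ∈ Finset.univ.filter fun i => B < m i} ↪ Fin d) :=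
    Function.Embedding.nonempty_of_card_le (by rwa [Fintype.card_coe, Fintype.card_fin])
  let c : Fin d → List (S × Option (Fin d) × Option S) :=
    Function.extend φ (fun i => L i) fun _ => []
  have hheavy : ∀ i : {i // i ∈ Finset.univ.filter fun i => B < m i}, m i ≠ 0 := fun i => by
    have := (Finset.mem_filter.1 i.2).2
    omega
  have hc : ∀ j, ∃ s ∈ b.map Prod.fst, IsWalk (some s) (c j) (some s) ∧ (∀ r ∈ c j, r ∈ l) ∧
      (c j).length ≤ n := by
    intro j
    by_cases hj : ∃ i, φ i = j
    · obtain ⟨i, rfl⟩ := hj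
      obtain ⟨h1, -⟩ := hL i (hheavy i)
      obtain ⟨h2, s, hs, h3⟩ := hC _ h1
      simp only [c, φ.injective.extend_apply]
      exact ⟨s, hsrc s hs, h3, hLC _ h1, h2⟩
    · refine ⟨x, hb.start_mem, ?_⟩
      simp only [c, Function.extend_apply' _ _ _ hj]
      exact ⟨rfl, by simp, Nat.zero_le _⟩
  choose s hs hc using hc
  refine ⟨b, s, c, Function.extend φ (fun i => m i) fun _ => 0, hb, ?_, ?_,
    fun j => ⟨hs j, hc j⟩, ?_⟩
  · intro r hr
    rcases List.mem_append.1 (hbperm.mem_iff.1 hr) with h1 | h1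
    · exact hperm.mem_iff.2 (List.mem_append_left _ h1)
    · obtain ⟨c', h2, h3⟩ := List.mem_flatten.1 h1
      exact hLC _ (hD _ h2) _ h3
  · rw [hbperm.length_eq, List.length_append, baseBound]
    refine Nat.add_le_add hlen ?_
    have h1 : D.flatten.length = ∑ i ∈ Finset.univ.filter (fun i => ¬ B < m i),
        m i * (L i).length := by
      rw [← Finset.sum_map_toList]
      simp only [D]
      induction (Finset.univ.filter fun i => ¬ B < m i).toList with
      | nil => rfl
      | cons i E ih => simp [ih]
    rw [h1]
    calc ∑ i ∈ Finset.univ.filter (fun i => ¬ B < m i), m i * (L i).length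
        ≤ ∑ i ∈ Finset.univ.filter (fun i => ¬ B < m i), B * n := by
          refine Finset.sum_le_sum fun i hi => ?_
          by_cases h0 : m i = 0
          · rw [h0]
            simp
          · exact Nat.mul_le_mul (not_lt.1 (Finset.mem_filter.1 hi).2) (hC _ (hL i h0).1).1
      _ ≤ (n + 1) ^ d * (B * n) := by
          rw [Finset.sum_const, smul_eq_mul]
          refine Nat.mul_le_mul_right _ ((Finset.card_le_univ _).trans ?_)
          simp
  · have h1 : vec D.flatten = ∑ i ∈ Finset.univ.filter (fun i => ¬ B < m i), m i • vec (L i) := by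
      rw [vec_flatten, ← Finset.sum_map_toList]
      simp only [D]
      induction (Finset.univ.filter fun i => ¬ B < m i).toList with
      | nil => rfl
      | cons i E ih => simp [ih]
    have h2 : ∑ i ∈ Finset.univ.filter (fun i => B < m i), m i • vec (L i) =
        ∑ j, (Function.extend φ (fun i => m i) (fun _ => 0) : Fin d → ℕ) j • vec (c j) := by
      rw [← Finset.sum_coe_sort]
      refine Fintype.sum_of_injective φ φ.injective _ _ (fun j hj => ?_) fun i => ?_
      · rw [Function.extend_apply' _ _ _ (fun h => hj h), zero_smul]
      · simp only [c, φ.injective.extend_apply]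
    rw [vec_perm hperm, vec_append, hsum, vec_perm hbperm, vec_append, h1, add_assoc, ← h2,
      add_comm (∑ i ∈ Finset.univ.filter (fun i => ¬ B < m i), m i • vec (L i)),
      Finset.sum_filter_add_sum_filter_not]

end LabelledWalk

/-! ### Finding a walk bit by bit -/

namespace RegGrammarDesc

open LabelledWalk

/-- The configurations of the search for a walk: `d` points `s` on the walk, a closed walk that
starts at `o` and has arrived at `t`, the number `i` of bits that are dealt with, and a carry `w`. -/
@[ext]
structure Config (d : ℕ) where
  o : ℕ
  t : ℕ
  i : ℕ
  s : Fin d → ℕ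
  w : Fin d → ℕ

variable {d : ℕ}

/-- All entries are below `N`. -/
def Config.Lt (c : Config d) (N : ℕ) : Prop :=
  c.o < N ∧ c.t < N ∧ c.i < N ∧ (∀ j, c.s j < N) ∧ ∀ a, c.w a < N

/-- The configuration `y` is initial, or it is reached from a configuration in `C`. -/
def Step (E : ℕ → Option (Fin d) → ℕ → Prop) (St : ℕ → Prop) (bot : ℕ) (Bit : Fin d → ℕ → Prop)
    (C : Config d → Prop) (y : Config d) : Prop :=
  (y.o = bot ∧ St y.t ∧ y.i = 0 ∧ (∀ j, y.s j = y.t) ∧ ∀ a, y.w a = 0) ∨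
  (∃ j, y.o = bot ∧ y.t ≠ bot ∧ y.s j = y.t ∧
    ∃ v, C { y with s := Function.update y.s j v }) ∨
  (∃ a t, E t a y.t ∧ a.elim (C { y with t := t }) fun b =>
    ∃ v, y.w b = v + 1 ∧ C { y with t := t, w := Function.update y.w b v }) ∨
  (∃ j, y.o = y.t ∧ y.o = y.s j ∧ ∃ z, C { y with o := z, t := z }) ∨
  (y.o = y.t ∧ ∃ i, y.i = i + 1 ∧ ∃ β : Fin d → Bool, (∀ a, Bit a i ↔ β a = true) ∧
    C { y with i := i, w := fun a => 2 * y.w a + (β a).toNat })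

variable (g : RegGrammarDesc d)

/-- The number of a point of a walk. -/
def num (bot : ℕ) (x : Option (Fin g.numStates)) : ℕ :=
  x.elim bot Fin.val

theorem num_injective {bot : ℕ} (h : g.numStates ≤ bot) : Function.Injective (g.num bot) := by
  intro x y hxy
  cases x with
  | none =>
    cases y with
    | none => rfl
    | some q =>
      have : bot = q := hxy
      omega
  | some p =>
    cases y with
    | none =>
      have : (p : ℕ) = bot := hxy
      omega
    | some q => exact congrArg some (Fin.ext hxy)

/-- The transitions of `g` as a relation between numbers. -/
def NumEdge (bot t : ℕ) (a : Option (Fin d)) (u : ℕ) : Prop :=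
  ∃ r ∈ g.rules, (r.1 : ℕ) = t ∧ r.2.1 = a ∧ g.num bot r.2.2 = u

section sound

variable (bot : ℕ) (K : Fin d → ℕ)

/-- There is a walk to the final point through `s` which is right up to the carry `w`. -/
def Done (s : Fin d → ℕ) (i : ℕ) (w : Fin d → ℕ) : Prop :=
  ∃ l, IsWalk (some g.start) l none ∧ (∀ r ∈ l, r ∈ g.rules) ∧
    (∀ j, ∃ p ∈ l.map Prod.fst, (p : ℕ) = s j) ∧ ∀ a, vec l a = K a % 2 ^ i + 2 ^ i * w a

/-- The invariant of the search while it builds the first walk. -/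
def InvFirst (y : Config d) : Prop :=
  y.o = bot ∧ y.i = 0 ∧ ∃ q l, y.t = g.num bot (some q) ∧ IsWalk (some g.start) l (some q) ∧
    (∀ r ∈ l, r ∈ g.rules) ∧ (∀ a, vec l a = y.w a) ∧
    ∀ j, ∃ p : Fin g.numStates, (p : ℕ) = y.s j ∧ (p ∈ l.map Prod.fst ∨ p = q)

/-- The invariant of the search after it has built the first walk. -/
def InvLoop (y : Config d) : Prop :=
  ∃ o t w l, y.o = g.num bot o ∧ y.t = g.num bot t ∧ g.Done K y.s y.i w ∧ IsWalk o l t ∧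
    (∀ r ∈ l, r ∈ g.rules) ∧ (∀ a, y.w a = w a + vec l a) ∧
    (o = none ∨ ∃ j, y.s j = g.num bot o)

variable {bot K}

/-- The closed walk is inserted `2 ^ i` times, which adds its letter count exactly once to the
carry. This is why the search may forget which closed walk it used in earlier rounds. -/
theorem Done.insert {s : Fin d → ℕ} {i : ℕ} {w : Fin d → ℕ} (h : g.Done K s i w) {j : Fin d}
    {q : Fin g.numStates} (hq : s j = q)
    {c : List (Fin g.numStates × Option (Fin d) × Option (Fin g.numStates))}
    (hc : IsWalk (some q) c (some q)) (hcg : ∀ r ∈ c, r ∈ g.rules) :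
    g.Done K s i (w + vec c) := by
  obtain ⟨l, hl, hlg, hs, hv⟩ := h
  obtain ⟨p, hp, hpq⟩ := hs j
  obtain rfl : p = q := Fin.ext (hpq.trans hq)
  obtain ⟨l', hl', hperm⟩ := hl.insert_flatten (List.replicate (2 ^ i) c) fun c' hc' => by
    rw [List.eq_of_mem_replicate hc']
    exact ⟨p, hp, hc⟩
  refine ⟨l', hl', fun r hr => ?_, fun j => ?_, fun a => ?_⟩
  · rcases List.mem_append.1 (hperm.mem_iff.1 hr) with h | h
    · exact hlg r h
    · obtain ⟨c', hc', hr'⟩ := List.mem_flatten.1 h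
      rw [List.eq_of_mem_replicate hc'] at hr'
      exact hcg r hr'
  · obtain ⟨p', hp', hj⟩ := hs j
    exact ⟨p', (hperm.map _).mem_iff.2 (by
      rw [List.map_append]
      exact List.mem_append_left _ hp'), hj⟩
  · rw [vec_perm hperm, vec_append, vec_flatten, List.map_replicate, List.sum_replicate]
    simp only [Pi.add_apply, Pi.smul_apply, smul_eq_mul, hv]
    ring

/-- When `o = t`, the walk under construction is closed and can be absorbed by `Done.insert`. At the
final point it is empty, because no edge starts there. -/
theorem InvLoop.done (hbot : g.numStates ≤ bot) {y : Config d} (h : g.InvLoop bot K y)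
    (hy : y.o = y.t) :
    g.Done K y.s y.i y.w ∧ ∃ o, y.o = g.num bot o ∧ (o = none ∨ ∃ j, y.s j = g.num bot o) := by
  obtain ⟨o, t, w, l, ho, ht, hd, hl, hlg, hw, hor⟩ := h
  obtain rfl : o = t := g.num_injective hbot (by rw [← ho, ← ht, hy])
  refine ⟨?_, o, ho, hor⟩
  have hw' : y.w = w + vec l := funext hw
  rw [hw']
  cases o with
  | none =>
    cases l with
    | nil => exact hd
    | cons r l => cases hl.1
  | some q =>
    rcases hor with hor | ⟨j, hj⟩
    · cases hor
    · exact Done.insert g hd hj hl hlg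

/-- In the first phase `o` is the final point, which the walk has not yet reached. Hence the
condition `o = t` in a step excludes this phase. -/
theorem InvFirst.ne (hbot : g.numStates ≤ bot) {y : Config d} (h : g.InvFirst bot y) :
    y.o ≠ y.t := by
  obtain ⟨ho, -, q, -, ht, -⟩ := h
  rw [ho, ht]
  have : g.num bot none ≠ g.num bot (some q) := fun h => by cases g.num_injective hbot h
  exact this

theorem vec_snoc (l : List (Fin g.numStates × Option (Fin d) × Option (Fin g.numStates)))
    (r : Fin g.numStates × Option (Fin d) × Option (Fin g.numStates)) (a : Fin d) :
    vec (l ++ [r]) a = vec l a + if r.2.1 = some a then 1 else 0 := by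
  simp [vec, List.countP_append, List.countP_singleton]

theorem inv_of_walk (hbot : g.numStates ≤ bot) {c : Config d}
    (hc : g.InvFirst bot c ∨ g.InvLoop bot K c)
    {r : Fin g.numStates × Option (Fin d) × Option (Fin g.numStates)} (hr : r ∈ g.rules)
    (ht : (r.1 : ℕ) = c.t) {w : Fin d → ℕ}
    (hw : ∀ a, w a = c.w a + if r.2.1 = some a then 1 else 0) :
    g.InvFirst bot { c with t := g.num bot r.2.2, w := w } ∨
      g.InvLoop bot K { c with t := g.num bot r.2.2, w := w } := by
  rcases hc with ⟨ho, hi, q, l, hq, hl, hlg, hv, hs⟩ | ⟨o, t, w₀, l, ho, ht', hd, hl, hlg, hv, hor⟩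
  · obtain rfl : r.1 = q := Fin.ext (ht.trans hq)
    have hlg' : ∀ r' ∈ l ++ [r], r' ∈ g.rules := fun r' hr' => by
      rcases List.mem_append.1 hr' with h | h
      · exact hlg r' h
      · rwa [List.mem_singleton.1 h]
    have hv' : ∀ a, vec (l ++ [r]) a = w a := fun a => by rw [vec_snoc, hv, hw]
    have hs' : ∀ j, ∃ p ∈ (l ++ [r]).map Prod.fst, (p : ℕ) = c.s j := fun j => by
      obtain ⟨p, hp, h⟩ := hs j
      refine ⟨p, ?_, hp⟩
      rw [List.map_append, List.mem_append]
      exact h.imp id fun h => by simp [h]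
    cases hu : r.2.2 with
    | none =>
      right
      -- Reaching the final point ends the first phase. The finished walk satisfies `Done` with `i =
      -- 0`, where `K a % 2 ^ 0 = 0`, and the current closed walk is the empty one at `none`.
      refine ⟨none, none, w, [], ho, rfl, ⟨l ++ [r], ?_, hlg', hs', fun a => ?_⟩, rfl, by simp,
        fun a => rfl, Or.inl rfl⟩
      · exact isWalk_append.2 ⟨_, hl, rfl, hu⟩
      · simp [hi, Nat.mod_one, hv']
    | some u =>
      left
      exact ⟨ho, hi, u, l ++ [r], rfl, isWalk_append.2 ⟨_, hl, rfl, hu⟩, hlg', hv', fun j => by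
        obtain ⟨p, hp, h⟩ := hs' j
        exact ⟨p, h, Or.inl hp⟩⟩
  · right
    obtain rfl : some r.1 = t := g.num_injective hbot (ht.trans ht')
    refine ⟨o, r.2.2, w₀, l ++ [r], ho, rfl, hd, isWalk_append.2 ⟨_, hl, rfl, rfl⟩, fun r' hr' => ?_,
      fun a => ?_, hor⟩
    · rcases List.mem_append.1 hr' with h | h
      · exact hlg r' h
      · rwa [List.mem_singleton.1 h]
    · change w a = _
      rw [hw, hv, vec_snoc, add_assoc]

/-- The search keeps its invariant. -/
theorem inv_of_step (hbot : g.numStates ≤ bot) {C : Config d → Prop}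
    (hC : ∀ c, C c → g.InvFirst bot c ∨ g.InvLoop bot K c) {y : Config d}
    (h : Step (g.NumEdge bot) (· = g.start) bot
      (fun a i => (K a).testBit i = true) C y) : g.InvFirst bot y ∨ g.InvLoop bot K y := by
  rcases h with ⟨ho, ht, hi, hs, hw⟩ | ⟨j, ho, ht, hs, v, h⟩ | ⟨a, t, ⟨r, hr, hrt, rfl, hu⟩, h⟩ |
    ⟨j, hot, hs, z, h⟩ | ⟨hot, i, hi, β, hβ, h⟩
  · exact Or.inl ⟨ho, hi, g.start, [], ht, rfl, by simp, fun a => (hw a).symm,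
      fun j => ⟨g.start, ((hs j).trans ht).symm, Or.inr rfl⟩⟩
  · rcases hC _ h with ⟨_, hi, q, l, hq, hl, hlg, hv, hs'⟩ | ⟨o, t, w, l, ho', ht', hd, hl, -⟩
    · refine Or.inl ⟨ho, hi, q, l, hq, hl, hlg, hv, fun k => ?_⟩
      by_cases hk : k = j
      · subst hk
        exact ⟨q, (hs.trans hq).symm, Or.inr rfl⟩
      · have := hs' k
        rwa [show ({ y with s := Function.update y.s j v } : Config d).s k = y.s k from
          Function.update_of_ne hk _ _] at this
    -- In the second phase a walk from the final point is empty, so `t` would be the final point as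
    -- well.
    · obtain rfl : none = o := g.num_injective hbot (ho.symm.trans ho')
      cases l with
      | nil =>
        obtain rfl : none = t := hl
        exact absurd ht' ht
      | cons r l => cases hl.1
  · cases ha : r.2.1 with
    | none =>
      rw [ha] at h
      have := inv_of_walk g hbot (hC _ h) hr hrt (w := y.w) fun a => by simp [ha]
      rwa [hu] at this
    | some b =>
      rw [ha] at h
      obtain ⟨v, hv, h⟩ := h
      have := inv_of_walk g hbot (hC _ h) hr hrt (w := y.w) fun a => by
        by_cases hab : a = b
        · subst hab
          simp [ha, hv]
        · simp [ha, Function.update_of_ne hab, Ne.symm hab]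
      rwa [hu] at this
  · right
    obtain ⟨hd, -⟩ := InvLoop.done g hbot ((hC _ h).resolve_left fun h => h.ne g hbot rfl) rfl
    obtain ⟨p, -, hp⟩ := hd.choose_spec.2.2.1 j
    have hp' : y.s j = g.num bot (some p) := hp.symm
    exact ⟨some p, some p, y.w, [], hs.trans hp', hot.symm.trans (hs.trans hp'), hd, rfl, by simp,
      fun a => rfl, Or.inr ⟨j, hp'⟩⟩
  · right
    obtain ⟨⟨l, hl, hlg, hs, hv⟩, o, ho, hor⟩ :=
      InvLoop.done g hbot ((hC _ h).resolve_left fun h => h.ne g hbot hot) hot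
    refine ⟨o, o, y.w, [], ho, hot.symm.trans ho, ⟨l, hl, hlg, hs, fun a => ?_⟩, rfl, by simp,
      fun a => rfl, hor⟩
    -- Halving preserves the total: the predecessor's carry 2w + β at weight 2^i is w at weight
    -- 2^(i+1), plus the digit β of `K` at place i.
    rw [hv, hi, Nat.mod_pow_succ]
    have h1 := Bool.eq_iff_iff.2 (hβ a)
    have h2 : K a / 2 ^ i % 2 = (β a).toNat := by
      rw [← h1, Nat.testBit_eq_decide_div_mod_eq]
      rcases Nat.mod_two_eq_zero_or_one (K a / 2 ^ i) with h | h <;> simp [h]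
    rw [h2]
    simp only [pow_succ]
    ring

/-- If the search succeeds, then there is a walk. -/
theorem mem_out_of_inv (hbot : g.numStates ≤ bot) {y : Config d} (hK : ∀ a, K a < 2 ^ y.i)
    (h : g.InvFirst bot y ∨ g.InvLoop bot K y) (hy : y.o = y.t) (hw : ∀ a, y.w a = 0) :
    K ∈ g.toGrammar.out := by
  obtain ⟨⟨l, hl, hlg, -, hv⟩, -⟩ :=
    InvLoop.done g hbot (h.resolve_left fun h => h.ne g hbot hy) hy
  refine (g.mem_out_iff K).2 ⟨l, hl, hlg, funext fun a => ?_⟩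
  rw [hv, hw, mul_zero, add_zero, Nat.mod_eq_of_lt (hK a)]

end sound

section complete

variable {bot N : ℕ} {K : Fin d → ℕ} {C : Config d → Prop}

/-- Carries only grow along a walk, so a bound on the final carry keeps all intermediate
configurations in range. -/
theorem step_walk (hCN : ∀ y, C y → y.Lt N)
    (hC : ∀ y : Config d, y.Lt N → Step (g.NumEdge bot) (· = g.start) bot
      (fun a i => (K a).testBit i = true) C y → C y)
    (hbot : g.numStates ≤ bot) (hN : bot < N)
    {l : List (Fin g.numStates × Option (Fin d) × Option (Fin g.numStates))}
    {x z : Option (Fin g.numStates)} (hl : IsWalk x l z) (hlg : ∀ r ∈ l, r ∈ g.rules)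
    {y : Config d} (hy : C y) (hx : y.t = g.num bot x)
    (hw : ∀ a, y.w a + vec l a < N) : C { y with t := g.num bot z, w := y.w + vec l } := by
  have hyN := hCN y hy
  induction l generalizing x y with
  | nil =>
    obtain rfl : x = z := hl
    rw [← hx]
    exact hy
  | cons r l ih =>
    obtain ⟨rfl, hl⟩ := hl
    have hv : ∀ a, vec (r :: l) a = vec [r] a + vec l a := fun a =>
      congrFun (vec_append [r] l) a
    have hlt : ({ y with t := g.num bot r.2.2, w := y.w + vec [r] } : Config d).Lt N := by
      refine ⟨hyN.1, ?_, hyN.2.2.1, hyN.2.2.2.1, fun a => ?_⟩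
      · change g.num bot r.2.2 < N
        cases r.2.2 with
        | none => exact hN
        | some u => exact (u.2.trans_le hbot).trans hN
      · have := hw a
        rw [hv] at this
        change y.w a + vec [r] a < N
        omega
    have h1 : C { y with t := g.num bot r.2.2, w := y.w + vec [r] } := by
      refine hC _ hlt (Or.inr (Or.inr (Or.inl ⟨r.2.1, y.t,
        ⟨r, hlg r List.mem_cons_self, hx.symm, rfl, rfl⟩, ?_⟩)))
      cases ha : r.2.1 with
      | none =>
        have : vec [r] = 0 := funext fun a => by simp [vec, ha]
        rw [this]
        exact hy
      | some b =>
        refine ⟨y.w b, by simp [vec, ha], ?_⟩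
        convert hy using 1
        ext a
        · rfl
        · rfl
        · rfl
        · rfl
        · by_cases hab : a = b
          · subst hab
            simp
          · simp [Function.update_of_ne hab, vec, ha, Ne.symm hab]
    have h2 := ih hl (fun r' hr' => hlg r' (List.mem_cons_of_mem _ hr')) h1 rfl (fun a => by
      have := hw a
      rw [hv] at this
      change y.w a + vec [r] a + vec l a < N
      omega) hlt
    convert h2 using 2
    rw [add_assoc]
    exact congrArg _ (funext hv)

/-- The points `s j` are recorded while the base walk is traversed, each when the walk leaves it;
until then the initial state is a placeholder. -/
theorem step_base (hCN : ∀ y, C y → y.Lt N)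
    (hC : ∀ y : Config d, y.Lt N → Step (g.NumEdge bot) (· = g.start) bot
      (fun a i => (K a).testBit i = true) C y → C y)
    (hbot : g.numStates ≤ bot) (hN : bot < N) (s : Fin d → Fin g.numStates)
    (l : List (Fin g.numStates × Option (Fin d) × Option (Fin g.numStates)))
    {z : Option (Fin g.numStates)} (hl : IsWalk (some g.start) l z) (hlg : ∀ r ∈ l, r ∈ g.rules)
    (hw : l.length < N) :
    C ⟨bot, g.num bot z, 0, fun j => if s j ∈ l.map Prod.fst then s j else g.start, vec l⟩ := by
  have hst : ∀ q : Fin g.numStates, (q : ℕ) < N := fun q => (q.2.trans_le hbot).trans hN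
  induction l using List.reverseRecOn generalizing z with
  | nil =>
    obtain rfl : some g.start = z := hl
    exact hC _ ⟨hN, hst _, hw, fun j => by simpa using hst _, fun a => hw⟩
      (Or.inl ⟨rfl, rfl, rfl, fun j => by simp [num], fun a => rfl⟩)
  | append_singleton l r ih =>
    obtain ⟨_, hl, rfl, hz⟩ := isWalk_append.1 hl
    have hw' : l.length < N := by
      rw [List.length_append] at hw
      omega
    have h1 := ih hl (fun r' hr' => hlg r' (List.mem_append_left _ hr')) hw'
    -- Before the edge `r` is taken, all `j` with `s j = r.1` are recorded, one index per step.
    have h2 : ∀ J : Finset (Fin d), C ⟨bot, r.1, 0, fun j =>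
        if s j ∈ l.map Prod.fst ∨ j ∈ J ∧ s j = r.1 then s j else g.start, vec l⟩ := by
      intro J
      induction J using Finset.induction_on with
      | empty => simpa [num] using h1
      | insert k J hk ih =>
        by_cases hkr : s k = r.1
        · refine hC _ ⟨hN, hst _, (Nat.zero_le _).trans_lt hN, fun j => ?_,
            fun a => (vec_le_length l a).trans_lt hw'⟩ (Or.inr (Or.inl ⟨k, rfl, ?_, ?_,
            if s k ∈ l.map Prod.fst ∨ k ∈ J ∧ s k = r.1 then s k else g.start, ?_⟩))
          · dsimp only
            split_ifs
            · exact hst _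
            · exact hst _
          · exact (r.1.2.trans_le hbot).ne
          · simp [hkr]
          · convert ih using 2
            funext j
            by_cases hjk : j = k
            · subst hjk
              simp
            · simp [hjk]
        · convert ih using 2
          funext j
          by_cases hjk : j = k
          · subst hjk
            simp [hkr]
          · simp [hjk]
    have h3 := g.step_walk hCN hC hbot hN (l := [r]) (x := some r.1) (z := z) ⟨rfl, hz⟩
      (fun r' hr' => hlg r' (List.mem_append_right _ hr')) (h2 Finset.univ) rfl fun a => by
        have := (vec_le_length (l ++ [r]) a).trans_lt hw
        rwa [vec_append] at this
    rw [vec_append]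
    convert h3 using 2
    funext j
    simp only [List.map_append, List.mem_append, List.map_singleton, List.mem_singleton,
      Finset.mem_univ, true_and]

/-- If there is a walk, then the search succeeds. -/
theorem exists_of_mem_out (hCN : ∀ y, C y → y.Lt N)
    (hC : ∀ y : Config d, y.Lt N → Step (g.NumEdge bot) (· = g.start) bot
      (fun a i => (K a).testBit i = true) C y → C y)
    (hbot : g.numStates ≤ bot) (hN : bot < N) {L : ℕ} (hLN : L < N) (hL : ∀ a, K a < 2 ^ L)
    (hbound : 2 * (baseBound d g.numStates + d * g.numStates) < N) (h : K ∈ g.toGrammar.out) :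
    ∃ y, C y ∧ y.o = y.t ∧ y.i = L ∧ ∀ a, y.w a = 0 := by
  obtain ⟨l, hl, hlg, rfl⟩ := (g.mem_out_iff K).1 h
  obtain ⟨b, s, c, M, hb, hbl, hlen, hc, hsum⟩ := hl.exists_decomposition
  rw [Fintype.card_fin] at hlen hc
  set W := baseBound d g.numStates + d * g.numStates with hW
  have hst : ∀ q : Fin g.numStates, (q : ℕ) < N := fun q => (q.2.trans_le hbot).trans hN
  have hcn : ∀ j a, vec (c j) a ≤ g.numStates := fun j a => (vec_le_length _ a).trans (hc j).2.2.2
  -- After i rounds, the carry and the quotients of the M_j by 2^i together represent K / 2^i. A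
  -- round adds at most d·n to the carry and then halves it; as W ≥ d·n, the bound W persists and 2W
  -- suffices in between.
  have key : ∀ i ≤ L, ∃ (o : ℕ) (w : Fin d → ℕ), C ⟨o, o, i, fun j => s j, w⟩ ∧
      (∀ a, w a ≤ W) ∧ ∀ a, vec l a / 2 ^ i = w a + ∑ j, M j / 2 ^ i * vec (c j) a := by
    intro i
    induction i with
    | zero =>
      intro _
      have h1 := g.step_base hCN hC hbot hN s b hb (fun r hr => hlg r (hbl r hr)) (by omega)
      refine ⟨bot, vec b, ?_, fun a => ((vec_le_length b a).trans hlen).trans (by omega),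
        fun a => ?_⟩
      · convert h1 using 2
        · rfl
        · funext j
          rw [if_pos (hc j).1]
      · simpa using congrFun hsum a
    | succ i ih =>
      intro hi
      obtain ⟨o, w, h1, hwW, hdiv⟩ := ih (by omega)
      let w' : Finset (Fin d) → Fin d → ℕ := fun J a =>
        w a + ∑ j ∈ J, M j / 2 ^ i % 2 * vec (c j) a
      have hw' : ∀ J a, w' J a ≤ W + d * g.numStates := by
        intro J a
        refine Nat.add_le_add (hwW a) ?_
        calc ∑ j ∈ J, M j / 2 ^ i % 2 * vec (c j) a ≤ ∑ j ∈ J, 1 * g.numStates :=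
              Finset.sum_le_sum fun j _ => Nat.mul_le_mul (by omega) (hcn j a)
          _ ≤ d * g.numStates := by
              rw [Finset.sum_const, smul_eq_mul, one_mul]
              exact Nat.mul_le_mul_right _ ((Finset.card_le_univ J).trans_eq (Fintype.card_fin d))
      -- For each `j` whose multiplicity has bit `i` equal to 1, the search jumps to `s j` and walks
      -- around `c j` once.
      have h2 : ∀ J : Finset (Fin d), ∃ o, C ⟨o, o, i, fun j => s j, w' J⟩ := by
        intro J
        induction J using Finset.induction_on with
        | empty => exact ⟨o, by simpa [w'] using h1⟩
        | insert k J hk ih =>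
          obtain ⟨o, h2⟩ := ih
          rcases Nat.mod_two_eq_zero_or_one (M k / 2 ^ i) with h3 | h3
          · refine ⟨o, ?_⟩
            have : w' (insert k J) = w' J := funext fun a => by
              simp [w', Finset.sum_insert hk, h3]
            rwa [this]
          · have hkw : w' (insert k J) = w' J + vec (c k) := funext fun a => by
              simp only [w', Finset.sum_insert hk, h3, Pi.add_apply]
              ring
            have h4 := hCN _ h2
            have h5 : C ⟨s k, s k, i, fun j => s j, w' J⟩ :=
              hC _ ⟨hst _, hst _, h4.2.2⟩ (Or.inr (Or.inr (Or.inr (Or.inl ⟨k, rfl, rfl, o, h2⟩))))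
            refine ⟨s k, ?_⟩
            rw [hkw]
            refine g.step_walk hCN hC hbot hN (hc k).2.1
              (fun r hr => hlg r ((hc k).2.2.1 r hr)) h5 rfl fun a => ?_
            have h6 := hw' (insert k J) a
            rw [hkw] at h6
            exact (show w' J a + vec (c k) a ≤ _ from h6).trans_lt (by omega)
      obtain ⟨o', h3⟩ := h2 Finset.univ
      have h4 := hCN _ h3
      have hsplit : ∀ a, vec l a / 2 ^ i =
          w' Finset.univ a + 2 * ∑ j, M j / 2 ^ (i + 1) * vec (c j) a := by
        intro a
        rw [hdiv, add_assoc, Finset.mul_sum, ← Finset.sum_add_distrib]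
        congr 1
        refine Finset.sum_congr rfl fun j _ => ?_
        rw [pow_succ, ← Nat.div_div_eq_div_mul, ← mul_assoc, ← add_mul, Nat.mod_add_div]
      refine ⟨o', fun a => w' Finset.univ a / 2, hC _ ⟨h4.1, h4.2.1, hi.trans_lt hLN, h4.2.2.2.1,
        fun a => (Nat.div_le_self _ _).trans_lt (h4.2.2.2.2 a)⟩ (Or.inr (Or.inr (Or.inr (Or.inr
        ⟨rfl, i, rfl, fun a => (vec l a).testBit i, fun a => Iff.rfl, ?_⟩)))), fun a => ?_, fun a => ?_⟩
      · convert h3 using 2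
        funext a
        have h5 := hsplit a
        have h6 : ((vec l a).testBit i).toNat = vec l a / 2 ^ i % 2 := by
          rw [Nat.testBit_eq_decide_div_mod_eq]
          rcases Nat.mod_two_eq_zero_or_one (vec l a / 2 ^ i) with h | h <;> simp [h]
        dsimp only
        rw [h6]
        omega
      · have := hw' Finset.univ a
        dsimp only
        omega
      · rw [pow_succ, ← Nat.div_div_eq_div_mul, hsplit]
        simp only [pow_succ]
        omega
  -- After `L` rounds `K / 2 ^ L = 0`, which forces the carry to vanish.
  obtain ⟨o, w, h1, -, h2⟩ := key L le_rfl
  refine ⟨_, h1, rfl, rfl, fun a => ?_⟩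
  have := h2 a
  rw [Nat.div_eq_of_lt (hL a)] at this
  change w a = 0
  omega

end complete

end RegGrammarDesc

/-! ### Reading the encoding of an instance -/

namespace RegGrammarDesc

variable {d : ℕ}

/-- A unary numeral is found at the place `p`. -/
def NumAt (w : List (Symb d)) (p m : ℕ) : Prop :=
  (∀ i < m, w[p + i]? = some .tick) ∧ w[p + m]? = some .comma

/-- The number of the initial state. -/
def StartAt (w : List (Symb d)) (L u : ℕ) : Prop :=
  ∃ n < L, NumAt w 0 n ∧ NumAt w (n + 1) u

/-- The symbol for an optional letter. -/
def letterSymb : Option (Fin d) → Symb d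
  | none => .noLetter
  | some a => .letter a

/-- The transitions that are found in the word. -/
def RuleIn (w : List (Symb d)) (L t : ℕ) (a : Option (Fin d)) (u : ℕ) : Prop :=
  ∃ p < L, w[p]? = some .rule ∧ NumAt w (p + 1) t ∧ w[p + t + 2]? = some (letterSymb a) ∧
    ((w[p + t + 3]? = some .noState ∧ u = L) ∨ NumAt w (p + t + 3) u)

/-- There are at least `m` commas after the place `p`. -/
def CommasAfter (w : List (Symb d)) (L : ℕ) : ℕ → ℕ → Prop
  | 0, _ => True
  | m + 1, p => ∃ q < L, p < q ∧ w[q]? = some .comma ∧ CommasAfter w L m q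

/-- The bits of the multiplicities that are `1`. -/
def BitIn (w : List (Symb d)) (L : ℕ) (a : Fin d) (i : ℕ) : Prop :=
  ∃ p < L, w[p]? = some .comma ∧ (CommasAfter w L (d - a) p ∧ ¬ CommasAfter w L (d - a + 1) p) ∧
    (∀ k < i, ∃ b, w[p + 1 + k]? = some (.bit b)) ∧ w[p + 1 + i]? = some (.bit true)

theorem getElem?_of_drop {w v : List (Symb d)} {p : ℕ} (h : w.drop p = v) (i : ℕ) :
    w[p + i]? = v[i]? := by
  rw [← h, List.getElem?_drop]

theorem numAt_iff {w v : List (Symb d)} {p u m : ℕ} (h : w.drop p = encUnary u ++ v) :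
    NumAt w p m ↔ m = u := by
  simp only [NumAt, getElem?_of_drop h, encUnary, List.append_assoc]
  have h1 : ∀ i < u, (List.replicate u (Symb.tick : Symb d) ++ ([.comma] ++ v))[i]? =
      some .tick := fun i hi => by
    rw [List.getElem?_append_left (by simpa using hi)]
    simp [hi]
  have h2 : (List.replicate u (Symb.tick : Symb d) ++ ([.comma] ++ v))[u]? = some .comma := by
    rw [List.getElem?_append_right (by simp)]
    simp
  constructor
  · rintro ⟨h3, h4⟩
    rcases lt_trichotomy m u with h | h | h
    · rw [h1 m h] at h4
      cases h4
    · exact h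
    · have := h3 u h
      rw [h2] at this
      cases this
  · rintro rfl
    exact ⟨h1, h2⟩

theorem drop_append_eq {w x y : List (Symb d)} {p q : ℕ} (h : w.drop p = x ++ y)
    (hq : q = p + x.length) : w.drop q = y := by
  rw [hq, ← List.drop_drop, h, List.drop_left]

theorem length_encUnary (n : ℕ) : (encUnary n : List (Symb d)).length = n + 1 := by
  simp [encUnary]

theorem startAt_iff (g : RegGrammarDesc d) (K : Fin d → ℕ) (u : ℕ) :
    StartAt (encInstance (g, K)) (encInstance (g, K)).length u ↔ u = g.start := by
  obtain ⟨v, hv⟩ : ∃ v, encInstance (g, K) = encUnary g.numStates ++ (encUnary g.start ++ v) :=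
    ⟨_, by simp only [encInstance, encGrammar, List.append_assoc]; rfl⟩
  have h0 : (encInstance (g, K)).drop 0 = encUnary g.numStates ++ (encUnary g.start ++ v) := hv
  have h1 := drop_append_eq h0 (q := g.numStates + 1) (by rw [length_encUnary, zero_add])
  constructor
  · rintro ⟨n, -, h2, h3⟩
    obtain rfl := (numAt_iff h0).1 h2
    exact (numAt_iff h1).1 h3
  · rintro rfl
    refine ⟨g.numStates, ?_, (numAt_iff h0).2 rfl, (numAt_iff h1).2 rfl⟩
    rw [hv, List.length_append, length_encUnary]
    omega

theorem ruleAt_iff {w v : List (Symb d)} {p L t u n : ℕ} {a : Option (Fin d)}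
    {r : Fin n × Option (Fin d) × Option (Fin n)} (h : w.drop p = encRule r ++ v) :
    (w[p]? = some .rule ∧ NumAt w (p + 1) t ∧ w[p + t + 2]? = some (letterSymb a) ∧
      ((w[p + t + 3]? = some .noState ∧ u = L) ∨ NumAt w (p + t + 3) u)) ↔
    (r.1 : ℕ) = t ∧ r.2.1 = a ∧ r.2.2.elim L Fin.val = u := by
  obtain ⟨s, b, x⟩ := r
  have h0 : w.drop p = [.rule] ++ (encUnary s ++ (encLetter b ++ (encTarget x ++ v))) := by
    rw [h, encRule]
    simp
  have h1 := drop_append_eq h0 (q := p + 1) rfl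
  have h2 := drop_append_eq h1 (q := p + s + 2) (by rw [length_encUnary]; omega)
  have hb : (encLetter b : List (Symb d)) = [letterSymb b] := by cases b <;> rfl
  rw [hb] at h2
  have h3 := drop_append_eq h2 (q := p + s + 3) rfl
  have e0 : w[p]? = some .rule := getElem?_of_drop h0 0
  have e2 : w[p + s + 2]? = some (letterSymb b) := getElem?_of_drop h2 0
  have hinj : letterSymb b = letterSymb a ↔ b = a := by
    cases a <;> cases b <;> simp [letterSymb]
  have key : ((w[p + s + 3]? = some .noState ∧ u = L) ∨ NumAt w (p + s + 3) u) ↔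
      x.elim L Fin.val = u := by
    cases x with
    | none =>
      have e3 : w[p + s + 3]? = some .noState := getElem?_of_drop h3 0
      have : ¬ NumAt w (p + s + 3) u := by
        rintro ⟨h4, h5⟩
        rcases u with _ | u
        · rw [add_zero, e3] at h5
          cases h5
        · have := h4 0 (by omega)
          rw [add_zero, e3] at this
          cases this
      simp [e3, this, eq_comm]
    | some q =>
      have e3 : w[p + s + 3]? ≠ some .noState := by
        have := getElem?_of_drop h3 0
        rw [add_zero] at this
        rw [this]
        rcases q with ⟨_ | q, hq⟩ <;> simp [encTarget, encUnary, List.replicate_succ]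
      simp [e3, numAt_iff h3, eq_comm]
  rw [numAt_iff h1]
  constructor
  · rintro ⟨-, rfl, h4, h5⟩
    rw [e2, Option.some.injEq, hinj] at h4
    exact ⟨rfl, h4, key.1 h5⟩
  · rintro ⟨rfl, rfl, h5⟩
    exact ⟨e0, rfl, e2, key.2 h5⟩

theorem exists_of_getElem?_append {x y : List (Symb d)} {p : ℕ} {c : Symb d} (hc : c ∉ x)
    (h : (x ++ y)[p]? = some c) : ∃ q, p = x.length + q ∧ y[q]? = some c := by
  by_cases hp : p < x.length
  · rw [List.getElem?_append_left hp] at h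
    exact absurd (List.mem_of_getElem? h) hc
  · refine ⟨p - x.length, by omega, ?_⟩
    rwa [List.getElem?_append_right (by omega)] at h

theorem rule_notMem_encMultiset (K : Fin d → ℕ) : Symb.rule ∉ encMultiset K := by
  simp [encMultiset, encBinary]

theorem rule_notMem_encUnary (n : ℕ) : (Symb.rule : Symb d) ∉ encUnary n := by
  simp [encUnary]

theorem exists_rule_of_getElem? {n : ℕ} (R : List (Fin n × Option (Fin d) × Option (Fin n)))
    {y : List (Symb d)} (hy : Symb.rule ∉ y) {p : ℕ}
    (h : (R.flatMap encRule ++ y)[p]? = some .rule) :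
    ∃ r ∈ R, ∃ v, (R.flatMap encRule ++ y).drop p = encRule r ++ v := by
  induction R generalizing p with
  | nil =>
    rw [List.flatMap_nil, List.nil_append] at h
    exact absurd (List.mem_of_getElem? h) hy
  | cons r R ih =>
    rw [List.flatMap_cons, List.append_assoc] at h ⊢
    rcases p with _ | p
    · exact ⟨r, List.mem_cons_self, _, rfl⟩
    · have hr : (Symb.rule : Symb d) ∉ encUnary (r.1 : ℕ) ++ encLetter r.2.1 ++ encTarget r.2.2 := by
        obtain ⟨s, b, x⟩ := r
        cases b <;> cases x <;> simp [encUnary, encLetter, encTarget]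
      rw [encRule, List.cons_append, List.getElem?_cons_succ] at h
      obtain ⟨q, rfl, h1⟩ := exists_of_getElem?_append hr h
      obtain ⟨r', hr', v, hv⟩ := ih h1
      refine ⟨r', List.mem_cons_of_mem _ hr', v, ?_⟩
      rw [encRule, List.cons_append, List.drop_succ_cons, ← hv, List.drop_length_add_append]

/-- The symbol `rule` occurs only at the beginning of an encoded transition, so each occurrence can
be decoded. The length of the word serves as the number of the final point. -/
theorem ruleIn_iff (g : RegGrammarDesc d) (K : Fin d → ℕ) (t : ℕ) (a : Option (Fin d)) (u : ℕ) :
    RuleIn (encInstance (g, K)) (encInstance (g, K)).length t a u ↔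
      g.NumEdge (encInstance (g, K)).length t a u := by
  set w := encInstance (g, K) with hw
  set L := w.length
  have hsplit : w = (encUnary g.numStates ++ encUnary g.start) ++
      (g.rules.flatMap encRule ++ (.comma :: encMultiset K)) := by
    simp [hw, encInstance, encGrammar]
  have hpre : (Symb.rule : Symb d) ∉ encUnary g.numStates ++ encUnary (g.start : ℕ) := by
    simp [rule_notMem_encUnary]
  constructor
  · rintro ⟨p, -, h⟩
    have h1 := h.1
    rw [hsplit] at h1
    obtain ⟨q, rfl, h2⟩ := exists_of_getElem?_append hpre h1
    obtain ⟨r, hr, v, hv⟩ := exists_rule_of_getElem? g.rules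
      (by simp [rule_notMem_encMultiset]) h2
    rw [← List.drop_length_add_append (l₁ := encUnary g.numStates ++ encUnary (g.start : ℕ)),
      ← hsplit] at hv
    exact ⟨r, hr, (ruleAt_iff hv).1 h⟩
  · rintro ⟨r, hr, h⟩
    obtain ⟨R₁, R₂, hR⟩ := List.append_of_mem hr
    have hv : w.drop (encUnary g.numStates ++ encUnary g.start ++ R₁.flatMap encRule).length =
        encRule r ++ (R₂.flatMap encRule ++ (.comma :: encMultiset K)) := by
      have : w = (encUnary g.numStates ++ encUnary g.start ++ R₁.flatMap encRule) ++
          (encRule r ++ (R₂.flatMap encRule ++ (.comma :: encMultiset K))) := by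
        rw [hsplit, hR, List.flatMap_append, List.flatMap_cons]
        simp only [List.append_assoc]
      rw [this, List.drop_left]
    have h1 := (ruleAt_iff (L := L) hv).2 h
    exact ⟨_, (List.getElem?_eq_some_iff.1 h1.1).1, h1⟩

/-- Whether a symbol is a comma. -/
def isComma : Symb d → Bool
  | .comma => true
  | _ => false

theorem succ_le_countP_comma_iff (v : List (Symb d)) (m : ℕ) :
    m + 1 ≤ v.countP isComma ↔
      ∃ q, v[q]? = some .comma ∧ m ≤ (v.drop (q + 1)).countP isComma := by
  induction v with
  | nil => simp
  | cons c v ih =>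
    by_cases hc : c = .comma
    · subst hc
      rw [List.countP_cons_of_pos rfl, Nat.succ_le_succ_iff]
      constructor
      · intro h
        exact ⟨0, rfl, h⟩
      · rintro ⟨q, -, h⟩
        exact h.trans ((List.drop_sublist q v).countP_le)
    · have h1 : isComma c ≠ true := by cases c <;> simp_all [isComma]
      rw [List.countP_cons_of_neg h1, ih]
      constructor
      · rintro ⟨q, h⟩
        exact ⟨q + 1, h⟩
      · rintro ⟨q, h, h'⟩
        rcases q with _ | q
        · exact absurd (Option.some.inj h) hc
        · exact ⟨q, h, h'⟩

theorem commasAfter_iff (w : List (Symb d)) (m p : ℕ) :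
    CommasAfter w w.length m p ↔ m ≤ (w.drop (p + 1)).countP isComma := by
  induction m generalizing p with
  | zero => simp [CommasAfter]
  | succ m ih =>
    rw [succ_le_countP_comma_iff]
    simp only [CommasAfter, ih, List.getElem?_drop, List.drop_drop]
    constructor
    · rintro ⟨q, -, h1, h2, h3⟩
      obtain ⟨k, rfl⟩ := Nat.exists_eq_add_of_lt h1
      exact ⟨k, by rwa [Nat.add_right_comm], by rwa [show p + 1 + (k + 1) = p + k + 1 + 1 by omega]⟩
    · rintro ⟨k, h1, h2⟩
      exact ⟨p + 1 + k, (List.getElem?_eq_some_iff.1 h1).1, by omega, h1, h2⟩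

/-- The numerals of the letters from `a` on end with one comma each, so the comma before the numeral
of `a` is the only one followed by exactly `d - a` commas. Places beyond the digits are no `bit
true`, in accordance with leading zeros. -/
theorem bitIn_iff (g : RegGrammarDesc d) (K : Fin d → ℕ) (a : Fin d) (i : ℕ) :
    BitIn (encInstance (g, K)) (encInstance (g, K)).length a i ↔ (K a).testBit i = true := by
  set w := encInstance (g, K) with hw
  -- The comma before a numeral closes either the grammar, for the first letter, or the preceding
  -- numeral.
  have hend : ∀ l : List (Fin d), ∃ Y, (Symb.comma : Symb d) :: l.flatMap (fun b => encBinary (K b)) =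
      Y ++ [.comma] := by
    intro l
    induction l using List.reverseRecOn with
    | nil => exact ⟨[], rfl⟩
    | append_singleton l b ih =>
      rw [List.flatMap_append, List.flatMap_singleton, encBinary, ← List.append_assoc,
        ← List.cons_append]
      exact ⟨_, rfl⟩
  have hcount : ∀ l : List (Fin d), (l.flatMap fun b => (encBinary (K b) : List (Symb d))).countP
      isComma = l.length := by
    intro l
    induction l with
    | nil => rfl
    | cons b l ih =>
      rw [List.flatMap_cons, List.countP_append, ih, encBinary, List.countP_append,
        List.countP_map, List.length_cons]
      have : (isComma : Symb d → Bool) ∘ Symb.bit = fun _ => false := rfl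
      rw [this]
      simp [isComma]
      omega
  have hfin : List.finRange d = (List.finRange d).take a ++
      a :: (List.finRange d).drop (a + 1) := by
    conv_lhs => rw [← List.take_append_drop a (List.finRange d)]
    rw [List.drop_eq_getElem_cons (by simp)]
    simp
  set l₂ := (List.finRange d).drop (a + 1) with hl₂
  have hlen : l₂.length = d - (a + 1) := by simp [hl₂]
  obtain ⟨Y, hY⟩ := hend ((List.finRange d).take a)
  obtain ⟨X, hX⟩ : ∃ X, w = X ++ [.comma] ++ ((K a).bits.map .bit ++
      (.comma :: l₂.flatMap fun b => encBinary (K b))) := by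
    refine ⟨encUnary g.numStates ++ encUnary g.start ++ g.rules.flatMap encRule ++ Y, ?_⟩
    rw [List.append_assoc _ Y, ← hY, hw, encInstance, encGrammar, encMultiset]
    conv_lhs => rw [hfin]
    simp [encBinary]
  have h0 : w.drop X.length = [.comma] ++ ((K a).bits.map .bit ++
      (.comma :: l₂.flatMap fun b => encBinary (K b))) := by
    rw [hX, List.append_assoc, List.drop_left]
  have h1 := drop_append_eq h0 (q := X.length + 1) rfl
  have e0 : w[X.length]? = some .comma := getElem?_of_drop h0 0
  have hc : (w.drop (X.length + 1)).countP isComma = d - a := by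
    rw [h1, List.countP_append, List.countP_map, List.countP_cons_of_pos rfl, hcount, hlen]
    have : (isComma : Symb d → Bool) ∘ Symb.bit = fun _ => false := rfl
    rw [this]
    have := a.2
    simp
    omega
  have hlt : ∀ p q, p < q → w[q]? = some .comma →
      (w.drop (q + 1)).countP isComma < (w.drop (p + 1)).countP isComma := by
    intro p q hpq hq
    obtain ⟨k, rfl⟩ := Nat.exists_eq_add_of_lt hpq
    refine (succ_le_countP_comma_iff _ _).2 ⟨k, ?_, ?_⟩
    · rw [List.getElem?_drop, ← hq, Nat.add_right_comm]
    · rw [List.drop_drop, show p + 1 + (k + 1) = p + k + 1 + 1 by omega]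
  have huniq : ∀ p, w[p]? = some .comma → (w.drop (p + 1)).countP isComma = d - a →
      p = X.length := by
    intro p hp hcp
    rcases lt_trichotomy p X.length with h | h | h
    · have := hlt _ _ h e0
      omega
    · exact h
    · have := hlt _ _ h hp
      omega
  have hbit : ((∀ k < i, ∃ b, w[X.length + 1 + k]? = some (.bit b)) ∧
      w[X.length + 1 + i]? = some (.bit true)) ↔ (K a).bits[i]? = some true := by
    simp only [getElem?_of_drop h1]
    have hlt : ∀ k < (K a).bits.length, ((K a).bits.map Symb.bit ++
        (.comma :: l₂.flatMap fun b => encBinary (K b)))[k]? =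
        ((K a).bits[k]?).map (Symb.bit : Bool → Symb d) := by
      intro k hk
      rw [List.getElem?_append_left (by simpa using hk), List.getElem?_map]
    have heq : ((K a).bits.map Symb.bit ++
        (.comma :: l₂.flatMap fun b => encBinary (K b)))[(K a).bits.length]? =
        some (.comma : Symb d) := by
      rw [List.getElem?_append_right (by simp)]
      simp
    constructor
    · rintro ⟨h2, h3⟩
      rcases lt_trichotomy i (K a).bits.length with h | h | h
      · rw [hlt i h] at h3
        simpa using h3
      · rw [h, heq] at h3
        cases h3
      · obtain ⟨b, hb⟩ := h2 _ h
        rw [heq] at hb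
        cases hb
    · intro h
      have hi := (List.getElem?_eq_some_iff.1 h).1
      refine ⟨fun k hk => ⟨(K a).bits[k], ?_⟩, ?_⟩
      · rw [hlt k (by omega), List.getElem?_eq_getElem (by omega)]
        rfl
      · rw [hlt i hi, h]
        rfl
  have htest : (K a).bits[i]? = some true ↔ (K a).testBit i = true := by
    rw [Nat.testBit_eq_inth, List.getI_eq_getElem?_getD]
    cases (K a).bits[i]? with
    | none => simp
    | some b => simp
  rw [← htest, ← hbit]
  simp only [BitIn, commasAfter_iff]
  constructor
  · rintro ⟨p, -, h2, h3, h4⟩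
    obtain rfl := huniq p h2 (by omega)
    exact h4
  · intro h
    exact ⟨X.length, (List.getElem?_eq_some_iff.1 e0).1, e0, by omega, h⟩

end RegGrammarDesc

/-! ### The search as a program -/

namespace StackProg

theorem trunc_trunc {k k' : ℕ} (h : k ≤ k') (e : ℕ → ℕ) : trunc k (trunc k' e) = trunc k e := by
  funext j
  simp only [trunc]
  split_ifs <;> first | rfl | omega

namespace Test

/-- Nested bounded quantifiers, one for each entry of the tuple. -/
theorem exists_tuple {α : Type} {m k : ℕ} {f : (ℕ → ℕ) → ℕ} (hf : IsTm α k f)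
    {Q : List α → (ℕ → Bool) → (ℕ → ℕ) → (Fin m → ℕ) → Prop}
    (hQ : ∀ k' ≥ k, ∀ x : Fin m → (ℕ → ℕ) → ℕ, (∀ j, IsTm α k' (x j)) →
      Test k' fun w T e => Q w T (trunc k e) fun j => x j e) :
    Test k fun w T e => ∃ x : Fin m → ℕ, (∀ j, x j < f e) ∧ Q w T e x := by
  induction m generalizing k f with
  | zero =>
    refine (hQ k le_rfl (fun j => j.elim0) fun j => j.elim0).congr fun w T e he => ?_
    rw [trunc_eq_self he]
    constructor
    · exact fun h => ⟨_, fun j => j.elim0, h⟩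
    · rintro ⟨x, -, h⟩
      convert h using 1
  | succ m ih =>
    refine (exists_lt hf (Q := fun w T e x => ∃ x' : Fin m → ℕ, (∀ j, x' j < f e) ∧
      Q w T e (Fin.cons x x')) fun k' hk x hx => ?_).congr fun w T e _ => ?_
    · refine ih (hf.trunc hk) (Q := fun w T e x' => Q w T (trunc k e) (Fin.cons (x e) x'))
        fun k'' hk' x' hx' => ?_
      refine (hQ k'' (hk.trans hk') (Fin.cons (fun e => x (trunc k' e)) x')
        (Fin.cases (hx.trunc hk') hx')).congr fun w T e _ => ?_
      rw [trunc_trunc hk]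
      refine iff_of_eq (congrArg _ (funext fun j => ?_))
      cases j using Fin.cases <;> rfl
    · constructor
      · rintro ⟨x, hx, x', hx', h⟩
        exact ⟨Fin.cons x x', Fin.cases hx hx', h⟩
      · rintro ⟨x, hx, h⟩
        exact ⟨x 0, hx 0, Fin.tail x, fun j => hx _, by rwa [Fin.cons_self_tail]⟩

theorem symb {α : Type} {k : ℕ} {f : (ℕ → ℕ) → ℕ} (hf : IsTm α k f) (s : Option α → Prop) :
    Test k fun w _ e => s w[f e]? := by
  classical
  exact (inp hf fun o => decide (s o)).congr fun w T e _ => decide_eq_true_iff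

end Test

end StackProg

namespace RegGrammarDesc

open StackProg LabelledWalk

variable {d k : ℕ}

section word

variable {L p m t u i : (ℕ → ℕ) → ℕ}

theorem test_numAt (hp : IsTm (Symb d) k p) (hm : IsTm (Symb d) k m) :
    Test k fun (w : List (Symb d)) _ e => NumAt w (p e) (m e) :=
  (Test.forall_lt (Q := fun w _ e i => w[p e + i]? = some .tick) hm fun _ hk _ hx =>
    Test.symb ((hp.trunc hk).add hx) (· = some .tick)).and
  (Test.symb (hp.add hm) (· = some .comma))

theorem test_startAt (hL : IsTm (Symb d) k L) (hu : IsTm (Symb d) k u) :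
    Test k fun (w : List (Symb d)) _ e => StartAt w (L e) (u e) :=
  Test.exists_lt (Q := fun w _ e n => NumAt w 0 n ∧ NumAt w (n + 1) (u e)) hL fun _ hk _ hx =>
    (test_numAt (IsTm.const 0) hx).and (test_numAt (hx.add (IsTm.const 1)) (hu.trunc hk))

theorem test_ruleIn (hL : IsTm (Symb d) k L) (ht : IsTm (Symb d) k t) (a : Option (Fin d))
    (hu : IsTm (Symb d) k u) :
    Test k fun (w : List (Symb d)) _ e => RuleIn w (L e) (t e) a (u e) :=
  Test.exists_lt (Q := fun w _ e p => w[p]? = some .rule ∧ NumAt w (p + 1) (t e) ∧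
      w[p + t e + 2]? = some (letterSymb a) ∧
      ((w[p + t e + 3]? = some .noState ∧ u e = L e) ∨ NumAt w (p + t e + 3) (u e))) hL
    fun _ hk _ hx =>
      have ht' := ht.trunc hk
      (Test.symb hx (· = some .rule)).and <|
      (test_numAt (hx.add (IsTm.const 1)) ht').and <|
      (Test.symb ((hx.add ht').add (IsTm.const 2)) (· = some (letterSymb a))).and <|
      ((Test.symb ((hx.add ht').add (IsTm.const 3)) (· = some .noState)).and
        (Test.eq (hu.trunc hk) (hL.trunc hk))).or
      (test_numAt ((hx.add ht').add (IsTm.const 3)) (hu.trunc hk))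

theorem test_commasAfter (hL : IsTm (Symb d) k L) (n : ℕ) (hp : IsTm (Symb d) k p) :
    Test k fun (w : List (Symb d)) _ e => CommasAfter w (L e) n (p e) := by
  induction n generalizing k L p with
  | zero => exact Test.const True
  | succ n ih =>
    exact Test.exists_lt (Q := fun w _ e q => p e < q ∧ w[q]? = some .comma ∧
      CommasAfter w (L e) n q) hL fun _ hk _ hx =>
        (Test.lt (hp.trunc hk) hx).and <| (Test.symb hx (· = some .comma)).and <|
          ih (hL.trunc hk) hx

theorem test_bitIn (hL : IsTm (Symb d) k L) (a : Fin d) (hi : IsTm (Symb d) k i) :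
    Test k fun (w : List (Symb d)) _ e => BitIn w (L e) a (i e) :=
  Test.exists_lt (Q := fun w _ e p => w[p]? = some .comma ∧
      (CommasAfter w (L e) (d - a) p ∧ ¬ CommasAfter w (L e) (d - a + 1) p) ∧
      (∀ k < i e, ∃ b, w[p + 1 + k]? = some (.bit b)) ∧ w[p + 1 + i e]? = some (.bit true)) hL
    fun _ hk x hx =>
      have hx1 := hx.add (IsTm.const 1)
      have hi' := hi.trunc hk
      (Test.symb hx (· = some .comma)).and <|
      ((test_commasAfter (hL.trunc hk) _ hx).and (test_commasAfter (hL.trunc hk) _ hx).not).and <|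
      (Test.forall_lt (Q := fun w _ e k => ∃ b, w[x e + 1 + k]? = some (.bit b)) hi'
        fun _ hk' _ hy => Test.symb ((hx1.trunc hk').add hy) fun o => ∃ b, o = some (.bit b)).and
      (Test.symb (hx1.add hi') (· = some (.bit true)))

end word

/-- The entries of a configuration. -/
def Config.reg (c : Config d) : Fin 3 ⊕ Fin d ⊕ Fin d → ℕ :=
  Sum.elim ![c.o, c.t, c.i] (Sum.elim c.s c.w)

theorem Config.reg_injective : Function.Injective (Config.reg (d := d)) := by
  intro c c' h
  ext j
  · exact congrFun h (.inl 0)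
  · exact congrFun h (.inl 1)
  · exact congrFun h (.inl 2)
  · exact congrFun h (.inr (.inl j))
  · exact congrFun h (.inr (.inr j))

theorem Config.Lt.reg {c : Config d} {N : ℕ} (h : c.Lt N) (r : Fin 3 ⊕ Fin d ⊕ Fin d) :
    c.reg r < N := by
  obtain ⟨h1, h2, h3, h4, h5⟩ := h
  rcases r with r | j | a
  · fin_cases r
    · exact h1
    · exact h2
    · exact h3
  · exact h4 j
  · exact h5 a

/-- The number of a configuration. -/
noncomputable def Config.code (N : ℕ) (c : Config d) : ℕ :=
  Nat.ofDigits N ((Finset.univ : Finset (Fin 3 ⊕ Fin d ⊕ Fin d)).toList.map c.reg)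

theorem Config.code_injOn {N : ℕ} (hN : 1 < N) {c c' : Config d} (hc : c.Lt N) (hc' : c'.Lt N)
    (h : c.code N = c'.code N) : c = c' := by
  have hlt : ∀ {c : Config d}, c.Lt N →
      ∀ x ∈ (Finset.univ : Finset (Fin 3 ⊕ Fin d ⊕ Fin d)).toList.map c.reg, x < N := by
    intro c hc x hx
    obtain ⟨r, -, rfl⟩ := List.mem_map.1 hx
    exact hc.reg r
  have h1 := Nat.ofDigits_inj_of_len_eq hN (by simp) (hlt hc) (hlt hc') h
  exact Config.reg_injective (funext fun r =>
    List.map_inj_left.1 h1 r (Finset.mem_toList.2 (Finset.mem_univ r)))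

theorem Config.code_lt {N : ℕ} (hN : 1 < N) {c : Config d} (hc : c.Lt N) :
    c.code N < N ^ (2 * d + 3) := by
  have h : ((Finset.univ : Finset (Fin 3 ⊕ Fin d ⊕ Fin d)).toList.map c.reg).length = 2 * d + 3 := by
    simp
    omega
  rw [← h]
  refine Nat.ofDigits_lt_base_pow_length hN fun x hx => ?_
  obtain ⟨r, -, rfl⟩ := List.mem_map.1 hx
  exact hc.reg r

/-- The configuration is marked in the table. -/
def InTab (T : ℕ → Bool) (N : ℕ) (c : Config d) : Prop :=
  c.Lt N ∧ T (c.code N) = true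

/-- The entries of a configuration can be computed from the first `k` counters. -/
structure IsTmConfig (k : ℕ) (c : (ℕ → ℕ) → Config d) : Prop where
  o : IsTm (Symb d) k fun e => (c e).o
  t : IsTm (Symb d) k fun e => (c e).t
  i : IsTm (Symb d) k fun e => (c e).i
  s : ∀ j, IsTm (Symb d) k fun e => (c e).s j
  w : ∀ a, IsTm (Symb d) k fun e => (c e).w a

theorem IsTmConfig.trunc {c : (ℕ → ℕ) → Config d} {k k' : ℕ} (hc : IsTmConfig k c) (h : k ≤ k') :
    IsTmConfig k' fun e => c (trunc k e) :=
  ⟨hc.o.trunc h, hc.t.trunc h, hc.i.trunc h, fun j => (hc.s j).trunc h, fun a => (hc.w a).trunc h⟩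

section step

variable {c : (ℕ → ℕ) → Config d} {L N v : (ℕ → ℕ) → ℕ}

theorem IsTmConfig.code (hc : IsTmConfig k c) (hN : IsTm (Symb d) k N) :
    IsTm (Symb d) k fun e => (c e).code (N e) := by
  refine IsTm.ofDigits hN _ (fun r e => (c e).reg r) fun r _ => ?_
  rcases r with r | j | a
  · fin_cases r
    · exact hc.o
    · exact hc.t
    · exact hc.i
  · exact hc.s j
  · exact hc.w a

theorem isTm_update {f : Fin d → (ℕ → ℕ) → ℕ} (hf : ∀ j, IsTm (Symb d) k (f j)) (j : Fin d)
    (hv : IsTm (Symb d) k v) (j' : Fin d) :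
    IsTm (Symb d) k fun e => Function.update (fun j => f j e) j (v e) j' := by
  by_cases h : j' = j
  · subst h
    simpa using hv
  · simpa [h] using hf j'

theorem test_inTab (hc : IsTmConfig k c) (hN : IsTm (Symb d) k N) :
    Test k fun (_ : List (Symb d)) T e => InTab T (N e) (c e) :=
  ((Test.lt hc.o hN).and <| (Test.lt hc.t hN).and <| (Test.lt hc.i hN).and <|
    (Test.forallFintype fun j => Test.lt (hc.s j) hN).and
    (Test.forallFintype fun a => Test.lt (hc.w a) hN)).and (Test.tab (hc.code hN))

/-- `Step` is a formula in testable atoms. Its numerical quantifiers can be bounded by `N` because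
every witness is an entry of a configuration in the table, and `InTab` requires entries below `N`.
-/
theorem test_step (hc : IsTmConfig k c) (hL : IsTm (Symb d) k L) (hN : IsTm (Symb d) k N) :
    Test k fun (w : List (Symb d)) T e => Step (RuleIn w (L e)) (StartAt w (L e)) (L e)
      (BitIn w (L e)) (InTab T (N e)) (c e) := by
  refine Test.or ?_ (Test.or ?_ (Test.or ?_ (Test.or ?_ ?_)))
  · exact (Test.eq hc.o hL).and <| (test_startAt hL hc.t).and <| (Test.eq hc.i (IsTm.const 0)).and <|
      (Test.forallFintype fun j => Test.eq (hc.s j) hc.t).and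
      (Test.forallFintype fun a => Test.eq (hc.w a) (IsTm.const 0))
  · refine Test.existsFintype fun j => (Test.eq hc.o hL).and <| (Test.eq hc.t hL).not.and <|
      (Test.eq (hc.s j) hc.t).and ?_
    refine (Test.exists_lt (Q := fun _ T e v => InTab T (N e)
      { c e with s := Function.update (c e).s j v }) hN fun k' hk x hx => ?_).congr
      fun w T e _ => ⟨fun ⟨v, _, h⟩ => ⟨v, h⟩, fun ⟨v, h⟩ => ⟨v, ?_, h⟩⟩
    · have hc' := hc.trunc hk
      exact test_inTab ⟨hc'.o, hc'.t, hc'.i, isTm_update hc'.s j hx, hc'.w⟩ (hN.trunc hk)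
    · have := h.1.2.2.2.1 j
      rwa [show ({ c e with s := Function.update (c e).s j v } : Config d).s j = v from
        Function.update_self ..] at this
  · refine Test.existsFintype fun a => ?_
    cases a with
    | none =>
      refine (Test.exists_lt (Q := fun w T e t => RuleIn w (L e) t none (c e).t ∧
        InTab T (N e) { c e with t := t }) hN fun k' hk x hx => ?_).congr
        fun w T e _ => ⟨fun ⟨v, _, h⟩ => ⟨v, h⟩, fun ⟨v, h⟩ => ⟨v, h.2.1.2.1, h⟩⟩
      have hc' := hc.trunc hk
      exact (test_ruleIn (hL.trunc hk) hx _ hc'.t).and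
        (test_inTab ⟨hc'.o, hx, hc'.i, hc'.s, hc'.w⟩ (hN.trunc hk))
    | some b =>
      refine (Test.exists_lt (Q := fun w T e t => RuleIn w (L e) t (some b) (c e).t ∧
        ∃ v < N e, (c e).w b = v + 1 ∧ InTab T (N e)
          { c e with t := t, w := Function.update (c e).w b v }) hN fun k' hk x hx => ?_).congr
        fun w T e _ => ⟨fun ⟨t, _, h, v, _, h'⟩ => ⟨t, h, v, h'⟩,
          fun ⟨t, h, v, h1, h2⟩ => ⟨t, h2.1.2.1, h, v, ?_, h1, h2⟩⟩
      · have hc' := hc.trunc hk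
        refine (test_ruleIn (hL.trunc hk) hx _ hc'.t).and ?_
        refine Test.exists_lt (Q := fun w T e v => (c (trunc k e)).w b = v + 1 ∧
          InTab T (N (trunc k e)) { c (trunc k e) with
            t := x e, w := Function.update (c (trunc k e)).w b v }) (hN.trunc hk)
          fun k'' hk' y hy => ?_
        have hc'' := hc'.trunc hk'
        exact (Test.eq (hc''.w b) (hy.add (IsTm.const 1))).and
          (test_inTab ⟨hc''.o, hx.trunc hk', hc''.i, hc''.s, isTm_update hc''.w b hy⟩
            ((hN.trunc hk).trunc hk'))
      · have := h2.1.2.2.2.2 b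
        rwa [show ({ c e with t := t, w := Function.update (c e).w b v } : Config d).w b = v from
          Function.update_self ..] at this
  · refine Test.existsFintype fun j => (Test.eq hc.o hc.t).and <| (Test.eq hc.o (hc.s j)).and ?_
    refine (Test.exists_lt (Q := fun _ T e z => InTab T (N e) { c e with o := z, t := z }) hN
      fun k' hk x hx => ?_).congr
      fun w T e _ => ⟨fun ⟨v, _, h⟩ => ⟨v, h⟩, fun ⟨v, h⟩ => ⟨v, h.1.1, h⟩⟩
    have hc' := hc.trunc hk
    exact test_inTab ⟨hx, hx, hc'.i, hc'.s, hc'.w⟩ (hN.trunc hk)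
  · refine (Test.eq hc.o hc.t).and ?_
    refine (Test.exists_lt (Q := fun w T e i => (c e).i = i + 1 ∧ ∃ β : Fin d → Bool,
      (∀ a, BitIn w (L e) a i ↔ β a = true) ∧ InTab T (N e)
        { c e with i := i, w := fun a => 2 * (c e).w a + (β a).toNat }) hN
      fun k' hk x hx => ?_).congr
      fun w T e _ => ⟨fun ⟨v, _, h⟩ => ⟨v, h⟩, fun ⟨v, h, β, h'⟩ => ⟨v, h'.2.1.2.2.1, h, β, h'⟩⟩
    have hc' := hc.trunc hk
    refine (Test.eq hc'.i (hx.add (IsTm.const 1))).and (Test.existsFintype fun β => ?_)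
    exact (Test.forallFintype fun a => (test_bitIn (hL.trunc hk) a hx).iff (Test.const _)).and
      (test_inTab ⟨hc'.o, hc'.t, hx, hc'.s,
        fun a => ((IsTm.const 2).mul (hc'.w a)).add (IsTm.const _)⟩ (hN.trunc hk))

end step

theorem Step.mono {E : ℕ → Option (Fin d) → ℕ → Prop} {St : ℕ → Prop} {bot : ℕ}
    {Bit : Fin d → ℕ → Prop} {C C' : Config d → Prop} (hC : ∀ c, C c → C' c) {y : Config d}
    (h : Step E St bot Bit C y) : Step E St bot Bit C' y := by
  rcases h with h | ⟨j, h1, h2, h3, v, h⟩ | ⟨a, t, h1, h⟩ | ⟨j, h1, h2, z, h⟩ | ⟨h1, i, h2, β, h3, h⟩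
  · exact Or.inl h
  · exact Or.inr (Or.inl ⟨j, h1, h2, h3, v, hC _ h⟩)
  · refine Or.inr (Or.inr (Or.inl ⟨a, t, h1, ?_⟩))
    cases a with
    | none => exact hC _ h
    | some b =>
      obtain ⟨v, h2, h⟩ := h
      exact ⟨v, h2, hC _ h⟩
  · exact Or.inr (Or.inr (Or.inr (Or.inl ⟨j, h1, h2, z, hC _ h⟩)))
  · exact Or.inr (Or.inr (Or.inr (Or.inr ⟨h1, i, h2, β, h3, hC _ h⟩)))

end RegGrammarDesc

/-! ### The main theorem -/

namespace RegGrammarDesc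

open StackProg LabelledWalk

variable {d : ℕ}

theorem baseBound_mono {m n : ℕ} (h : m ≤ n) : baseBound d m ≤ baseBound d n := by
  unfold baseBound
  gcongr

/-- The range of the entries of the configurations, for inputs of length `ℓ`. -/
def searchRange (d ℓ : ℕ) : ℕ :=
  2 * (baseBound d ℓ + d * ℓ) + ℓ + 1

/-- The configuration that is stored in the counters. -/
def configOf (d : ℕ) (e : ℕ → ℕ) : Config d :=
  ⟨e 0, e 1, e 2, fun j => e (3 + j), fun a => e (3 + d + a)⟩

theorem isTmConfig_configOf {k : ℕ} (h : 2 * d + 3 ≤ k) : IsTmConfig k (configOf d) :=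
  ⟨IsTm.var (by omega), IsTm.var (by omega), IsTm.var (by omega), fun j => IsTm.var (by omega),
    fun a => IsTm.var (by omega)⟩

theorem isTm_searchRange {k : ℕ} {L : (ℕ → ℕ) → ℕ} (hL : IsTm (Symb d) k L) :
    IsTm (Symb d) k fun e => searchRange d (L e) := by
  have h1 := hL.add (IsTm.const 1)
  have h2 := (((IsTm.const (d + 1)).mul hL).add (IsTm.const 1)).pow d
  exact (((IsTm.const 2).mul (((h1.pow 2).add ((h1.pow d).mul (h2.mul hL))).add
    ((IsTm.const d).mul hL))).add hL).add (IsTm.const 1)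

theorem lt_configOf {ℓ n : ℕ} {e : ℕ → ℕ} (he : InBox (2 * d + 3) ℓ n e) : (configOf d e).Lt n :=
  ⟨he.1 _ (by omega), he.1 _ (by omega), he.1 _ (by omega), fun j => he.1 _ (by omega),
    fun a => he.1 _ (by omega)⟩

theorem exists_configOf_eq {ℓ n : ℕ} {c : Config d} (hc : c.Lt n) :
    ∃ e, InBox (2 * d + 3) ℓ n e ∧ configOf d e = c := by
  obtain ⟨h0, h1, h2, h3, h4⟩ := hc
  refine ⟨fun j => if j = 0 then c.o else if j = 1 then c.t else if j = 2 then c.i else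
    if h : j - 3 < d then c.s ⟨j - 3, h⟩ else if h : j - 3 - d < d then c.w ⟨j - 3 - d, h⟩ else
    envAt (2 * d + 3) ℓ n j, ⟨fun j hj => ?_, fun j hj => ?_⟩, ?_⟩
  · dsimp only
    split_ifs
    · exact h0
    · exact h1
    · exact h2
    · exact h3 _
    · exact h4 _
    · omega
  · dsimp only
    rw [if_neg (by omega), if_neg (by omega), if_neg (by omega), dif_neg (by omega),
      dif_neg (by omega)]
  · ext j
    · rfl
    · rfl
    · rfl
    · simp only [configOf]
      rw [if_neg (by omega), if_neg (by omega), if_neg (by omega), dif_pos (by omega)]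
      congr
      omega
    · simp only [configOf]
      rw [if_neg (by omega), if_neg (by omega), if_neg (by omega), dif_neg (by omega),
        dif_pos (by omega)]
      congr
      omega

/-- The rule by which configurations are marked. -/
def Mark (d : ℕ) (w : List (Symb d)) (T : ℕ → Bool) (e : ℕ → ℕ) : Prop :=
  Step (RuleIn w (e (2 * d + 3))) (StartAt w (e (2 * d + 3))) (e (2 * d + 3))
    (BitIn w (e (2 * d + 3))) (InTab T (e (2 * d + 3 + 1))) (configOf d e)

/-- A final configuration is marked. -/
def Accepts (d : ℕ) (T : ℕ → Bool) (e : ℕ → ℕ) : Prop :=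
  ∃ o < e (2 * d + 3 + 1), ∃ s : Fin d → ℕ, (∀ j, s j < e (2 * d + 3 + 1)) ∧
    InTab T (e (2 * d + 3 + 1)) ⟨o, o, e (2 * d + 3), s, fun _ => 0⟩

theorem test_mark {k : ℕ} (hk : 2 * d + 3 + 2 ≤ k) :
    Test k fun (w : List (Symb d)) T e => Mark d w T (trunc (2 * d + 3 + 2) e) :=
  test_step ((isTmConfig_configOf (k := 2 * d + 3 + 2) (by omega)).trunc hk)
    ((IsTm.var (by omega)).trunc hk) ((IsTm.var (by omega)).trunc hk)

theorem test_accepts :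
    Test (2 * d + 3 + 2) fun (_ : List (Symb d)) T e => Accepts d T e := by
  have hN : IsTm (Symb d) (2 * d + 3 + 2) fun e => e (2 * d + 3 + 1) := IsTm.var (by omega)
  have hL : IsTm (Symb d) (2 * d + 3 + 2) fun e => e (2 * d + 3) := IsTm.var (by omega)
  refine Test.exists_lt (Q := fun _ T e o => ∃ s : Fin d → ℕ, (∀ j, s j < e (2 * d + 3 + 1)) ∧
    InTab T (e (2 * d + 3 + 1)) ⟨o, o, e (2 * d + 3), s, fun _ => 0⟩) hN fun k' hk x hx => ?_
  refine Test.exists_tuple (Q := fun _ T e s => InTab T (trunc (2 * d + 3 + 2) e (2 * d + 3 + 1))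
    ⟨x e, x e, trunc (2 * d + 3 + 2) e (2 * d + 3), s, fun _ => 0⟩) (hN.trunc hk)
    fun k'' hk' s hs => ?_
  exact test_inTab ⟨hx.trunc hk', hx.trunc hk', (hL.trunc hk).trunc hk', hs,
    fun _ => IsTm.const 0⟩ ((hN.trunc hk).trunc hk')

theorem numStates_le_length (g : RegGrammarDesc d) (K : Fin d → ℕ) :
    g.numStates ≤ (encInstance (g, K)).length := by
  simp only [encInstance, encGrammar, List.length_append, length_encUnary]
  omega

theorem lt_two_pow_length (g : RegGrammarDesc d) (K : Fin d → ℕ) (a : Fin d) :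
    K a < 2 ^ (encInstance (g, K)).length := by
  have h1 : (encBinary (K a) : List (Symb d)).length ≤ (encMultiset K).length := by
    rw [encMultiset, List.length_flatMap]
    exact List.single_le_sum (fun _ _ => Nat.zero_le _) _
      (List.mem_map.2 ⟨a, List.mem_finRange a, rfl⟩)
  have h2 : (K a).size ≤ (encInstance (g, K)).length := by
    rw [encInstance, List.length_append, ← Nat.size_eq_bits_len]
    rw [encBinary, List.length_append, List.length_map] at h1
    exact (le_of_add_le_left h1).trans (Nat.le_add_left _ _)
  exact (Nat.lt_size_self _).trans_le (Nat.pow_le_pow_right (by norm_num) h2)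

/-- The table that the program computes decides the membership problem. -/
theorem accepts_iff (g : RegGrammarDesc d) (K : Fin d → ℕ) {n : ℕ}
    (hn : n = searchRange d (encInstance (g, K)).length) :
    Accepts d ((passTab (Mark d) (fun e => (configOf d e).code (e (2 * d + 3 + 1))) (2 * d + 3)
      (encInstance (g, K)) (2 * d + 3) (envAt (2 * d + 3) (encInstance (g, K)).length n))^[
        n ^ (2 * d + 3)] fun _ => false) (envAt (2 * d + 3) (encInstance (g, K)).length n) ↔
      K ∈ g.toGrammar.out := by
  have hbot := numStates_le_length g K
  have hE : RuleIn (encInstance (g, K)) (encInstance (g, K)).length =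
      g.NumEdge (encInstance (g, K)).length := by
    funext t a u
    exact propext (ruleIn_iff g K t a u)
  have hS : StartAt (encInstance (g, K)) (encInstance (g, K)).length = (· = (g.start : ℕ)) :=
    funext fun u => propext (startAt_iff g K u)
  have hB : BitIn (encInstance (g, K)) (encInstance (g, K)).length =
      fun a i => (K a).testBit i = true := by
    funext a i
    exact propext (bitIn_iff g K a i)
  have hK := lt_two_pow_length g K
  -- Once the relations read from the word are replaced by those of the grammar and of `K`, nothing
  -- but the length of the word matters.
  generalize encInstance (g, K) = w at *
  set ℓ := w.length with hℓ
  have hℓn : ℓ < n := by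
    rw [hn, searchRange]
    omega
  have hn1 : 1 < n := by
    have : 0 < baseBound d ℓ := by
      unfold baseBound
      positivity
    rw [hn, searchRange]
    omega
  have hbound : 2 * (baseBound d g.numStates + d * g.numStates) < n := by
    have h1 := baseBound_mono (d := d) hbot
    have h2 := Nat.mul_le_mul_left d hbot
    rw [hn, searchRange]
    omega
  have hA : envAt (2 * d + 3) ℓ n (2 * d + 3) = ℓ := by simp [envAt]
  have hA1 : envAt (2 * d + 3) ℓ n (2 * d + 3 + 1) = n := by simp [envAt]
  have hmark : ∀ T e, InBox (2 * d + 3) ℓ n e → (Mark d w T e ↔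
      Step (g.NumEdge ℓ) (· = (g.start : ℕ)) ℓ (fun a i => (K a).testBit i = true) (InTab T n)
        (configOf d e)) := by
    intro T e he
    rw [Mark, he.2 _ le_rfl, he.2 _ (Nat.le_succ _), hA, hA1, hE, hS, hB]
  have hcode : ∀ e, InBox (2 * d + 3) ℓ n e →
      (configOf d e).code (e (2 * d + 3 + 1)) = (configOf d e).code n := by
    intro e he
    rw [he.range]
  constructor
  · rintro ⟨o, -, s, -, hlt, hT⟩
    rw [hA, hA1] at *
    -- Good entries are the numbers of configurations that satisfy the invariant; injectivity of
    -- `Config.code` within the range recovers the configuration.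
    obtain ⟨c, hc, hcode', hinv⟩ := iterate_passTab_sound
      (fun z => ∃ c : Config d, c.Lt n ∧ c.code n = z ∧ (g.InvFirst ℓ c ∨ g.InvLoop ℓ K c))
      (fun T hT y hy h => ⟨configOf d y, lt_configOf hy, (hcode y hy).symm,
        g.inv_of_step hbot (fun c hc => by
          obtain ⟨c', h1, h2, h3⟩ := hT _ hc.2
          rwa [Config.code_injOn hn1 h1 hc.1 h2] at h3) ((hmark T y hy).1 h)⟩)
      (by omega) _ _ hT
    rw [Config.code_injOn hn1 hc hlt hcode'] at hinv
    exact g.mem_out_of_inv hbot (y := ⟨o, o, ℓ, s, fun _ => 0⟩) hK hinv rfl fun _ => rfl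
  · intro h
    -- The final table is closed under the monotone rule, so it may play the role of the set `C` of
    -- reached configurations.
    obtain ⟨⟨o, t, i, s, v⟩, hy, ho, hi, hv⟩ := g.exists_of_mem_out
      (C := InTab ((passTab (Mark d) (fun e => (configOf d e).code (e (2 * d + 3 + 1)))
        (2 * d + 3) w (2 * d + 3) (envAt (2 * d + 3) ℓ n))^[n ^ (2 * d + 3)] fun _ => false) n)
      (fun _ h => h.1) (fun y hyn hstep => by
        obtain ⟨e, he, rfl⟩ := exists_configOf_eq (ℓ := ℓ) hyn
        refine ⟨hyn, ?_⟩
        rw [← hcode e he]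
        exact iterate_passTab_complete (by omega)
          (fun T T' e hTT' => Step.mono fun c hc => ⟨hc.1, hTT' _ hc.2⟩)
          (fun y hy => (hcode y hy).trans_lt (Config.code_lt hn1 (lt_configOf hy))) e he
          ((hmark _ e he).2 hstep)) hbot hℓn hℓn hK hbound h
    obtain rfl : o = t := ho
    obtain rfl : i = ℓ := hi
    obtain rfl : v = fun _ => 0 := funext hv
    rw [Accepts, hA, hA1]
    exact ⟨o, hy.1.1, s, hy.1.2.2.2.1, hy⟩

end RegGrammarDesc

noncomputable instance (d : ℕ) : Fintype (Symb d) := by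
  classical
  refine Fintype.ofSurjective (α := Fin 5 ⊕ Fin d ⊕ Bool)
    (Sum.elim ![.tick, .comma, .rule, .noLetter, .noState] (Sum.elim .letter .bit)) fun c => ?_
  cases c with
  | tick => exact ⟨.inl 0, rfl⟩
  | comma => exact ⟨.inl 1, rfl⟩
  | rule => exact ⟨.inl 2, rfl⟩
  | letter a => exact ⟨.inr (.inl a), rfl⟩
  | noLetter => exact ⟨.inl 3, rfl⟩
  | noState => exact ⟨.inl 4, rfl⟩
  | bit b => exact ⟨.inr (.inr b), rfl⟩

instance (d : ℕ) : Inhabited (Symb d) :=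
  ⟨.tick⟩

open StackProg RegGrammarDesc in
-- `A = 2 * d + 3` is the number of entries of a configuration; as `d` is fixed, tables and passes
-- over all configurations have polynomial size.
theorem mainTheorem3 (d : ℕ) :
    DecidableInPolyTime (encInstance (d := d))
      (fun I : RegGrammarDesc d × (Fin d → ℕ) => I.2 ∈ I.1.toGrammar.out) :=
  decidableInPolyTime_of_pass (A := 2 * d + 3)
    (isTm_searchRange (L := fun e => e (2 * d + 3)) (IsTm.var (by omega)))
    ((isTmConfig_configOf (by omega)).code (N := fun e => e (2 * d + 3 + 1)) (IsTm.var (by omega))) (fun _ => test_mark)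
    test_accepts fun I n hn => accepts_iff I.1 I.2 (by simpa using hn)
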